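/- Let $d\ge 1$ and let $\Omega\subset\mathbb R^d$ be a bounded connected open polyhedral set (its boundary is contained in a finite union of hyperplanes). Let $\gamma$ be the $(d-1)$-dimensional Lebesgue measure on hyperplanes. **Discretisations.** A discretisation $\mathcal D=(\mathcal M,\mathcal E,\mathcal P)$ of $\Omega$ consists of * a finite family $\mathcal M$ of disjoint nonempty connected open sets $K\subset\Omega$ with $\overline\Omega=\bigcup_{K\in\mathcal M}\overline K$; * a finite family $\mathcal E$ of disjoint sets $\sigma\subset\overline\Omega$, each a nonempty relatively open subset of a hyperplane with $|\sigma|=\gamma(\sigma)>0$ and with $\gamma$-negligible relative boundary $\overline\sigma\setminus\sigma$, and for each $K$ a subset $\mathcal E_K\subset\mathcal E$ with $\partial K=\bigcup_{\sigma\in\mathcal E_K}\overline\sigma$, such that for each $\sigma$ the set $\mathcal M_\sigma=\{K:\sigma\in\mathcal E_K\}$ either has one element, and then $\sigma\subset\partial\Omega$ ($\sigma\in\mathcal E_{\rm ext}$), or has two elements ($\sigma\in\mathcal E_{\rm int}$); * points $x_K\in K$ such that $K$ is star-shaped with respect to $x_K$ and such that, for $\sigma\in\mathcal E_K$, the distance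 $d_{K,\sigma}$ from $x_K$ to the hyperplane containing $\sigma$ is positive. Let $|K|$ and $h_K$ be the volume and the diameter of $K$, $h_{\mathcal D}=\max_K h_K$, $x_\sigma$ the barycentre of $\sigma$, $n_{K,\sigma}$ the unit normal to $\sigma$ outward to $K$, and $D_{K,\sigma}$ the cone with vertex $x_K$ and basis $\sigma$. Let $\mathcal B\subset\mathcal E_{\rm int}$ and $(\beta_\sigma^K)_{\sigma\in\mathcal B,K\in\mathcal M}$ be real numbers with $\sum_K\beta_\sigma^K=1$ and $\sum_K\beta_\sigma^K x_K=x_\sigma$ for $\sigma\in\mathcal B$, and let $\theta_{\mathcal D,\mathcal B}$ be the maximum of $$\frac{d_{K,\sigma}}{d_{L,\sigma}}\ (\sigma\in\mathcal E_{\rm int},\,K,L\in\mathcal M_\sigma),\qquad \frac{h_K}{d_{K,\sigma}}\ (\sigma\in\mathcal E_K),\qquad \frac{\sum_L|\beta_\sigma^L|\,|x_L-x_\sigma|^2}{h_K^2}\ (\sigma\in\mathcal E_K\cap\mathcal B).$$ **Discrete spaces and operators.** Let $X_{\mathcal D}$ be the space of all $v=((v_K)_{K\in\mathcal M},(v_\sigma)_{\sigma\in\mathcal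 E})$ with real entries, and $X_{\mathcal D,\mathcal B}$ the subspace of those $v$ with $v_\sigma=0$ for $\sigma\in\mathcal E_{\rm ext}$ and $v_\sigma=\sum_K\beta_\sigma^Kv_K$ for $\sigma\in\mathcal B$. Put $|v|_X^2=\sum_K\sum_{\sigma\in\mathcal E_K}\frac{|\sigma|}{d_{K,\sigma}}(v_\sigma-v_K)^2$. Let $\Pi_{\mathcal M}v=v_K$ on $K$, and $P_{\mathcal M}\varphi=\varphi(x_K)$ on $K$. Let $P_{\mathcal D,\mathcal B}\varphi\in X_{\mathcal D,\mathcal B}$ have the values $\varphi(x_K)$ on $K$, $0$ on $\mathcal E_{\rm ext}$, $\sum_K\beta_\sigma^K\varphi(x_K)$ on $\sigma\in\mathcal B$, and $\varphi(x_\sigma)$ on $\sigma\in\mathcal E_{\rm int}\setminus\mathcal B$. The discrete gradient is $\nabla_{\mathcal D}v=\nabla_Kv+R_{K,\sigma}v\;n_{K,\sigma}$ on $D_{K,\sigma}$, where $$\nabla_Kv=\frac1{|K|}\sum_{\sigma\in\mathcal E_K}|\sigma|(v_\sigma-v_K)n_{K,\sigma},\qquad R_{K,\sigma}v=\frac{\sqrt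 d}{d_{K,\sigma}}\bigl(v_\sigma-v_K-\nabla_Kv\cdot(x_\sigma-x_K)\bigr).$$ For linear maps $F_{K,\sigma}:X_{\mathcal D}\to\mathbb R$ put $\langle v,w\rangle_F=\sum_K\sum_{\sigma\in\mathcal E_K}F_{K,\sigma}(v)(w_K-w_\sigma)$. The scheme is: find $u_{\mathcal D}\in X_{\mathcal D,\mathcal B}$ with $$\langle u_{\mathcal D},v\rangle_F=\sum_Kv_K\int_Kf\,dx\qquad\text{for all }v\in X_{\mathcal D,\mathcal B}.$$ The SUSHI fluxes (for $\Lambda=\mathrm{Id}$) are $F_{K,\sigma}(v)=\sum_{\sigma'\in\mathcal E_K}A_K^{\sigma\sigma'}(v_K-v_{\sigma'})$ with $A_K^{\sigma\sigma'}=\sum_{\sigma''\in\mathcal E_K}|D_{K,\sigma''}|\,y^{\sigma''\sigma}\cdot y^{\sigma''\sigma'}$, where $$y^{\sigma\sigma}=\frac{|\sigma|}{|K|}n_{K,\sigma}+\frac{\sqrt d}{d_{K,\sigma}}\Bigl(1-\frac{|\sigma|}{|K|}n_{K,\sigma}\cdot(x_\sigma-x_K)\Bigr)n_{K,\sigma},$$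 $$y^{\sigma\sigma'}=\frac{|\sigma'|}{|K|}n_{K,\sigma'}-\frac{\sqrt d\,|\sigma'|}{d_{K,\sigma}|K|}\bigl(n_{K,\sigma'}\cdot(x_\sigma-x_K)\bigr)n_{K,\sigma}\qquad(\sigma\ne\sigma').$$ **Theorem.** Let $f\in L^2(\Omega)$ and let $u\in H^1_0(\Omega)$ be the weak solution of $-\Delta u=f$, that is, $\int_\Omega\nabla u\cdot\nabla v=\int_\Omega fv$ for all $v\in H^1_0(\Omega)$. Assume that $u\in C^2(\overline\Omega)$, that is, $u$ is the restriction of a $C^2$ function on $\mathbb R^d$, again denoted by $u$. Let $\alpha>0$ and $\theta\in\mathbb R$. For every discretisation $\mathcal D$ with $\mathcal B$ and $\beta$ as above and $\theta_{\mathcal D,\mathcal B}\le\theta$, and every family $F$ of linear maps with $\alpha|v|_X^2\le\langle v,v\rangle_F$ for all $v\in X_{\mathcal D}$, the scheme has a unique solution $u_{\mathcal D}$. With $$E(u)=\Bigl(\sum_{K\in\mathcal M}\sum_{\sigma\in\mathcal E_K}\frac{d_{K,\sigma}}{|\sigma|}\Bigl(F_{K,\sigma}(P_{\mathcal D,\mathcal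 B}u)+\int_\sigma\nabla u\cdot n_{K,\sigma}\,d\gamma\Bigr)^2\Bigr)^{1/2},$$ it satisfies: 1. $\|\Pi_{\mathcal M}u_{\mathcal D}-P_{\mathcal M}u\|_{L^2(\Omega)}\le C_1E(u)$, where $C_1$ depends only on $d,\Omega,\alpha,\theta$; 2. $\|\nabla_{\mathcal D}u_{\mathcal D}-\nabla u\|_{L^2(\Omega)^d}\le C_2(E(u)+h_{\mathcal D})$, where $C_2$ depends only on $d,\Omega,\alpha,\theta,u$. For the SUSHI fluxes there is a constant $C_3$ depending only on $d,\Omega,\theta,u$ such that, whenever $\theta_{\mathcal D,\mathcal B}\le\theta$, 3. $E(u)\le C_3h_{\mathcal D}$; moreover the scheme has a unique solution, and $\|\Pi_{\mathcal M}u_{\mathcal D}-P_{\mathcal M}u\|_{L^2(\Omega)}\le C_3h_{\mathcal D}$ and $\|\nabla_{\mathcal D}u_{\mathcal D}-\nabla u\|_{L^2(\Omega)^d}\le C_3h_{\mathcal D}$. -/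

import Mathlib

open MeasureTheory Filter Topology
open scoped ContDiff RealInnerProductSpace Gradient

noncomputable section

/-- The Euclidean space `ℝ^d`. -/
abbrev Pt (d : ℕ) : Type := EuclideanSpace ℝ (Fin d)

/-- The `(d-1)`-dimensional measure `γ` on `ℝ^d` (`d ≥ 1`), normalised so that it agrees with the
Lebesgue measure on hyperplanes (the counting measure if `d = 1`). -/
abbrev surf (d : ℕ) : Measure (Pt d) := μHE[d - 1]

/-- Affine hyperplanes of `ℝ^d`. -/
def IsHyperplane {d : ℕ} (H : Set (Pt d)) : Prop :=
  ∃ (n : Pt d) (c : ℝ), n ≠ 0 ∧ H = {x | ⟪n, x⟫ = c}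

/-- A set is polyhedral if its boundary is a finite union of parts of hyperplanes. -/
def IsPolyhedral {d : ℕ} (S : Set (Pt d)) : Prop :=
  ∃ 𝓗 : Set (Set (Pt d)), 𝓗.Finite ∧ (∀ H ∈ 𝓗, IsHyperplane H) ∧ frontier S ⊆ ⋃₀ 𝓗

/-- `n` is the unit vector normal to `σ` and outward to `K` (where `σ` is a relatively open subset
of a hyperplane, contained in the boundary of `K`). -/
structure IsOutwardUnitNormal {d : ℕ} (K σ : Set (Pt d)) (n : Pt d) : Prop where
  norm_eq : ‖n‖ = 1
  orthogonal : ∀ x ∈ σ, ∀ y ∈ σ, ⟪n, x - y⟫ = 0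
  outward : ∀ y ∈ σ, ∀ᶠ t in 𝓝[>] (0 : ℝ), y - t • n ∈ K ∧ y + t • n ∉ K

/-- Space discretisations `(M, E, P)` of `Ω`: control volumes, edges and points. -/
structure Discretisation {d : ℕ} (Ω : Set (Pt d)) where
  /-- index set of the control volumes -/
  Cell : Type
  /-- index set of the edges -/
  Edge : Type
  cellFintype : Fintype Cell
  edgeFintype : Fintype Edge
  edgeDecidableEq : DecidableEq Edge
  /-- the control volumes `K` -/
  cell : Cell → Set (Pt d)
  cell_open : ∀ K, IsOpen (cell K)
  cell_connected : ∀ K, IsConnected (cell K)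
  cell_subset : ∀ K, cell K ⊆ Ω
  cell_disjoint : Pairwise fun K L => Disjoint (cell K) (cell L)
  closure_eq : closure Ω = ⋃ K, closure (cell K)
  /-- the edges `σ` -/
  edge : Edge → Set (Pt d)
  /-- the hyperplane including `σ` -/
  plane : Edge → Set (Pt d)
  plane_isHyperplane : ∀ σ, IsHyperplane (plane σ)
  edge_open : ∀ σ, ∃ U, IsOpen U ∧ edge σ = U ∩ plane σ
  edge_nonempty : ∀ σ, (edge σ).Nonempty
  edge_subset : ∀ σ, edge σ ⊆ closure Ω
  edge_disjoint : Pairwise fun σ τ => Disjoint (edge σ) (edge τ)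
  edge_measure_pos : ∀ σ, 0 < surf d (edge σ)
  /-- Edges are polyhedral pieces of their hyperplane; all that is required of this is that the
  relative boundary of `σ` is negligible. -/
  edge_boundary_null : ∀ σ, surf d (closure (edge σ) \ edge σ) = 0
  /-- the set `E_K` of the edges of `K` -/
  edgesOf : Cell → Finset Edge
  frontier_eq : ∀ K, frontier (cell K) = ⋃ σ ∈ edgesOf K, closure (edge σ)
  /-- An edge belongs to exactly one control volume, and then lies on the boundary of `Ω`, or to
  exactly two. -/
  edge_cells : ∀ σ,
    (Nat.card {K // σ ∈ edgesOf K} = 1 ∧ edge σ ⊆ frontier Ω) ∨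
      Nat.card {K // σ ∈ edgesOf K} = 2
  /-- the vectors `n_{K,σ}` -/
  normal : Cell → Edge → Pt d
  normal_spec : ∀ K, ∀ σ ∈ edgesOf K, IsOutwardUnitNormal (cell K) (edge σ) (normal K σ)
  /-- the points `x_K` -/
  center : Cell → Pt d
  center_mem : ∀ K, center K ∈ cell K
  cell_starShaped : ∀ K, StarConvex ℝ (center K) (cell K)
  dist_pos : ∀ K, ∀ σ ∈ edgesOf K, 0 < Metric.infDist (center K) (plane σ)

attribute [instance] Discretisation.cellFintype Discretisation.edgeFintype
  Discretisation.edgeDecidableEq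

namespace Discretisation

variable {d : ℕ} {Ω : Set (Pt d)} (D : Discretisation Ω)

/-- The set `M_σ` of the control volumes with edge `σ`. -/
def cellsOf (σ : D.Edge) : Finset D.Cell := Finset.univ.filter fun K => σ ∈ D.edgesOf K

/-- The boundary edges `E_ext`. -/
def extEdges : Finset D.Edge := Finset.univ.filter fun σ => (D.cellsOf σ).card = 1

/-- The interior edges `E_int`. -/
def intEdges : Finset D.Edge := Finset.univ.filter fun σ => (D.cellsOf σ).card = 2

/-- The measure `|K|`. -/
def vol (K : D.Cell) : ℝ := volume.real (D.cell K)

/-- The diameter `h_K`. -/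
def diam (K : D.Cell) : ℝ := Metric.diam (D.cell K)

/-- The measure `|σ|`. -/
def area (σ : D.Edge) : ℝ := (surf d).real (D.edge σ)

/-- The barycentre `x_σ`. -/
def bary (σ : D.Edge) : Pt d := ⨍ x in D.edge σ, x ∂(surf d)

/-- The distance `d_{K,σ}` from `x_K` to the hyperplane including `σ`. -/
def dist (K : D.Cell) (σ : D.Edge) : ℝ := Metric.infDist (D.center K) (D.plane σ)

/-- The (open) cone `D_{K,σ}` with vertex `x_K` and basis `σ`. -/
def cone (K : D.Cell) (σ : D.Edge) : Set (Pt d) :=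
  {x | ∃ y ∈ D.edge σ, ∃ t ∈ Set.Ioo (0 : ℝ) 1, x = D.center K + t • (y - D.center K)}

/-- The size `h_D` of the discretisation. -/
def size : ℝ := ⨆ K, D.diam K

/-- The regularity `θ_D` of the mesh. -/
def reg : ℝ :=
  max
    (sSup {r | ∃ σ ∈ D.intEdges, ∃ K ∈ D.cellsOf σ, ∃ L ∈ D.cellsOf σ, r = D.dist K σ / D.dist L σ})
    (sSup {r | ∃ K, ∃ σ ∈ D.edgesOf K, r = D.diam K / D.dist K σ})

/-- The regularity `θ_{D,B}`, for a set `B` of interior edges and coefficients `β_σ^K`. -/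
def regB (B : Finset D.Edge) (β : D.Edge → D.Cell → ℝ) : ℝ :=
  max D.reg
    (sSup {r | ∃ K, ∃ σ ∈ D.edgesOf K, σ ∈ B ∧
      r = (∑ L, |β σ L| * ‖D.center L - D.bary σ‖ ^ 2) / D.diam K ^ 2})

/-- The coefficients `β` express the barycentres of the edges in `B` as barycentric combinations
of the points `x_K`. -/
def IsBarycentric (B : Finset D.Edge) (β : D.Edge → D.Cell → ℝ) : Prop :=
  ∀ σ ∈ B, ∑ K, β σ K = 1 ∧ D.bary σ = ∑ K, β σ K • D.center K

/-- The space `X_D` of the discrete unknowns `((v_K)_K, (v_σ)_σ)`. -/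
abbrev X : Type := (D.Cell → ℝ) × (D.Edge → ℝ)

/-- Membership in the space `X_{D,B}`. -/
def MemXB (B : Finset D.Edge) (β : D.Edge → D.Cell → ℝ) (v : D.X) : Prop :=
  (∀ σ ∈ D.extEdges, v.2 σ = 0) ∧ ∀ σ ∈ B, v.2 σ = ∑ K, β σ K * v.1 K

/-- The square of the seminorm `|v|_X`. -/
def seminormSq (v : D.X) : ℝ :=
  ∑ K, ∑ σ ∈ D.edgesOf K, D.area σ / D.dist K σ * (v.2 σ - v.1 K) ^ 2

/-- Families `(F_{K,σ})` of linear mappings from `X_D` to `ℝ`. -/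
abbrev Fluxes : Type := D.Cell → D.Edge → D.X →ₗ[ℝ] ℝ

/-- The bilinear form `⟨u, v⟩_F`. -/
def form (F : D.Fluxes) (u v : D.X) : ℝ :=
  ∑ K, ∑ σ ∈ D.edgesOf K, F K σ u * (v.1 K - v.2 σ)

/-- Coercivity of the fluxes `F` with constant `α`. -/
def IsCoercive (F : D.Fluxes) (α : ℝ) : Prop :=
  ∀ v : D.X, α * D.seminormSq v ≤ D.form F v v

/-- `w` is a solution of the scheme with fluxes `F` and right-hand side `f`. -/
def IsSchemeSolution (B : Finset D.Edge) (β : D.Edge → D.Cell → ℝ) (F : D.Fluxes) (f : Pt d → ℝ)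
    (w : D.X) : Prop :=
  D.MemXB B β w ∧
    ∀ v, D.MemXB B β v → D.form F w v = ∑ K, v.1 K * ∫ x in D.cell K, f x

/-- The piecewise constant function `Π_M v`. -/
def piM (v : D.X) (x : Pt d) : ℝ := ∑ K, (D.cell K).indicator (fun _ => v.1 K) x

/-- The piecewise constant function `P_M φ`, equal to `φ(x_K)` on `K`. -/
def projM (φ : Pt d → ℝ) (x : Pt d) : ℝ :=
  ∑ K, (D.cell K).indicator (fun _ => φ (D.center K)) x

/-- The interpolate `P_{D,B} φ`. -/
def interpB (B : Finset D.Edge) (β : D.Edge → D.Cell → ℝ) (φ : Pt d → ℝ) : D.X :=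
  (fun K => φ (D.center K),
   fun σ => if σ ∈ D.extEdges then 0
    else if σ ∈ B then ∑ K, β σ K * φ (D.center K)
    else φ (D.bary σ))

/-- The cell gradient `∇_K v`. -/
def gradK (v : D.X) (K : D.Cell) : Pt d :=
  (D.vol K)⁻¹ • ∑ σ ∈ D.edgesOf K, (D.area σ * (v.2 σ - v.1 K)) • D.normal K σ

/-- The stabilisation `R_{K,σ} v`. -/
def stab (v : D.X) (K : D.Cell) (σ : D.Edge) : ℝ :=
  Real.sqrt d / D.dist K σ *
    (v.2 σ - v.1 K - ⟪D.gradK v K, D.bary σ - D.center K⟫)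

/-- The stabilised gradient `∇_{K,σ} v`. -/
def gradKσ (v : D.X) (K : D.Cell) (σ : D.Edge) : Pt d :=
  D.gradK v K + D.stab v K σ • D.normal K σ

/-- The discrete gradient `∇_D v`, equal to `∇_{K,σ} v` on `D_{K,σ}`. -/
def gradD (v : D.X) (x : Pt d) : Pt d :=
  ∑ K, ∑ σ ∈ D.edgesOf K, (D.cone K σ).indicator (fun _ => D.gradKσ v K σ) x

/-- The vectors `y^{σσ'}` (relative to the control volume `K`). -/
def yvec (K : D.Cell) (σ σ' : D.Edge) : Pt d :=
  if σ = σ' then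
    (D.area σ / D.vol K) • D.normal K σ +
      (Real.sqrt d / D.dist K σ *
        (1 - D.area σ / D.vol K * ⟪D.normal K σ, D.bary σ - D.center K⟫)) • D.normal K σ
  else
    (D.area σ' / D.vol K) • D.normal K σ' -
      (Real.sqrt d / (D.dist K σ * D.vol K) * D.area σ' *
        ⟪D.normal K σ', D.bary σ - D.center K⟫) • D.normal K σ

/-- The local matrices `A_K^{σσ'}` for the diffusion field `Λ`. -/
def localMatrix (Λ : Pt d → Pt d →L[ℝ] Pt d) (K : D.Cell) (σ σ' : D.Edge) : ℝ :=
  ∑ τ ∈ D.edgesOf K, ⟪D.yvec K τ σ, (∫ x in D.cone K τ, Λ x) (D.yvec K τ σ')⟫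

/-- The SUSHI fluxes `F_{K,σ}(u) = ∑_{σ'} A_K^{σσ'} (u_K - u_{σ'})`. -/
def sushiFlux (Λ : Pt d → Pt d →L[ℝ] Pt d) : D.Fluxes := fun K σ =>
  ∑ σ' ∈ D.edgesOf K, D.localMatrix Λ K σ σ' •
    ((LinearMap.proj K).comp (LinearMap.fst ℝ (D.Cell → ℝ) (D.Edge → ℝ)) -
      (LinearMap.proj σ').comp (LinearMap.snd ℝ (D.Cell → ℝ) (D.Edge → ℝ)))

/-- The flux consistency error `E(u)` (for `Λ = Id`). -/
def consErr (B : Finset D.Edge) (β : D.Edge → D.Cell → ℝ) (F : D.Fluxes) (u : Pt d → ℝ) : ℝ :=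
  Real.sqrt (∑ K, ∑ σ ∈ D.edgesOf K, D.dist K σ / D.area σ *
    (F K σ (D.interpB B β u) + ∫ x in D.edge σ, ⟪∇ u x, D.normal K σ⟫ ∂(surf d)) ^ 2)

end Discretisation

/-- The norm of `L²(Ω)` or `L²(Ω)^d`, with values in `[0, ∞]`. -/
def normL2 {d : ℕ} {V : Type*} [NormedAddCommGroup V] (Ω : Set (Pt d)) (g : Pt d → V) : ENNReal :=
  eLpNorm g 2 (volume.restrict Ω)

/-- `v` belongs to `H¹₀(Ω)`, the closure of `C_c^∞(Ω)` in `H¹(Ω)`, and its weak gradient is `G`. -/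
structure HasH10Gradient {d : ℕ} (Ω : Set (Pt d)) (v : Pt d → ℝ) (G : Pt d → Pt d) : Prop where
  memLp : MemLp v 2 (volume.restrict Ω)
  memLp_grad : MemLp G 2 (volume.restrict Ω)
  approx : ∃ φ : ℕ → Pt d → ℝ,
    (∀ k, ContDiff ℝ ∞ (φ k) ∧ HasCompactSupport (φ k) ∧ tsupport (φ k) ⊆ Ω) ∧
    Tendsto (fun k => normL2 Ω (φ k - v)) atTop (𝓝 0) ∧
    Tendsto (fun k => normL2 Ω (∇ (φ k) - G)) atTop (𝓝 0)

/-- `u` is the weak solution of `-div(Λ ∇u) = f` in `Ω`, `u = 0` on the boundary. -/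
def IsWeakSolution {d : ℕ} (Ω : Set (Pt d)) (Λ : Pt d → Pt d →L[ℝ] Pt d) (f u : Pt d → ℝ) : Prop :=
  ∃ G, HasH10Gradient Ω u G ∧ ∀ v H, HasH10Gradient Ω v H →
    ∫ x in Ω, ⟪Λ x (G x), H x⟫ = ∫ x in Ω, f x * v x

/-- The constant diffusion field `Λ = Id`. -/
def idField (d : ℕ) : Pt d → Pt d →L[ℝ] Pt d := fun _ => ContinuousLinearMap.id ℝ (Pt d)

end

/-! The error `w = uD - D.interpB B β u` belongs to `X_{D,B}`, so it can serve as its own test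
function. As `u` is `C²`, it satisfies `-Δu = f` almost everywhere, and the divergence theorem on a
cell turns `∫_K f` into a sum of exact fluxes. These cancel in pairs across interior edges and `w`
vanishes on boundary edges, so `⟨w, w⟩_F` is the sum over pairs `(K, σ)` of the flux residual times
`w_σ - w_K`. Coercivity and a weighted Cauchy–Schwarz inequality give `α |w|_X ≤ E(u)`
(`sq_mul_seminormSq_sub_le`). A discrete Poincaré inequality (`cellNormSq_le`) and the stability of
the discrete gradient (`normL2_gradD_le`) convert this into the two `L²` estimates; the gradient
estimate also needs `∇_D P u` to be within `O(h)` of `∇u`.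

Most of the discrete algebra rests on one identity, `∑_σ |σ| n_{K,σ} ⊗ (x_σ - p) = |K| Id`
(`sum_area_inner_mul_inner`), the divergence theorem for affine functions. It makes `∇_K` exact on
affine functions, produces the Poincaré inequality, and makes the stabilisation orthogonal to `∇_K`.
For SUSHI the form is the `L²` product of discrete gradients. Orthogonality and mesh regularity give
coercivity. Flux consistency holds because the vectors `y^{τσ}`, weighted by cone volumes, add up to
`|σ| n_{K,σ}`.

The analytic work is the divergence theorem on cells that are merely star-shaped with flat boundary
pieces. The gauge `g` of a cell about its centre is Lipschitz and linear on each cone over an edge;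
integrating by parts against `1 - g^(k+1)` and letting `k → ∞` concentrates the radial mass on the
boundary. Cones also yield the zero trace of `u` on boundary edges, from the divergence theorem for
radial fields. -/

noncomputable section

/-! ### Cones over flat pieces: volume and polar coordinates -/

/-- The open cone with vertex `c` and basis `σ`. -/
def coneOver {d : ℕ} (c : Pt d) (σ : Set (Pt d)) : Set (Pt d) :=
  {x | ∃ y ∈ σ, ∃ t ∈ Set.Ioo (0 : ℝ) 1, x = c + t • (y - c)}

section Cone

variable {d : ℕ} {c n : Pt d} {δ : ℝ} {σ : Set (Pt d)}

/-- The parameter of a point of the cone is its height over `c` divided by `δ`, and its base point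
is the radial projection onto the plane. This presents the cone as a preimage of `σ`, whence its
measurability and openness. -/
theorem coneOver_eq (hδ : 0 < δ) (hσ : ∀ y ∈ σ, ⟪n, y - c⟫ = δ) :
    coneOver c σ = {x | ⟪n, x - c⟫ ∈ Set.Ioo 0 δ ∧ c + (δ / ⟪n, x - c⟫) • (x - c) ∈ σ} := by
  ext x
  constructor
  · rintro ⟨y, hy, t, ⟨ht0, ht1⟩, rfl⟩
    have h : ⟪n, c + t • (y - c) - c⟫ = t * δ := by
      rw [add_sub_cancel_left, inner_smul_right, hσ y hy]
    refine ⟨?_, ?_⟩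
    · rw [h]
      exact ⟨by positivity, by nlinarith⟩
    · rw [h, add_sub_cancel_left, smul_smul]
      have : δ / (t * δ) * t = 1 := by field_simp
      rw [this, one_smul]
      simpa using hy
  · rintro ⟨⟨h0, h1⟩, hx⟩
    refine ⟨_, hx, ⟪n, x - c⟫ / δ, ⟨by positivity, by rwa [div_lt_one hδ]⟩, ?_⟩
    rw [add_sub_cancel_left, smul_smul]
    have : ⟪n, x - c⟫ / δ * (δ / ⟪n, x - c⟫) = 1 := by field_simp
    rw [this, one_smul]
    simp

theorem measurableSet_coneOver (hδ : 0 < δ) (hσ : ∀ y ∈ σ, ⟪n, y - c⟫ = δ)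
    (hσm : MeasurableSet σ) : MeasurableSet (coneOver c σ) := by
  rw [coneOver_eq hδ hσ]
  have h1 : Measurable fun x : Pt d => ⟪n, x - c⟫ := by fun_prop
  refine (h1 measurableSet_Ioo).inter ?_
  have h2 : Measurable fun x : Pt d => c + (δ / ⟪n, x - c⟫) • (x - c) := by
    have := measurable_const (a := δ) |>.div h1
    fun_prop
  exact h2 hσm

theorem isOpen_coneOver (hδ : 0 < δ) {U : Set (Pt d)} (hU : IsOpen U)
    (hσU : σ = U ∩ {y | ⟪n, y - c⟫ = δ}) : IsOpen (coneOver c σ) := by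
  have hσ : ∀ y ∈ σ, ⟪n, y - c⟫ = δ := by
    intro y hy
    rw [hσU] at hy
    exact hy.2
  have : coneOver c σ =
      {x | ⟪n, x - c⟫ ∈ Set.Ioo 0 δ} ∩ (fun x => c + (δ / ⟪n, x - c⟫) • (x - c)) ⁻¹' U := by
    rw [coneOver_eq hδ hσ]
    ext x
    simp only [Set.mem_ofPred_eq, Set.mem_inter_iff, Set.mem_preimage]
    refine and_congr_right fun hx => ?_
    rw [hσU]
    refine ⟨fun h => h.1, fun h => ⟨h, ?_⟩⟩
    have := hx.1.ne'
    simp only [Set.mem_ofPred_eq, add_sub_cancel_left, inner_smul_right]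
    field_simp
  rw [this]
  have ho : IsOpen {x : Pt d | ⟪n, x - c⟫ ∈ Set.Ioo 0 δ} :=
    isOpen_Ioo.preimage (by fun_prop : Continuous fun x : Pt d => ⟪n, x - c⟫)
  refine ContinuousOn.isOpen_inter_preimage ?_ ho hU
  have h1 : Continuous fun x : Pt d => ⟪n, x - c⟫ := by fun_prop
  have h2 : ContinuousOn (fun x : Pt d => x - c) {x | ⟪n, x - c⟫ ∈ Set.Ioo 0 δ} := by fun_prop
  have h3 : ContinuousOn (fun x : Pt d => δ / ⟪n, x - c⟫) {x | ⟪n, x - c⟫ ∈ Set.Ioo 0 δ} :=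
    continuousOn_const.div h1.continuousOn fun x hx => hx.1.ne'
  exact continuousOn_const.add (h3.smul h2)

theorem coneOver_inter_plane (hδ : 0 < δ) (hσ : ∀ y ∈ σ, ⟪n, y - c⟫ = δ) (A : Set (Pt d))
    {t : ℝ} (ht : t ∈ Set.Ioo (0 : ℝ) 1) :
    A ∩ coneOver c σ ∩ {x | ⟪n, x - c⟫ = δ * t} =
      AffineMap.homothety c t '' (σ ∩ (fun y => c + t • (y - c)) ⁻¹' A) := by
  ext x
  simp only [Set.mem_inter_iff, Set.mem_ofPred_eq, Set.mem_image, Set.mem_preimage,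
    AffineMap.homothety_apply, vsub_eq_sub, vadd_eq_add]
  constructor
  · rintro ⟨⟨hA, y, hy, s, hs, rfl⟩, hx⟩
    rw [add_sub_cancel_left, inner_smul_right, hσ y hy] at hx
    have : s = t := by
      have := mul_comm δ t ▸ hx
      exact mul_right_cancel₀ hδ.ne' this
    subst this
    exact ⟨y, ⟨hy, hA⟩, add_comm _ _⟩
  · rintro ⟨y, ⟨hy, hA⟩, rfl⟩
    refine ⟨⟨by rwa [add_comm], y, hy, t, ht, add_comm _ _⟩, ?_⟩
    rw [add_sub_cancel_right, inner_smul_right, hσ y hy, mul_comm]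

/-- Slice by the planes parallel to the base. The slice at height `δ t` is the image of part of `σ`
under the homothety of ratio `t`, which scales the area by `t^(d-1)`; the substitution `s = δ t`
supplies the factor `δ`. -/
theorem volume_inter_coneOver (hn : ‖n‖ = 1) (hδ : 0 < δ) (hσ : ∀ y ∈ σ, ⟪n, y - c⟫ = δ)
    (hσm : MeasurableSet σ) {A : Set (Pt d)} (hA : MeasurableSet A) :
    volume (A ∩ coneOver c σ) = ∫⁻ t in Set.Ioo (0 : ℝ) 1,
      ENNReal.ofReal (δ * t ^ (d - 1)) * surf d (σ ∩ (fun y => c + t • (y - c)) ⁻¹' A) := by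
  have hn0 : n ≠ 0 := by
    intro h
    simp [h] at hn
  have hm := measurableSet_coneOver hδ hσ hσm
  have h := EuclideanGeometry.euclideanHausdorffMeasure_eq_lintegral c hn0 (hA.inter hm)
  have hvol : (μHE[Module.finrank ℝ (Pt d)] : Measure (Pt d)) = volume :=
    InnerProductSpace.euclideanHausdorffMeasure_eq_volume
  rw [hvol] at h
  have hfr : Module.finrank ℝ (Pt d) = d := by simp
  have hne : ‖n‖ₑ = 1 := by rw [← ofReal_norm, hn]; simp
  rw [hfr, hne, one_mul] at h
  rw [h]
  have hpl : ∀ s : ℝ, ((AffineSubspace.mk' (s • n +ᵥ c) (Submodule.span ℝ {n})ᗮ :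
      AffineSubspace ℝ (Pt d)) : Set (Pt d)) = {x | ⟪n, x - c⟫ = s} := by
    intro s
    ext x
    simp only [SetLike.mem_coe, AffineSubspace.mem_mk', vadd_eq_add, vsub_eq_sub,
      Set.mem_ofPred_eq, Submodule.mem_orthogonal_singleton_iff_inner_right]
    rw [show x - (s • n + c) = (x - c) - s • n by abel, inner_sub_right, inner_smul_right,
      real_inner_self_eq_norm_sq, hn]
    constructor <;> intro h <;> linarith
  simp_rw [hpl]
  have hzero : ∀ s, s ∉ Set.Ioo 0 δ →
      surf d (A ∩ coneOver c σ ∩ {x | ⟪n, x - c⟫ = s}) = 0 := by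
    intro s hs
    have : A ∩ coneOver c σ ∩ {x | ⟪n, x - c⟫ = s} = ∅ := by
      ext x
      simp only [Set.mem_inter_iff, Set.mem_empty_iff_false, iff_false, not_and, Set.mem_ofPred_eq]
      rintro ⟨_, hx⟩ hx'
      rw [coneOver_eq hδ hσ] at hx
      exact hs (hx' ▸ hx.1)
    rw [this, measure_empty]
  have hind : (fun s => surf d (A ∩ coneOver c σ ∩ {x | ⟪n, x - c⟫ = s})) =
      (Set.Ioo 0 δ).indicator
        (fun s => surf d (A ∩ coneOver c σ ∩ {x | ⟪n, x - c⟫ = s})) := by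
    ext s
    by_cases hs : s ∈ Set.Ioo 0 δ
    · rw [Set.indicator_of_mem hs]
    · rw [Set.indicator_of_notMem hs, hzero s hs]
  rw [hind, lintegral_indicator measurableSet_Ioo]
  have himg : (fun t : ℝ => δ * t) '' Set.Ioo 0 1 = Set.Ioo 0 δ := by
    rw [Set.image_mul_left_Ioo hδ, mul_zero, mul_one]
  rw [← himg, lintegral_image_eq_lintegral_abs_deriv_mul (f' := fun _ => δ) measurableSet_Ioo
    (fun x _ => by simpa using ((hasDerivAt_id x).const_mul δ).hasDerivWithinAt)
    (fun x _ y _ hxy => mul_left_cancel₀ hδ.ne' hxy)]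
  refine setLIntegral_congr_fun measurableSet_Ioo fun t ht => ?_
  rw [coneOver_inter_plane hδ hσ A ht, euclideanHausdorffMeasure_homothety_image _ _ ht.1.ne',
    abs_of_pos hδ, ENNReal.ofReal_mul hδ.le, mul_assoc]
  congr 1
  rw [ENNReal.smul_def, smul_eq_mul]
  congr 1
  rw [ENNReal.ofReal_pow ht.1.le, ENNReal.coe_pow]
  congr 1
  rw [← enorm_eq_nnnorm, Real.enorm_eq_ofReal ht.1.le]

theorem lintegral_coneOver_weight (hd : 0 < d) (hδ : 0 < δ) :
    ∫⁻ t in Set.Ioo (0 : ℝ) 1, ENNReal.ofReal (δ * t ^ (d - 1)) = ENNReal.ofReal (δ / d) := by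
  rw [← ofReal_integral_eq_lintegral_ofReal, integral_const_mul]
  · congr 1
    rw [← integral_Ioc_eq_integral_Ioo, ← intervalIntegral.integral_of_le zero_le_one,
      integral_pow]
    have : d - 1 + 1 = d := by omega
    have h2 : ((d - 1 : ℕ) : ℝ) + 1 = d := by exact_mod_cast this
    rw [this, h2]
    simp [hd.ne']
    rfl
  · refine (Continuous.integrableOn_Icc (by fun_prop)).mono_set Set.Ioo_subset_Icc_self
  · refine (ae_restrict_mem measurableSet_Ioo).mono fun t ht => ?_
    have := ht.1.le
    positivity

theorem volume_coneOver (hd : 0 < d) (hn : ‖n‖ = 1) (hδ : 0 < δ) (hσ : ∀ y ∈ σ, ⟪n, y - c⟫ = δ)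
    (hσm : MeasurableSet σ) :
    volume (coneOver c σ) = ENNReal.ofReal (δ / d) * surf d σ := by
  have h := volume_inter_coneOver hn hδ hσ hσm MeasurableSet.univ
  simp only [Set.univ_inter, Set.preimage_univ, Set.inter_univ] at h
  rw [h, lintegral_mul_const _ (by fun_prop), lintegral_coneOver_weight hd hδ]

theorem isBounded_coneOver (hσ : Bornology.IsBounded σ) : Bornology.IsBounded (coneOver c σ) := by
  obtain ⟨R, hR⟩ := hσ.subset_closedBall c
  refine Metric.isBounded_closedBall.subset (s := coneOver c σ) (t := Metric.closedBall c R) ?_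
  rintro _ ⟨y, hy, t, ht, rfl⟩
  have := hR hy
  rw [Metric.mem_closedBall, dist_eq_norm] at this ⊢
  rw [add_sub_cancel_left, norm_smul, Real.norm_of_nonneg ht.1.le]
  nlinarith [norm_nonneg (y - c), ht.1, ht.2]

/-- Finiteness of the area is read off from the cone: its volume is `δ / d` times the area of its
base, and a bounded cone has finite volume. -/
theorem surf_lt_top (hd : 0 < d) (hn : ‖n‖ = 1) (hδ : 0 < δ) (hσ : ∀ y ∈ σ, ⟪n, y - c⟫ = δ)
    (hσm : MeasurableSet σ) (hb : Bornology.IsBounded σ) : surf d σ < ⊤ := by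
  have h := volume_coneOver hd hn hδ hσ hσm
  have h1 : volume (coneOver c σ) < ⊤ := (isBounded_coneOver hb).measure_lt_top
  rw [h] at h1
  have h0 : ENNReal.ofReal (δ / d) ≠ 0 := by
    simp only [ne_eq, ENNReal.ofReal_eq_zero, not_le]
    positivity
  exact ENNReal.lt_top_of_mul_ne_top_right h1.ne h0

theorem volume_real_coneOver (hd : 0 < d) (hn : ‖n‖ = 1) (hδ : 0 < δ)
    (hσ : ∀ y ∈ σ, ⟪n, y - c⟫ = δ) (hσm : MeasurableSet σ) :
    volume.real (coneOver c σ) = δ / d * (surf d).real σ := by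
  rw [Measure.real, volume_coneOver hd hn hδ hσ hσm, ENNReal.toReal_mul,
    ENNReal.toReal_ofReal (by positivity), Measure.real]

/-- Lebesgue measure on a cone in polar coordinates over the basis. -/
theorem restrict_coneOver_eq_map (hn : ‖n‖ = 1) (hδ : 0 < δ)
    (hσ : ∀ y ∈ σ, ⟪n, y - c⟫ = δ) (hσm : MeasurableSet σ) (hfin : surf d σ < ⊤) :
    volume.restrict (coneOver c σ) =
      Measure.map (fun p : ℝ × Pt d => c + p.1 • (p.2 - c))
        (((volume.restrict (Set.Ioo (0 : ℝ) 1)).withDensity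
          fun t => ENNReal.ofReal (δ * t ^ (d - 1))).prod ((surf d).restrict σ)) := by
  have : IsFiniteMeasure ((surf d).restrict σ) := ⟨by simpa using hfin⟩
  have hmeas : Measurable fun p : ℝ × Pt d => c + p.1 • (p.2 - c) := by fun_prop
  ext A hA
  rw [Measure.restrict_apply hA, volume_inter_coneOver hn hδ hσ hσm hA,
    Measure.map_apply hmeas hA, Measure.prod_apply (hmeas hA)]
  have h3 : Measurable fun t : ℝ => (surf d).restrict σ
      (Prod.mk t ⁻¹' ((fun p : ℝ × Pt d => c + p.1 • (p.2 - c)) ⁻¹' A)) :=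
    measurable_measure_prodMk_left (hmeas hA)
  rw [lintegral_withDensity_eq_lintegral_mul _ (by fun_prop) h3]
  refine lintegral_congr fun t => ?_
  simp only [Pi.mul_apply]
  rw [Measure.restrict_apply (measurable_prodMk_left (hmeas hA)), Set.inter_comm]
  rfl

theorem integral_coneOver (hn : ‖n‖ = 1) (hδ : 0 < δ)
    (hσ : ∀ y ∈ σ, ⟪n, y - c⟫ = δ) (hσm : MeasurableSet σ) (hfin : surf d σ < ⊤)
    {f : Pt d → ℝ} (hf : IntegrableOn f (coneOver c σ)) :
    ∫ x in coneOver c σ, f x = ∫ t in (0 : ℝ)..1,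
      δ * t ^ (d - 1) * ∫ y in σ, f (c + t • (y - c)) ∂(surf d) := by
  have : IsFiniteMeasure ((surf d).restrict σ) := ⟨by simpa using hfin⟩
  have hmeas : Measurable fun p : ℝ × Pt d => c + p.1 • (p.2 - c) := by fun_prop
  have hmap := restrict_coneOver_eq_map hn hδ hσ hσm hfin
  rw [IntegrableOn, hmap] at hf
  rw [hmap, integral_map hmeas.aemeasurable hf.aestronglyMeasurable]
  have hf2 := (integrable_map_measure hf.aestronglyMeasurable hmeas.aemeasurable).1 hf
  have hw : (fun t : ℝ => ENNReal.ofReal (δ * t ^ (d - 1))) =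
      fun t => ((Real.toNNReal (δ * t ^ (d - 1)) : NNReal) : ENNReal) := rfl
  rw [hw] at hf2 ⊢
  rw [integral_prod (fun p : ℝ × Pt d => f (c + p.1 • (p.2 - c))) hf2, integral_withDensity_eq_integral_smul (by fun_prop),
    intervalIntegral.integral_of_le zero_le_one, integral_Ioc_eq_integral_Ioo]
  refine setIntegral_congr_fun measurableSet_Ioo fun t ht => ?_
  have : 0 ≤ δ * t ^ (d - 1) := by have := ht.1; positivity
  simp only [NNReal.smul_def, Real.coe_toNNReal _ this, smul_eq_mul]

end Cone

/-! ### Star-shaped cells and their gauge -/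

/-- A bounded open set `K`, star-shaped about `c`, whose boundary consists of the closures of
finitely many pairwise disjoint flat pieces `σ i`, relatively open in the hyperplanes
`⟪n i, y - c⟫ = δ i` with `δ i > 0`. -/
structure IsStarCell {d : ℕ} {ι : Type*} (K : Set (Pt d)) (c : Pt d) (S : Finset ι)
    (σ : ι → Set (Pt d)) (n : ι → Pt d) (δ : ι → ℝ) : Prop where
  isOpen : IsOpen K
  isBounded : Bornology.IsBounded K
  center_mem : c ∈ K
  starConvex : StarConvex ℝ c K
  norm_normal : ∀ i ∈ S, ‖n i‖ = 1
  height_pos : ∀ i ∈ S, 0 < δ i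
  exists_open : ∀ i ∈ S, ∃ U, IsOpen U ∧ σ i = U ∩ {y | ⟪n i, y - c⟫ = δ i}
  boundary_null : ∀ i ∈ S, surf d (closure (σ i) \ σ i) = 0
  frontier_eq : frontier K = ⋃ i ∈ S, closure (σ i)
  disjoint : ∀ i ∈ S, ∀ j ∈ S, i ≠ j → Disjoint (σ i) (σ j)

/-- The Minkowski functional of `K` relative to the point `c`. -/
def starGauge {d : ℕ} (K : Set (Pt d)) (c x : Pt d) : ℝ :=
  sInf {r : ℝ | 0 < r ∧ c + r⁻¹ • (x - c) ∈ K}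

/-- A continuous function which is Lipschitz at every point, with a uniform constant,
is Lipschitz. -/
theorem norm_sub_le_of_eventually_norm_sub_le {E : Type*} [NormedAddCommGroup E]
    [NormedSpace ℝ E] {f : E → ℝ} {m : ℝ} (hf : Continuous f)
    (h : ∀ x, ∀ᶠ y in 𝓝 x, |f y - f x| ≤ m * ‖y - x‖) (x y : E) :
    |f y - f x| ≤ m * ‖y - x‖ := by
  let F : ℝ → ℝ := fun t => f (x + t • (y - x))
  have hF : Continuous F := by fun_prop
  let s : Set ℝ := {t | |F t - F 0| ≤ m * ‖y - x‖ * t}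
  have hs : IsClosed s := isClosed_le (by fun_prop) (by fun_prop)
  -- Induction along the segment: the set of parameters where the bound holds is closed, contains
  -- `0`, and can be prolonged to the right of each of its points.
  have hsub : Set.Icc (0 : ℝ) 1 ⊆ s := by
    refine (hs.inter isClosed_Icc).Icc_subset_of_forall_exists_gt (by simp [s]) ?_
    rintro t ⟨hts, ht⟩ r hr
    have hc : Tendsto (fun r : ℝ => x + r • (y - x)) (𝓝 t) (𝓝 (x + t • (y - x))) :=
      Continuous.tendsto (by fun_prop) t
    have h1 := (hc.eventually (h _)).filter_mono (nhdsWithin_le_nhds (s := Set.Ioi t))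
    obtain ⟨z, hz1, hz2⟩ := (h1.and (Ioc_mem_nhdsGT hr)).exists
    refine ⟨z, ?_, hz2⟩
    have h3 : x + z • (y - x) - (x + t • (y - x)) = (z - t) • (y - x) := by module
    rw [h3, norm_smul, Real.norm_of_nonneg (by linarith [hz2.1])] at hz1
    have hts' : |F t - F 0| ≤ m * ‖y - x‖ * t := hts
    change |F z - F 0| ≤ m * ‖y - x‖ * z
    calc |F z - F 0| ≤ |F z - F t| + |F t - F 0| := abs_sub_le _ _ _
      _ ≤ m * ((z - t) * ‖y - x‖) + m * ‖y - x‖ * t := add_le_add hz1 hts'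
      _ = m * ‖y - x‖ * z := by ring
  have := hsub (Set.right_mem_Icc.2 zero_le_one)
  simpa [s, F] using this

theorem volume_hyperplane {d : ℕ} {n : Pt d} (hn : n ≠ 0) (c : Pt d) (δ : ℝ) :
    volume {x : Pt d | ⟪n, x - c⟫ = δ} = 0 := by
  let p : Pt d := c + (δ / ‖n‖ ^ 2) • n
  have hn2 : ‖n‖ ^ 2 ≠ 0 := by positivity
  have hs : {x : Pt d | ⟪n, x - c⟫ = δ} =
      ((AffineSubspace.mk' p (Submodule.span ℝ {n})ᗮ : AffineSubspace ℝ (Pt d)) : Set (Pt d)) := by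
    ext x
    simp only [SetLike.mem_coe, AffineSubspace.mem_mk', vsub_eq_sub, Set.mem_ofPred_eq,
      Submodule.mem_orthogonal_singleton_iff_inner_right, p]
    rw [show x - (c + (δ / ‖n‖ ^ 2) • n) = (x - c) - (δ / ‖n‖ ^ 2) • n by abel,
      inner_sub_right (x := n) (y := x - c) (z := (δ / ‖n‖ ^ 2) • n), inner_smul_right, real_inner_self_eq_norm_sq, div_mul_cancel₀ _ hn2, sub_eq_zero]
  rw [hs]
  refine Measure.addHaar_affineSubspace _ _ fun h => ?_
  have h1 : p + n ∈ (AffineSubspace.mk' p (Submodule.span ℝ {n})ᗮ : AffineSubspace ℝ (Pt d)) := by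
    rw [h]
    trivial
  rw [AffineSubspace.mem_mk', Submodule.mem_orthogonal_singleton_iff_inner_right] at h1
  simp at h1
  exact hn h1

namespace IsStarCell

variable {d : ℕ} {ι : Type*} {K : Set (Pt d)} {c : Pt d} {S : Finset ι} {σ : ι → Set (Pt d)}
  {n : ι → Pt d} {δ : ι → ℝ} (h : IsStarCell K c S σ n δ)

include h

theorem inner_eq {i : ι} (hi : i ∈ S) {y : Pt d} (hy : y ∈ σ i) : ⟪n i, y - c⟫ = δ i := by
  obtain ⟨U, -, hU⟩ := h.exists_open i hi
  rw [hU] at hy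
  exact hy.2

theorem inner_eq_of_mem_closure {i : ι} (hi : i ∈ S) {y : Pt d} (hy : y ∈ closure (σ i)) :
    ⟪n i, y - c⟫ = δ i := by
  have hc : IsClosed {y : Pt d | ⟪n i, y - c⟫ = δ i} :=
    isClosed_eq (by fun_prop) continuous_const
  exact closure_minimal (fun y hy => h.inner_eq hi hy) hc hy

theorem measurableSet_edge {i : ι} (hi : i ∈ S) : MeasurableSet (σ i) := by
  obtain ⟨U, hUo, hU⟩ := h.exists_open i hi
  have hc : IsClosed {y : Pt d | ⟪n i, y - c⟫ = δ i} :=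
    isClosed_eq (by fun_prop) continuous_const
  rw [hU]
  exact hUo.measurableSet.inter hc.measurableSet

theorem closure_edge_subset {i : ι} (hi : i ∈ S) : closure (σ i) ⊆ frontier K := by
  rw [h.frontier_eq]
  exact Set.subset_biUnion_of_mem (u := fun i => closure (σ i)) hi

theorem edge_subset_frontier {i : ι} (hi : i ∈ S) : σ i ⊆ frontier K :=
  subset_closure.trans (h.closure_edge_subset hi)

theorem isBounded_edge {i : ι} (hi : i ∈ S) : Bornology.IsBounded (σ i) :=
  h.isBounded.closure.subset ((h.edge_subset_frontier hi).trans frontier_subset_closure)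

theorem exists_of_mem_frontier {z : Pt d} (hz : z ∈ frontier K) : ∃ i ∈ S, z ∈ closure (σ i) := by
  rw [h.frontier_eq] at hz
  simpa using hz

theorem add_smul_mem_closure {z : Pt d} (hz : z ∈ closure K) {s : ℝ} (hs0 : 0 ≤ s)
    (hs1 : s ≤ 1) : c + s • (z - c) ∈ closure K :=
  map_mem_closure (f := fun z : Pt d => c + s • (z - c)) (by fun_prop) hz
    fun _ hy => h.starConvex.add_smul_sub_mem hy hs0 hs1

/-- Rays from the centre meet the boundary at most once. -/
theorem add_smul_mem {z : Pt d} (hz : z ∈ closure K) {s : ℝ} (hs0 : 0 ≤ s) (hs1 : s < 1) :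
    c + s • (z - c) ∈ K := by
  by_contra hcon
  -- If one point of the ray before `z` misses `K`, then a whole interval of the ray lies in the
  -- boundary. Two of its points then lie in the plane of one edge, which is impossible: that plane
  -- is at positive height over `c`, so the ray crosses it at most once.
  have hfr : ∀ r ∈ Set.Icc s 1, c + r • (z - c) ∈ frontier K := by
    intro r hr
    rw [h.isOpen.frontier_eq]
    refine ⟨h.add_smul_mem_closure hz (hs0.trans hr.1) hr.2, fun hmem => hcon ?_⟩
    rcases (hs0.trans hr.1).eq_or_lt with h0 | h0
    · have : s = 0 := le_antisymm (hr.1.trans h0.symm.le) hs0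
      simpa [this] using h.center_mem
    have := h.starConvex.add_smul_sub_mem hmem (t := s / r) (by positivity)
      ((div_le_one h0).2 hr.1)
    rwa [add_sub_cancel_left, smul_smul, div_mul_cancel₀ _ h0.ne'] at this
  have : Nonempty ι := ⟨(h.exists_of_mem_frontier (hfr s ⟨le_rfl, hs1.le⟩)).choose⟩
  choose! f hfS hf using fun r hr => h.exists_of_mem_frontier (hfr r hr)
  have hinf : (Set.Icc s 1).Infinite := Set.Icc_infinite hs1
  obtain ⟨r, hr, r', hr', hne, heq⟩ :=
    hinf.exists_ne_map_eq_of_mapsTo (t := (S : Set ι)) (f := f) hfS S.finite_toSet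
  have h1 := h.inner_eq_of_mem_closure (hfS r hr) (hf r hr)
  have h2 := h.inner_eq_of_mem_closure (hfS r' hr') (hf r' hr')
  rw [add_sub_cancel_left, inner_smul_right] at h1 h2
  rw [← heq] at h2
  have hp := h.height_pos _ (hfS r hr)
  have hq : ⟪n (f r), z - c⟫ ≠ 0 := by
    intro h0
    rw [h0, mul_zero] at h1
    exact hp.ne h1
  exact hne (mul_right_cancel₀ hq (h1.trans h2.symm))

omit h in
theorem starGauge_nonneg (x : Pt d) : 0 ≤ starGauge K c x := Real.sInf_nonneg fun _ hr => hr.1.le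

theorem starGauge_lt_iff {x : Pt d} {s : ℝ} (hs : 0 < s) :
    starGauge K c x < s ↔ c + s⁻¹ • (x - c) ∈ K := by
  have hne : {r : ℝ | 0 < r ∧ c + r⁻¹ • (x - c) ∈ K}.Nonempty := by
    have hcont : Tendsto (fun t : ℝ => c + t • (x - c)) (𝓝[>] 0) (𝓝 (c + (0 : ℝ) • (x - c))) :=
      (Continuous.tendsto (by fun_prop) 0).mono_left nhdsWithin_le_nhds
    rw [zero_smul, add_zero] at hcont
    have := hcont.eventually (h.isOpen.mem_nhds h.center_mem)
    obtain ⟨t, ht, ht0⟩ := (this.and self_mem_nhdsWithin).exists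
    have ht0 : 0 < t := ht0
    exact ⟨t⁻¹, inv_pos.2 ht0, by rwa [inv_inv]⟩
  have hbdd : BddBelow {r : ℝ | 0 < r ∧ c + r⁻¹ • (x - c) ∈ K} := ⟨0, fun r hr => hr.1.le⟩
  constructor
  · intro hlt
    obtain ⟨r, ⟨hr0, hr⟩, hrs⟩ := (csInf_lt_iff hbdd hne).1 hlt
    have := h.starConvex.add_smul_sub_mem hr (t := r / s) (by positivity)
      ((div_le_one hs).2 hrs.le)
    rw [add_sub_cancel_left, smul_smul] at this
    have e : r / s * r⁻¹ = s⁻¹ := by field_simp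
    rwa [e] at this
  · intro hmem
    have hcont : Tendsto (fun t : ℝ => c + t⁻¹ • (x - c)) (𝓝[<] s) (𝓝 (c + s⁻¹ • (x - c))) := by
      have : ContinuousAt (fun t : ℝ => c + t⁻¹ • (x - c)) s := by
        have := continuousAt_inv₀ hs.ne'
        fun_prop
      exact this.tendsto.mono_left nhdsWithin_le_nhds
    have := hcont.eventually (h.isOpen.mem_nhds hmem)
    obtain ⟨t, ht, ht0⟩ := (this.and (Ioo_mem_nhdsLT hs)).exists
    exact (csInf_le hbdd ⟨ht0.1, ht⟩).trans_lt ht0.2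

/-- The reverse implication is where `add_smul_mem` matters: the gauge cannot jump along a ray,
because shrinking a point of `closure K` strictly towards `c` lands in `K`. -/
theorem starGauge_le_iff {x : Pt d} {s : ℝ} (hs : 0 < s) :
    starGauge K c x ≤ s ↔ c + s⁻¹ • (x - c) ∈ closure K := by
  constructor
  · intro hle
    have hcont : Tendsto (fun t : ℝ => c + t⁻¹ • (x - c)) (𝓝[>] s) (𝓝 (c + s⁻¹ • (x - c))) := by
      have : ContinuousAt (fun t : ℝ => c + t⁻¹ • (x - c)) s := by
        have := continuousAt_inv₀ hs.ne'
        fun_prop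
      exact this.tendsto.mono_left nhdsWithin_le_nhds
    refine mem_closure_of_tendsto hcont ?_
    filter_upwards [self_mem_nhdsWithin] with t ht
    exact (h.starGauge_lt_iff (hs.trans ht)).1 (hle.trans_lt ht)
  · intro hmem
    refine le_of_forall_gt_imp_ge_of_dense fun t ht => ?_
    have ht0 : 0 < t := hs.trans ht
    refine ((h.starGauge_lt_iff ht0).2 ?_).le
    have := h.add_smul_mem hmem (s := s / t) (by positivity) ((div_lt_one ht0).2 ht)
    rw [add_sub_cancel_left, smul_smul] at this
    have e : s / t * s⁻¹ = t⁻¹ := by field_simp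
    rwa [e] at this

theorem starGauge_lt_one_iff {x : Pt d} : starGauge K c x < 1 ↔ x ∈ K := by
  rw [h.starGauge_lt_iff one_pos]
  simp

theorem starGauge_center : starGauge K c c = 0 := by
  refine le_antisymm (le_of_forall_gt_imp_ge_of_dense fun t ht => ?_) (starGauge_nonneg c)
  exact ((h.starGauge_lt_iff ht).2 (by simpa using h.center_mem)).le

theorem starGauge_pos {x : Pt d} (hx : x ≠ c) : 0 < starGauge K c x := by
  refine (starGauge_nonneg x).lt_of_ne fun h0 => ?_
  obtain ⟨R, hR⟩ := h.isBounded.subset_closedBall c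
  have hxc : 0 < ‖x - c‖ := norm_pos_iff.2 (sub_ne_zero.2 hx)
  have hR0 : 0 ≤ R := by
    have := hR h.center_mem
    simpa using this
  have hs : 0 < ‖x - c‖ / (R + 1) := by positivity
  have hmem := hR ((h.starGauge_lt_iff hs).1 (h0 ▸ hs))
  rw [Metric.mem_closedBall, dist_eq_norm, add_sub_cancel_left, norm_smul, norm_inv,
    Real.norm_of_nonneg hs.le] at hmem
  have e : (‖x - c‖ / (R + 1))⁻¹ * ‖x - c‖ = R + 1 := by field_simp
  linarith

theorem exists_edge_of_ne {x : Pt d} (hx : x ≠ c) : ∃ i ∈ S,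
    c + (starGauge K c x)⁻¹ • (x - c) ∈ closure (σ i) := by
  have hp := h.starGauge_pos hx
  refine h.exists_of_mem_frontier ?_
  rw [h.isOpen.frontier_eq]
  exact ⟨(h.starGauge_le_iff hp).1 le_rfl, fun hm => lt_irrefl _ ((h.starGauge_lt_iff hp).2 hm)⟩

/-- At every point the gauge coincides with one of the finitely many linear functions `⟪n i, x - c⟫
/ δ i`, because the radial projection onto the boundary lies in the plane of some edge. -/
theorem exists_starGauge_eq {x : Pt d} (hx : x ≠ c) : ∃ i ∈ S,
    starGauge K c x = ⟪n i, x - c⟫ / δ i := by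
  obtain ⟨i, hi, hmem⟩ := h.exists_edge_of_ne hx
  refine ⟨i, hi, ?_⟩
  have h1 := h.inner_eq_of_mem_closure hi hmem
  have hp := h.starGauge_pos hx
  have hd := h.height_pos i hi
  rw [add_sub_cancel_left, inner_smul_right] at h1
  rw [← h1]
  have : ⟪n i, x - c⟫ ≠ 0 := by
    intro h0
    rw [h0, mul_zero] at h1
    exact hd.ne h1
  field_simp

theorem starGauge_add_smul {y : Pt d} (hy : y ∈ frontier K) {t : ℝ} (ht : 0 < t) :
    starGauge K c (c + t • (y - c)) = t := by
  have e : c + t⁻¹ • (c + t • (y - c) - c) = y := by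
    rw [add_sub_cancel_left, smul_smul, inv_mul_cancel₀ ht.ne', one_smul]
    abel
  rw [h.isOpen.frontier_eq] at hy
  refine le_antisymm ((h.starGauge_le_iff ht).2 (e.symm ▸ hy.1 :)) (not_lt.1 fun hlt => hy.2 ?_)
  rw [h.starGauge_lt_iff ht, e] at hlt
  exact hlt

theorem starGauge_eq_of_mem_cone {i : ι} (hi : i ∈ S) {x : Pt d} (hx : x ∈ coneOver c (σ i)) :
    starGauge K c x = ⟪n i, x - c⟫ / δ i := by
  obtain ⟨y, hy, t, ht, rfl⟩ := hx
  rw [h.starGauge_add_smul (h.edge_subset_frontier hi hy) ht.1, add_sub_cancel_left,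
    inner_smul_right, h.inner_eq hi hy]
  have := h.height_pos i hi
  field_simp

theorem cone_subset {i : ι} (hi : i ∈ S) : coneOver c (σ i) ⊆ K := by
  rintro _ ⟨y, hy, t, ht, rfl⟩
  exact h.add_smul_mem (frontier_subset_closure (h.edge_subset_frontier hi hy)) ht.1.le ht.2

/-- The gauge recovers the parameter `t` of a point, hence also its base point; two cones can meet
only if their bases do. -/
theorem cone_disjoint {i j : ι} (hi : i ∈ S) (hj : j ∈ S) (hij : i ≠ j) :
    Disjoint (coneOver c (σ i)) (coneOver c (σ j)) := by
  rw [Set.disjoint_left]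
  rintro _ ⟨y, hy, t, ht, rfl⟩ ⟨z, hz, s, hs, hzs⟩
  have h1 := h.starGauge_add_smul (h.edge_subset_frontier hi hy) ht.1
  have h2 := h.starGauge_add_smul (h.edge_subset_frontier hj hz) hs.1
  rw [← hzs, h1] at h2
  subst h2
  have h3 : t • (y - c) = t • (z - c) := add_left_cancel hzs
  have h4 : y = z := sub_left_injective (smul_right_injective _ ht.1.ne' h3)
  subst h4
  exact Set.disjoint_left.1 (h.disjoint i hi j hj hij) hy hz

theorem isOpen_cone {i : ι} (hi : i ∈ S) : IsOpen (coneOver c (σ i)) := by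
  obtain ⟨U, hU, hUσ⟩ := h.exists_open i hi
  exact isOpen_coneOver (h.height_pos i hi) hU hUσ

/-- For positive levels the closed and open sublevel sets are dilates of `closure K` and of `K`.
Levels at or below zero are treated apart, since the gauge vanishes only at `c`. -/
theorem continuous_starGauge : Continuous (starGauge K c) := by
  rw [continuous_iff_lower_upperSemicontinuous]
  constructor
  · rw [lowerSemicontinuous_iff_isClosed_preimage]
    intro s
    rcases lt_trichotomy s 0 with hs | hs | hs
    · have : starGauge K c ⁻¹' Set.Iic s = ∅ := by
        ext x
        simpa using hs.trans_le (starGauge_nonneg x)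
      rw [this]
      exact isClosed_empty
    · have : starGauge K c ⁻¹' Set.Iic s = {c} := by
        ext x
        subst hs
        simp only [Set.mem_preimage, Set.mem_Iic, Set.mem_singleton_iff]
        refine ⟨fun hx => ?_, fun hx => by rw [hx, h.starGauge_center]⟩
        by_contra hne
        exact absurd (h.starGauge_pos hne) hx.not_gt
      rw [this]
      exact isClosed_singleton
    · have : starGauge K c ⁻¹' Set.Iic s = (fun x => c + s⁻¹ • (x - c)) ⁻¹' closure K := by
        ext x
        exact h.starGauge_le_iff hs
      rw [this]
      exact isClosed_closure.preimage (by fun_prop)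
  · rw [upperSemicontinuous_iff_isOpen_preimage]
    intro s
    rcases le_or_gt s 0 with hs | hs
    · have : starGauge K c ⁻¹' Set.Iio s = ∅ := by
        ext x
        simpa using hs.trans (starGauge_nonneg x)
      rw [this]
      exact isOpen_empty
    · have : starGauge K c ⁻¹' Set.Iio s = (fun x => c + s⁻¹ • (x - c)) ⁻¹' K := by
        ext x
        exact h.starGauge_lt_iff hs
      rw [this]
      exact h.isOpen.preimage (by fun_prop)

theorem abs_linear_sub_le {i : ι} (hi : i ∈ S) (x y : Pt d) :
    |⟪n i, y - c⟫ / δ i - ⟪n i, x - c⟫ / δ i| ≤ (∑ j ∈ S, (δ j)⁻¹) * ‖y - x‖ := by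
  have hp := h.height_pos i hi
  rw [← sub_div, ← inner_sub_right, sub_sub_sub_cancel_right, abs_div, abs_of_pos hp,
    div_eq_inv_mul]
  have h1 : |⟪n i, y - x⟫| ≤ ‖y - x‖ := by
    simpa [h.norm_normal i hi] using abs_real_inner_le_norm (n i) (y - x)
  refine mul_le_mul ?_ h1 (abs_nonneg _)
    (Finset.sum_nonneg fun j hj => (inv_pos.2 (h.height_pos j hj)).le)
  exact Finset.single_le_sum (f := fun j => (δ j)⁻¹)
    (fun j hj => (inv_pos.2 (h.height_pos j hj)).le) hi

/-- Locally around `x`, the linear function that represents the gauge at `y` also represents it at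
`x`, since a function that disagrees at `x` still disagrees nearby by continuity. So the gauge is
pointwise Lipschitz with a uniform constant. The sum of the `(δ j)⁻¹` is used as a common bound for
all the slopes. -/
theorem abs_starGauge_sub_le (x y : Pt d) :
    |starGauge K c y - starGauge K c x| ≤ (∑ j ∈ S, (δ j)⁻¹) * ‖y - x‖ := by
  refine norm_sub_le_of_eventually_norm_sub_le h.continuous_starGauge (fun x => ?_) x y
  have hev : ∀ i ∈ S, ∀ᶠ y in 𝓝 x, starGauge K c y = ⟪n i, y - c⟫ / δ i →
      starGauge K c x = ⟪n i, x - c⟫ / δ i := by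
    intro i _
    by_cases hx : starGauge K c x = ⟪n i, x - c⟫ / δ i
    · exact Eventually.of_forall fun _ _ => hx
    · have hc : Continuous fun y => starGauge K c y - ⟪n i, y - c⟫ / δ i := by
        have := h.continuous_starGauge
        fun_prop
      filter_upwards [hc.continuousAt.eventually_ne (sub_ne_zero.2 hx)] with y hy hy'
      exact absurd (sub_eq_zero.2 hy') hy
  filter_upwards [(Filter.eventually_all_finset S).2 hev] with y hy
  by_cases hyc : y = c
  · by_cases hxc : x = c
    · rw [hyc, hxc]
      simp
    · obtain ⟨i, hi, hxi⟩ := h.exists_starGauge_eq hxc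
      have := h.abs_linear_sub_le hi x y
      rw [← hxi] at this
      subst hyc
      rw [h.starGauge_center]
      simpa using this
  · obtain ⟨i, hi, hyi⟩ := h.exists_starGauge_eq hyc
    rw [hyi, hy i hi hyi]
    exact h.abs_linear_sub_le hi x y

/-- Off a null set, the closure of a star-shaped cell is the union of the cones over its edges. -/
theorem ae_mem_cone (hd : 0 < d) : ∀ᵐ x : Pt d, x ∈ closure K → ∃ i ∈ S, x ∈ coneOver c (σ i) := by
  have h1 : ∀ᵐ x : Pt d, ∀ i ∈ S, ⟪n i, x - c⟫ ≠ δ i := by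
    refine (Filter.eventually_all_finset S).2 fun i hi => ?_
    have hn : n i ≠ 0 := by
      intro h0
      have := h.norm_normal i hi
      simp [h0] at this
    have := volume_hyperplane hn c (δ i)
    rw [ae_iff]
    simpa using this
  -- The relative boundary of an edge has no area, so the cone over it has no volume; rays through
  -- it can be discarded.
  have h2 : ∀ᵐ x : Pt d, ∀ i ∈ S, x ∉ coneOver c (closure (σ i) \ σ i) := by
    refine (Filter.eventually_all_finset S).2 fun i hi => ?_
    have := volume_coneOver (σ := closure (σ i) \ σ i) hd (h.norm_normal i hi) (h.height_pos i hi)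
      (fun y hy => h.inner_eq_of_mem_closure hi hy.1)
      (isClosed_closure.measurableSet.diff (h.measurableSet_edge hi))
    rw [h.boundary_null i hi, mul_zero] at this
    rw [ae_iff]
    simpa using this
  have h3 : ∀ᵐ x : Pt d, x ≠ c := by
    have : Nontrivial (Pt d) := by
      have : Nonempty (Fin d) := ⟨⟨0, hd⟩⟩
      infer_instance
    rw [ae_iff]
    simp
  filter_upwards [h1, h2, h3] with x hx1 hx2 hx3 hxK
  have hxK' : starGauge K c x < 1 := by
    rw [h.starGauge_lt_one_iff]
    by_contra hcon
    have hfr : x ∈ frontier K := by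
      rw [h.isOpen.frontier_eq]
      exact ⟨hxK, hcon⟩
    obtain ⟨i, hi, hxi⟩ := h.exists_of_mem_frontier hfr
    exact hx1 i hi (h.inner_eq_of_mem_closure hi hxi)
  have hp := h.starGauge_pos hx3
  obtain ⟨i, hi, hmem⟩ := h.exists_edge_of_ne hx3
  have hxe : x = c + starGauge K c x • (c + (starGauge K c x)⁻¹ • (x - c) - c) := by
    rw [add_sub_cancel_left, smul_smul, mul_inv_cancel₀ hp.ne', one_smul]
    abel
  refine ⟨i, hi, _, ?_, _, ⟨hp, hxK'⟩, hxe⟩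
  by_contra hcon
  exact hx2 i hi ⟨_, ⟨hmem, hcon⟩, _, ⟨hp, hxK'⟩, hxe⟩

end IsStarCell

/-! ### The divergence theorem on star-shaped cells -/

/-- The probability densities `(k + 1) t^k` on `[0, 1]` concentrate at `t = 1`. -/
theorem tendsto_integral_pow_mul {F : ℝ → ℝ} (hF : Continuous F) :
    Tendsto (fun k : ℕ => ((k : ℝ) + 1) * ∫ t in (0 : ℝ)..1, t ^ k * F t) atTop (𝓝 (F 1)) := by
  have h := tendsto_setIntegral_pow_smul_of_unique_maximum_of_isCompact_of_continuousOn
    (μ := (volume : Measure ℝ)) (s := Set.Icc (0 : ℝ) 1) (x₀ := 1) (c := fun t => t) (g := F)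
    isCompact_Icc continuousOn_id (fun y hy hne => lt_of_le_of_ne hy.2 hne)
    (fun x hx => hx.1) one_pos
    (by rw [interior_Icc, closure_Ioo zero_ne_one]; exact Set.right_mem_Icc.2 zero_le_one)
    hF.continuousOn
  refine h.congr fun k => ?_
  rw [integral_Icc_eq_integral_Ioc, integral_Icc_eq_integral_Ioc,
    ← intervalIntegral.integral_of_le zero_le_one, ← intervalIntegral.integral_of_le zero_le_one,
    integral_pow]
  simp

namespace IsStarCell

variable {d : ℕ} {ι : Type*} {K : Set (Pt d)} {c : Pt d} {S : Finset ι} {σ : ι → Set (Pt d)}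
  {n : ι → Pt d} {δ : ι → ℝ} (h : IsStarCell K c S σ n δ)

include h

theorem dim_pos {i : ι} (hi : i ∈ S) : 0 < d := by
  rcases Nat.eq_zero_or_pos d with rfl | hd
  · have := h.norm_normal i hi
    simp [Subsingleton.elim (n i) 0] at this
  · exact hd

theorem surf_edge_lt_top {i : ι} (hi : i ∈ S) : surf d (σ i) < ⊤ :=
  surf_lt_top (h.dim_pos hi) (h.norm_normal i hi) (h.height_pos i hi)
    (fun _ hy => h.inner_eq hi hy) (h.measurableSet_edge hi) (h.isBounded_edge hi)

theorem integral_cone {i : ι} (hi : i ∈ S) {f : Pt d → ℝ} (hf : Continuous f) :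
    ∫ x in coneOver c (σ i), f x = ∫ t in (0 : ℝ)..1,
      δ i * t ^ (d - 1) * ∫ y in σ i, f (c + t • (y - c)) ∂(surf d) := by
  refine integral_coneOver (h.norm_normal i hi) (h.height_pos i hi)
    (fun _ hy => h.inner_eq hi hy) (h.measurableSet_edge hi) (h.surf_edge_lt_top hi) ?_
  have hc : IsCompact (closure (coneOver c (σ i))) :=
    (isBounded_coneOver (h.isBounded_edge hi)).isCompact_closure
  exact (hf.continuousOn.integrableOn_compact hc).mono_set subset_closure

/-- The cut-off functions `1 - min(g, 1)^(k+1)`, where `g` is the gauge. -/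
def cutoff (K : Set (Pt d)) (c : Pt d) (k : ℕ) (x : Pt d) : ℝ :=
  1 - min (starGauge K c x) 1 ^ (k + 1)

theorem cutoff_eq_zero (k : ℕ) {x : Pt d} (hx : x ∉ K) : cutoff K c k x = 0 := by
  have : 1 ≤ starGauge K c x := not_lt.1 fun hlt => hx (h.starGauge_lt_one_iff.1 hlt)
  simp [cutoff, this]

theorem lipschitz_cutoff (k : ℕ) : ∃ C, LipschitzWith C (cutoff K c k) := by
  have hm : 0 ≤ ∑ j ∈ S, (δ j)⁻¹ :=
    Finset.sum_nonneg fun j hj => (inv_pos.2 (h.height_pos j hj)).le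
  refine ⟨Real.toNNReal ((k + 1) * ∑ j ∈ S, (δ j)⁻¹), LipschitzWith.of_dist_le_mul fun x y => ?_⟩
  rw [Real.coe_toNNReal _ (by positivity), Real.dist_eq, dist_eq_norm, cutoff, cutoff,
    sub_sub_sub_cancel_left]
  have hx := starGauge_nonneg (K := K) (c := c) x
  have hy := starGauge_nonneg (K := K) (c := c) y
  have hx' : 0 ≤ min (starGauge K c x) 1 := le_min hx zero_le_one
  have hy' : 0 ≤ min (starGauge K c y) 1 := le_min hy zero_le_one
  refine (abs_pow_sub_pow_le _ _ _).trans ?_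
  have h1 : max |min (starGauge K c y) 1| |min (starGauge K c x) 1| ^ (k + 1 - 1) ≤ 1 := by
    refine pow_le_one₀ (le_max_of_le_left (abs_nonneg _)) (max_le ?_ ?_)
    · rw [abs_of_nonneg hy']
      exact min_le_right _ _
    · rw [abs_of_nonneg hx']
      exact min_le_right _ _
  have h2 : |min (starGauge K c y) 1 - min (starGauge K c x) 1| ≤
      (∑ j ∈ S, (δ j)⁻¹) * ‖x - y‖ := by
    refine (abs_min_sub_min_le_max _ _ _ _).trans ?_
    rw [sub_self, abs_zero, max_eq_left (abs_nonneg _), norm_sub_rev]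
    exact h.abs_starGauge_sub_le x y
  push_cast
  calc _ ≤ (∑ j ∈ S, (δ j)⁻¹) * ‖x - y‖ * (k + 1) * 1 := by gcongr; exact h1
    _ = _ := by ring

theorem hasCompactSupport_cutoff (k : ℕ) : HasCompactSupport (cutoff K c k) :=
  HasCompactSupport.intro h.isBounded.isCompact_closure
    fun _ hx => h.cutoff_eq_zero k fun hxK => hx (subset_closure hxK)

/-- The cone is open and the gauge is linear on it, so the derivative is computed exactly. -/
theorem lineDeriv_cutoff_of_mem_cone (k : ℕ) {i : ι} (hi : i ∈ S) {x : Pt d}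
    (hx : x ∈ coneOver c (σ i)) (e : Pt d) :
    lineDeriv ℝ (cutoff K c k) x e =
      -((k + 1) * (⟪n i, x - c⟫ / δ i) ^ k * (⟪n i, e⟫ / δ i)) := by
  have hev : cutoff K c k =ᶠ[𝓝 x] fun y => 1 - (⟪n i, y - c⟫ / δ i) ^ (k + 1) := by
    filter_upwards [(h.isOpen_cone hi).mem_nhds hx] with y hy
    have h1 := h.starGauge_eq_of_mem_cone hi hy
    have h2 := h.starGauge_lt_one_iff.2 (h.cone_subset hi hy)
    rw [cutoff, min_eq_left h2.le, h1]
  rw [hev.lineDeriv_eq]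
  have hL : HasLineDerivAt ℝ (fun y : Pt d => ⟪n i, y - c⟫ / δ i) (⟪n i, e⟫ / δ i) x e := by
    rw [HasLineDerivAt]
    have : (fun t : ℝ => ⟪n i, x + t • e - c⟫ / δ i) =
        fun t : ℝ => ⟪n i, x - c⟫ / δ i + t * (⟪n i, e⟫ / δ i) := by
      ext t
      rw [show x + t • e - c = (x - c) + t • e by abel, inner_add_right, inner_smul_right]
      ring
    rw [this]
    simpa using ((hasDerivAt_id (0 : ℝ)).mul_const (⟪n i, e⟫ / δ i)).const_add
      (⟪n i, x - c⟫ / δ i)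
  have hD : HasLineDerivAt ℝ (fun y : Pt d => 1 - (⟪n i, y - c⟫ / δ i) ^ (k + 1))
      (-((k + 1) * (⟪n i, x - c⟫ / δ i) ^ k * (⟪n i, e⟫ / δ i))) x e := by
    rw [HasLineDerivAt] at hL ⊢
    have := (hL.fun_pow (k + 1)).const_sub 1
    simpa using this
  exact hD.lineDeriv

theorem lineDeriv_cutoff_of_notMem (k : ℕ) {x : Pt d} (hx : x ∉ closure K) (e : Pt d) :
    lineDeriv ℝ (cutoff K c k) x e = 0 := by
  have hev : cutoff K c k =ᶠ[𝓝 x] fun _ => 0 := by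
    filter_upwards [isClosed_closure.isOpen_compl.mem_nhds hx] with y hy
    exact h.cutoff_eq_zero k fun hyK => hy (subset_closure hyK)
  rw [hev.lineDeriv_eq]
  simp [lineDeriv]

theorem ae_lineDeriv_cutoff (hd : 0 < d) (k : ℕ) (e : Pt d) :
    ∀ᵐ x : Pt d, lineDeriv ℝ (cutoff K c k) x e =
      ∑ i ∈ S, (coneOver c (σ i)).indicator
        (fun x => -((k + 1) * (⟪n i, x - c⟫ / δ i) ^ k * (⟪n i, e⟫ / δ i))) x := by
  filter_upwards [h.ae_mem_cone hd] with x hx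
  by_cases hxK : x ∈ closure K
  · obtain ⟨i, hi, hxi⟩ := hx hxK
    rw [h.lineDeriv_cutoff_of_mem_cone k hi hxi, Finset.sum_eq_single i,
      Set.indicator_of_mem hxi]
    · intro j hj hji
      exact Set.indicator_of_notMem
        (Set.disjoint_left.1 (h.cone_disjoint hi hj hji.symm) hxi) _
    · exact fun hcon => absurd hi hcon
  · rw [h.lineDeriv_cutoff_of_notMem k hxK]
    symm
    refine Finset.sum_eq_zero fun i hi => Set.indicator_of_notMem (fun hxi => hxK ?_) _
    exact subset_closure (h.cone_subset hi hxi)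

/-- In polar coordinates over the edge, the linear function that gives the gauge is just `t`. -/
theorem integral_cone_pow_mul {i : ι} (hi : i ∈ S) (k : ℕ) {a : Pt d → ℝ} (ha : Continuous a) :
    ∫ x in coneOver c (σ i), (⟪n i, x - c⟫ / δ i) ^ k * a x = δ i * ∫ t in (0 : ℝ)..1,
      t ^ k * (t ^ (d - 1) * ∫ y in σ i, a (c + t • (y - c)) ∂(surf d)) := by
  rw [h.integral_cone hi (by fun_prop), ← intervalIntegral.integral_const_mul]
  refine intervalIntegral.integral_congr fun t _ => ?_
  have : ∫ y in σ i, (⟪n i, c + t • (y - c) - c⟫ / δ i) ^ k * a (c + t • (y - c)) ∂(surf d) =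
      ∫ y in σ i, t ^ k * a (c + t • (y - c)) ∂(surf d) := by
    refine setIntegral_congr_fun (h.measurableSet_edge hi) fun y hy => ?_
    have hp := (h.height_pos i hi).ne'
    rw [add_sub_cancel_left, inner_smul_right, h.inner_eq hi hy, mul_div_assoc, div_self hp,
      mul_one]
  rw [this, integral_const_mul]
  ring

theorem integral_fderiv_mul_cutoff (hd : 0 < d) (k : ℕ) {a : Pt d → ℝ} (ha : ContDiff ℝ 1 a)
    (hac : HasCompactSupport a) (e : Pt d) :
    ∫ x in K, fderiv ℝ a x e * cutoff K c k x = ∑ i ∈ S, ⟪n i, e⟫ * ((k + 1) *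
      ∫ t in (0 : ℝ)..1, t ^ k * (t ^ (d - 1) * ∫ y in σ i, a (c + t • (y - c)) ∂(surf d))) := by
  obtain ⟨C, hC⟩ := h.lipschitz_cutoff k
  obtain ⟨C', hC'⟩ := ha.lipschitzWith_of_hasCompactSupport hac one_ne_zero
  -- The cut-off is only Lipschitz, so its derivative exists almost everywhere. The formula
  -- differentiates it in direction `-e`, which absorbs the minus sign of
  -- `lineDeriv_cutoff_of_mem_cone`.
  have h1 := hC'.integral_lineDeriv_mul_eq (μ := volume) hC (h.hasCompactSupport_cutoff k) e
  have h2 : ∫ x in K, fderiv ℝ a x e * cutoff K c k x =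
      ∫ x, lineDeriv ℝ a x e * cutoff K c k x := by
    rw [setIntegral_eq_integral_of_forall_compl_eq_zero fun x hx => by
      rw [h.cutoff_eq_zero k hx, mul_zero]]
    refine integral_congr_ae (Eventually.of_forall fun x => ?_)
    simp only
    rw [((ha.differentiable one_ne_zero) x).lineDeriv_eq_fderiv]
  rw [h2, h1]
  have hae : ∀ᵐ x : Pt d, lineDeriv ℝ (cutoff K c k) x (-e) * a x =
      ∑ i ∈ S, (coneOver c (σ i)).indicator
        (fun x => ⟪n i, e⟫ / δ i * (k + 1) * ((⟪n i, x - c⟫ / δ i) ^ k * a x)) x := by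
    filter_upwards [h.ae_lineDeriv_cutoff hd k (-e)] with x hx
    rw [hx, Finset.sum_mul]
    refine Finset.sum_congr rfl fun i _ => ?_
    by_cases hxi : x ∈ coneOver c (σ i)
    · rw [Set.indicator_of_mem hxi, Set.indicator_of_mem hxi, inner_neg_right]
      ring
    · rw [Set.indicator_of_notMem hxi, Set.indicator_of_notMem hxi, zero_mul]
  have hac' := ha.continuous
  rw [integral_congr_ae hae, integral_finsetSum]
  · refine Finset.sum_congr rfl fun i hi => ?_
    rw [integral_indicator (h.isOpen_cone hi).measurableSet, integral_const_mul,
      h.integral_cone_pow_mul hi k ha.continuous]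
    have := (h.height_pos i hi).ne'
    field_simp
  · intro i hi
    rw [integrable_indicator_iff (h.isOpen_cone hi).measurableSet]
    have hc : IsCompact (closure (coneOver c (σ i))) :=
      (isBounded_coneOver (h.isBounded_edge hi)).isCompact_closure
    refine (ContinuousOn.integrableOn_compact hc (Continuous.continuousOn ?_)).mono_set
      subset_closure
    fun_prop

/-- Let `k → ∞` in `integral_fderiv_mul_cutoff`. The cut-off tends to `1` inside `K`, and on the
other side the radial weight `(k + 1) t^k` concentrates at `t = 1`, leaving the integrals over the
edges. -/
theorem integral_fderiv_of_hasCompactSupport (hd : 0 < d) {a : Pt d → ℝ} (ha : ContDiff ℝ 1 a)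
    (hac : HasCompactSupport a) (e : Pt d) :
    ∫ x in K, fderiv ℝ a x e = ∑ i ∈ S, ⟪n i, e⟫ * ∫ y in σ i, a y ∂(surf d) := by
  have hL : Tendsto (fun k : ℕ => ∫ x in K, fderiv ℝ a x e * cutoff K c k x) atTop
      (𝓝 (∫ x in K, fderiv ℝ a x e)) := by
    have hfc : Continuous fun x => fderiv ℝ a x e :=
      (ha.continuous_fderiv one_ne_zero).clm_apply continuous_const
    refine tendsto_integral_of_dominated_convergence (fun x => ‖fderiv ℝ a x e‖) ?_ ?_ ?_ ?_
    · intro k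
      obtain ⟨C, hC⟩ := h.lipschitz_cutoff k
      exact (hfc.mul hC.continuous).aestronglyMeasurable
    · exact ((hfc.norm.continuousOn.integrableOn_compact
        h.isBounded.isCompact_closure).mono_set subset_closure)
    · intro k
      refine Eventually.of_forall fun x => ?_
      rw [norm_mul]
      refine mul_le_of_le_one_right (norm_nonneg _) ?_
      have h0 : 0 ≤ min (starGauge K c x) 1 := le_min (starGauge_nonneg x) zero_le_one
      have h1 : min (starGauge K c x) 1 ^ (k + 1) ≤ 1 := pow_le_one₀ h0 (min_le_right _ _)
      have h2 : 0 ≤ min (starGauge K c x) 1 ^ (k + 1) := by positivity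
      rw [cutoff, Real.norm_eq_abs, abs_le]
      constructor <;> linarith
    · refine (ae_restrict_mem h.isOpen.measurableSet).mono fun x hx => ?_
      have hlt := h.starGauge_lt_one_iff.2 hx
      have h1 : Tendsto (fun k : ℕ => cutoff K c k x) atTop (𝓝 (1 - 0)) := by
        refine Tendsto.const_sub _ ?_
        rw [min_eq_left hlt.le]
        exact (tendsto_pow_atTop_nhds_zero_of_lt_one (starGauge_nonneg x) hlt).comp
          (tendsto_add_atTop_nat 1)
      simpa using h1.const_mul (fderiv ℝ a x e)
  have hR : Tendsto (fun k : ℕ => ∑ i ∈ S, ⟪n i, e⟫ * (((k : ℝ) + 1) *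
      ∫ t in (0 : ℝ)..1, t ^ k * (t ^ (d - 1) * ∫ y in σ i, a (c + t • (y - c)) ∂(surf d)))) atTop
      (𝓝 (∑ i ∈ S, ⟪n i, e⟫ * ∫ y in σ i, a y ∂(surf d))) := by
    refine tendsto_finsetSum _ fun i hi => Tendsto.const_mul _ ?_
    have hcont : Continuous fun t : ℝ =>
        t ^ (d - 1) * ∫ y in σ i, a (c + t • (y - c)) ∂(surf d) := by
      refine (continuous_pow _).mul ?_
      have : IsFiniteMeasure ((surf d).restrict (σ i)) :=
        ⟨by simpa using h.surf_edge_lt_top hi⟩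
      obtain ⟨M, hM⟩ := hac.exists_bound_of_continuous ha.continuous
      have hac' := ha.continuous
      exact continuous_of_dominated (bound := fun _ => M)
        (fun t => (Continuous.aestronglyMeasurable (by fun_prop)))
        (fun t => Eventually.of_forall fun y => hM _) (integrable_const _)
        (Eventually.of_forall fun y => by fun_prop)
    have := tendsto_integral_pow_mul hcont
    simpa using this
  refine tendsto_nhds_unique hL (hR.congr fun k => ?_)
  rw [h.integral_fderiv_mul_cutoff hd k ha hac e]

/-- The divergence theorem on a star-shaped cell. -/
theorem integral_fderiv (hd : 0 < d) {a : Pt d → ℝ} (ha : ContDiff ℝ 1 a) (e : Pt d) :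
    ∫ x in K, fderiv ℝ a x e = ∑ i ∈ S, ⟪n i, e⟫ * ∫ y in σ i, a y ∂(surf d) := by
  obtain ⟨R, hR0, hR⟩ := h.isBounded.subset_ball_lt 0 c
  -- Multiplying by a bump equal to `1` on a neighbourhood of `closure K` makes the support compact
  -- without changing either side.
  let b : ContDiffBump c := ⟨R + 1, R + 2, by linarith, by linarith⟩
  have hb : ∀ x ∈ Metric.ball c (R + 1), b x = 1 := fun x hx =>
    b.one_of_mem_closedBall (Metric.ball_subset_closedBall hx)
  have hba : ∀ x ∈ Metric.ball c (R + 1), (fun x => b x * a x) x = a x := fun x hx => by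
    simp [hb x hx]
  have hcl : closure K ⊆ Metric.ball c (R + 1) :=
    (closure_mono hR).trans (Metric.closure_ball_subset_closedBall.trans
      (Metric.closedBall_subset_ball (by linarith)))
  have hmain := h.integral_fderiv_of_hasCompactSupport hd (a := fun x => b x * a x)
    (b.contDiff.mul ha) b.hasCompactSupport.mul_right e
  have h1 : ∫ x in K, fderiv ℝ (fun x => b x * a x) x e = ∫ x in K, fderiv ℝ a x e := by
    refine setIntegral_congr_fun h.isOpen.measurableSet fun x hx => ?_
    have : (fun x => b x * a x) =ᶠ[𝓝 x] a := by
      filter_upwards [Metric.isOpen_ball.mem_nhds (hcl (subset_closure hx))] with y hy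
      exact hba y hy
    rw [this.fderiv_eq]
  rw [← h1, hmain]
  refine Finset.sum_congr rfl fun i hi => ?_
  congr 1
  refine setIntegral_congr_fun (h.measurableSet_edge hi) fun y hy => ?_
  exact hba y (hcl (frontier_subset_closure (h.edge_subset_frontier hi hy)))

end IsStarCell

/-! ### Geometry of a discretisation: normals, barycentres, cone volumes -/

namespace Discretisation

variable {d : ℕ} {Ω : Set (Pt d)} (D : Discretisation Ω)

theorem mem_cellsOf {K : D.Cell} {σ : D.Edge} : K ∈ D.cellsOf σ ↔ σ ∈ D.edgesOf K := by
  simp [cellsOf]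

/-- Vectors orthogonal to a relatively open subset of a hyperplane are multiples of the normal
vector of the hyperplane. -/
theorem eq_smul_of_orthogonal {U σ : Set (Pt d)} {m n : Pt d} {b : ℝ} (hm : m ≠ 0)
    (hU : IsOpen U) (hσ : σ = U ∩ {x | ⟪m, x⟫ = b}) (hne : σ.Nonempty)
    (hn : ∀ x ∈ σ, ∀ y ∈ σ, ⟪n, x - y⟫ = 0) : n = (⟪m, n⟫ / ‖m‖ ^ 2) • m := by
  obtain ⟨y, hy⟩ := hne
  have hm2 : ‖m‖ ^ 2 ≠ 0 := by positivity
  -- Moving from `y` a little along a direction orthogonal to `m` stays in `σ`, by relative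
  -- openness.
  have key : ∀ z, ⟪m, z⟫ = 0 → ⟪n, z⟫ = 0 := by
    intro z hz
    have hyσ := hy
    rw [hσ] at hy
    have hcont : Tendsto (fun t : ℝ => y + t • z) (𝓝[≠] 0) (𝓝 (y + (0 : ℝ) • z)) :=
      (Continuous.tendsto (by fun_prop) 0).mono_left nhdsWithin_le_nhds
    rw [zero_smul, add_zero] at hcont
    obtain ⟨t, htU, ht⟩ :=
      ((hcont.eventually (hU.mem_nhds hy.1)).and self_mem_nhdsWithin).exists
    have ht0 : t ≠ 0 := ht
    have hmem : y + t • z ∈ σ := by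
      rw [hσ]
      refine ⟨htU, ?_⟩
      have h2 : ⟪m, y⟫ = b := hy.2
      simp [inner_add_right, inner_smul_right, hz, h2]
    have := hn _ hmem _ hyσ
    rw [add_sub_cancel_left, inner_smul_right] at this
    exact (mul_eq_zero.1 this).resolve_left ht0
  set z := n - (⟪m, n⟫ / ‖m‖ ^ 2) • m with hz
  have hmz : ⟪m, z⟫ = 0 := by
    rw [hz, inner_sub_right, inner_smul_right, real_inner_self_eq_norm_sq,
      div_mul_cancel₀ _ hm2, sub_self]
  have hzz : ⟪z, z⟫ = 0 := by
    conv_lhs => rw [hz]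
    rw [inner_sub_left, inner_smul_left, key z hmz, hmz]
    simp
  exact sub_eq_zero.1 (inner_self_eq_zero.1 hzz)

theorem infDist_hyperplane {n : Pt d} (hn : ‖n‖ = 1) (c : Pt d) (s : ℝ) :
    Metric.infDist c {x | ⟪n, x - c⟫ = s} = |s| := by
  have hmem : c + s • n ∈ {x : Pt d | ⟪n, x - c⟫ = s} := by
    simp [inner_smul_right, hn]
  refine le_antisymm ?_ ?_
  · refine (Metric.infDist_le_dist_of_mem hmem).trans ?_
    rw [dist_eq_norm, sub_add_cancel_left, norm_neg, norm_smul, hn, mul_one, Real.norm_eq_abs]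
  · refine (Metric.le_infDist ⟨_, hmem⟩).2 fun y hy => ?_
    have hy' : ⟪n, y - c⟫ = s := hy
    rw [← hy', dist_comm, dist_eq_norm]
    simpa [hn] using abs_real_inner_le_norm n (y - c)

theorem plane_eq_of_mem {K : D.Cell} {σ : D.Edge} (hσ : σ ∈ D.edgesOf K) {y : Pt d}
    (hy : y ∈ D.edge σ) (c : Pt d) :
    D.plane σ = {x | ⟪D.normal K σ, x - c⟫ = ⟪D.normal K σ, y - c⟫} := by
  obtain ⟨m, b, hm, hp⟩ := D.plane_isHyperplane σ
  obtain ⟨U, hU, he⟩ := D.edge_open σ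
  have hN := D.normal_spec K σ hσ
  rw [hp] at he
  have hn := eq_smul_of_orthogonal hm hU he ⟨y, hy⟩ hN.orthogonal
  have hl : ⟪m, D.normal K σ⟫ / ‖m‖ ^ 2 ≠ 0 := by
    intro h0
    rw [h0, zero_smul] at hn
    have := hN.norm_eq
    rw [hn] at this
    simp at this
  rw [he] at hy
  have hyb : ⟪m, y⟫ = b := hy.2
  rw [hp]
  ext x
  simp only [Set.mem_ofPred_eq]
  have e1 : ⟪D.normal K σ, x - c⟫ - ⟪D.normal K σ, y - c⟫ =
      (⟪m, D.normal K σ⟫ / ‖m‖ ^ 2) * (⟪m, x⟫ - b) := by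
    rw [← inner_sub_right, sub_sub_sub_cancel_right]
    conv_lhs => rw [hn]
    rw [real_inner_smul_left, inner_sub_right, hyb]
  rw [← sub_eq_zero (b := b), ← sub_eq_zero (a := ⟪D.normal K σ, x - c⟫), e1,
    mul_eq_zero]
  simp [hl]

/-- The distance is the absolute value of the height `s`, so the content is `s > 0`. If `s < 0`, a
point `y - t • n` of `K` close to `y` lies beyond the plane as seen from the centre. Contracting it
by `s / (s - t)` lands on the plane near `y`, hence in the edge; yet by star-shapedness it lands in
`K`, which is open and disjoint from its boundary. -/
theorem inner_normal_eq_dist {K : D.Cell} {σ : D.Edge} (hσ : σ ∈ D.edgesOf K) {y : Pt d}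
    (hy : y ∈ D.edge σ) : ⟪D.normal K σ, y - D.center K⟫ = D.dist K σ := by
  have hN := D.normal_spec K σ hσ
  set c := D.center K with hc
  set n := D.normal K σ with hn
  set s := ⟪n, y - c⟫ with hs
  have hp : D.plane σ = {x | ⟪n, x - c⟫ = s} := D.plane_eq_of_mem hσ hy c
  have hdist : D.dist K σ = |s| := by
    rw [dist, hp, infDist_hyperplane hN.norm_eq]
  have hpos : 0 < |s| := hdist ▸ D.dist_pos K σ hσ
  rw [hdist]
  rcases lt_or_ge s 0 with hneg | hnn
  swap
  · rw [abs_of_nonneg hnn]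
  exfalso
  obtain ⟨U, hU, he⟩ := D.edge_open σ
  have hyU : y ∈ U := (he ▸ hy : y ∈ U ∩ D.plane σ).1
  have hcont : Tendsto (fun t : ℝ => c + (s / (s - t)) • (y - t • n - c)) (𝓝[>] 0)
      (𝓝 (c + (s / (s - 0)) • (y - (0 : ℝ) • n - c))) := by
    have h1 : ContinuousAt (fun t : ℝ => s / (s - t)) 0 :=
      continuousAt_const.div (by fun_prop) (by simpa using hneg.ne)
    have h2 : ContinuousAt (fun t : ℝ => c + (s / (s - t)) • (y - t • n - c)) 0 := by fun_prop
    exact h2.tendsto.mono_left nhdsWithin_le_nhds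
  have e0 : c + (s / (s - 0)) • (y - (0 : ℝ) • n - c) = y := by
    rw [sub_zero, div_self hneg.ne, one_smul, zero_smul, sub_zero]
    abel
  rw [e0] at hcont
  obtain ⟨t, ⟨htU, htK, -⟩, ht⟩ := (((hcont.eventually (hU.mem_nhds hyU)).and
    (hN.outward y hy)).and self_mem_nhdsWithin).exists
  have ht0 : 0 < t := ht
  have hst : s - t < 0 := by linarith
  have hr0 : 0 ≤ s / (s - t) := div_nonneg_of_nonpos hneg.le hst.le
  have hr1 : s / (s - t) ≤ 1 := by
    rw [div_le_one_of_neg hst]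
    linarith
  have hK := (D.cell_starShaped K).add_smul_sub_mem htK hr0 hr1
  have hplane : c + (s / (s - t)) • (y - t • n - c) ∈ D.plane σ := by
    rw [hp]
    have e1 : ⟪n, y - t • n - c⟫ = s - t := by
      rw [show y - t • n - c = (y - c) - t • n by abel, inner_sub_right, inner_smul_right,
        real_inner_self_eq_norm_sq, hN.norm_eq]
      ring
    rw [Set.mem_ofPred_eq, add_sub_cancel_left, inner_smul_right, e1, div_mul_cancel₀ _ hst.ne]
  have hedge : c + (s / (s - t)) • (y - t • n - c) ∈ D.edge σ := by
    rw [he]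
    exact ⟨htU, hplane⟩
  have hfr : c + (s / (s - t)) • (y - t • n - c) ∈ frontier (D.cell K) := by
    rw [D.frontier_eq K]
    exact Set.mem_biUnion hσ (subset_closure hedge)
  rw [(D.cell_open K).frontier_eq] at hfr
  exact hfr.2 hK

theorem plane_eq {K : D.Cell} {σ : D.Edge} (hσ : σ ∈ D.edgesOf K) :
    D.plane σ = {x | ⟪D.normal K σ, x - D.center K⟫ = D.dist K σ} := by
  obtain ⟨y, hy⟩ := D.edge_nonempty σ
  rw [D.plane_eq_of_mem hσ hy (D.center K), D.inner_normal_eq_dist hσ hy]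

theorem isStarCell (hΩ : Bornology.IsBounded Ω) (K : D.Cell) :
    IsStarCell (D.cell K) (D.center K) (D.edgesOf K) D.edge (D.normal K) (D.dist K) where
  isOpen := D.cell_open K
  isBounded := hΩ.subset (D.cell_subset K)
  center_mem := D.center_mem K
  starConvex := D.cell_starShaped K
  norm_normal σ hσ := (D.normal_spec K σ hσ).norm_eq
  height_pos σ hσ := D.dist_pos K σ hσ
  exists_open σ hσ := by
    rw [← D.plane_eq hσ]
    exact D.edge_open σ
  boundary_null σ _ := D.edge_boundary_null σ
  frontier_eq := D.frontier_eq K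
  disjoint σ _ τ _ hστ := D.edge_disjoint hστ

/-- Both normals are unit multiples of the normal of the plane, so they agree up to sign. If they
were equal, `y - t • n` would lie in both cells for small `t > 0`. -/
theorem normal_neg {K L : D.Cell} (hKL : K ≠ L) {σ : D.Edge} (hK : σ ∈ D.edgesOf K)
    (hL : σ ∈ D.edgesOf L) : D.normal L σ = -D.normal K σ := by
  obtain ⟨m, b, hm, hp⟩ := D.plane_isHyperplane σ
  obtain ⟨U, hU, he⟩ := D.edge_open σ
  obtain ⟨y, hy⟩ := D.edge_nonempty σ
  have hNK := D.normal_spec K σ hK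
  have hNL := D.normal_spec L σ hL
  rw [hp] at he
  have h1 := eq_smul_of_orthogonal hm hU he ⟨y, hy⟩ hNK.orthogonal
  have h2 := eq_smul_of_orthogonal hm hU he ⟨y, hy⟩ hNL.orthogonal
  have hm0 : ‖m‖ ≠ 0 := norm_ne_zero_iff.2 hm
  have n1 := hNK.norm_eq
  have n2 := hNL.norm_eq
  rw [h1, norm_smul, Real.norm_eq_abs] at n1
  rw [h2, norm_smul, Real.norm_eq_abs] at n2
  have habs := mul_right_cancel₀ hm0 (n2.trans n1.symm)
  rcases abs_eq_abs.1 habs with heq | heq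
  · exfalso
    have hnn : D.normal L σ = D.normal K σ := by rw [h1, h2, heq]
    obtain ⟨t, ⟨hK', -⟩, hL', -⟩ := ((hNK.outward y hy).and (hNL.outward y hy)).exists
    rw [hnn] at hL'
    exact Set.disjoint_left.1 (D.cell_disjoint hKL) hK' hL'
  · rw [h1, h2, heq, neg_smul]

theorem card_cellsOf (σ : D.Edge) :
    ((D.cellsOf σ).card = 1 ∧ D.edge σ ⊆ frontier Ω) ∨ (D.cellsOf σ).card = 2 := by
  have : Nat.card {K // σ ∈ D.edgesOf K} = (D.cellsOf σ).card := by
    rw [cellsOf, Nat.card_eq_fintype_card, Fintype.card_subtype]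
  rw [← this]
  exact D.edge_cells σ

theorem notMem_extEdges {σ : D.Edge} (h : σ ∈ D.intEdges) : σ ∉ D.extEdges := by
  simp only [extEdges, intEdges, Finset.mem_filter, Finset.mem_univ, true_and] at h ⊢
  omega

theorem edge_subset_frontier_of_ext {σ : D.Edge} (h : σ ∈ D.extEdges) :
    D.edge σ ⊆ frontier Ω := by
  simp only [extEdges, Finset.mem_filter, Finset.mem_univ, true_and] at h
  rcases D.card_cellsOf σ with h' | h'
  · exact h'.2
  · omega

theorem exists_cell (σ : D.Edge) : ∃ K, σ ∈ D.edgesOf K := by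
  have : (D.cellsOf σ).Nonempty := by
    rw [← Finset.card_pos]
    rcases D.card_cellsOf σ with h | h <;> omega
  obtain ⟨K, hK⟩ := this
  exact ⟨K, D.mem_cellsOf.1 hK⟩

/-- Conservativity: fluxes of a field weighted by edge values which vanish on the boundary
cancel. -/
theorem sum_edge_inner_normal_eq_zero (q : D.Edge → ℝ) (hq : ∀ σ ∈ D.extEdges, q σ = 0)
    (a : D.Edge → Pt d) :
    ∑ K, ∑ σ ∈ D.edgesOf K, q σ * ⟪D.normal K σ, a σ⟫ = 0 := by
  classical
  rw [Finset.sum_comm' (t' := Finset.univ) (s' := fun σ => D.cellsOf σ)]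
  · refine Finset.sum_eq_zero fun σ _ => ?_
    rcases D.card_cellsOf σ with h | h
    · have : σ ∈ D.extEdges := by simpa [extEdges] using h.1
      simp [hq σ this]
    · obtain ⟨K, L, hKL, he⟩ := Finset.card_eq_two.1 h
      have hK : σ ∈ D.edgesOf K := D.mem_cellsOf.1 (by simp [he])
      have hL : σ ∈ D.edgesOf L := D.mem_cellsOf.1 (by simp [he])
      rw [he, Finset.sum_pair hKL, D.normal_neg hKL hK hL, inner_neg_left]
      ring
  · intro K σ
    simp [D.mem_cellsOf]

theorem cone_eq (K : D.Cell) (σ : D.Edge) : D.cone K σ = coneOver (D.center K) (D.edge σ) := rfl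

section Measure

variable (hd : 0 < d) (hΩ : Bornology.IsBounded Ω)

include hΩ

theorem surf_edge_lt_top (σ : D.Edge) : surf d (D.edge σ) < ⊤ := by
  obtain ⟨K, hK⟩ := D.exists_cell σ
  exact (D.isStarCell hΩ K).surf_edge_lt_top hK

theorem measurableSet_edge (σ : D.Edge) : MeasurableSet (D.edge σ) := by
  obtain ⟨K, hK⟩ := D.exists_cell σ
  exact (D.isStarCell hΩ K).measurableSet_edge hK

theorem area_pos (σ : D.Edge) : 0 < D.area σ :=
  ENNReal.toReal_pos (D.edge_measure_pos σ).ne' (D.surf_edge_lt_top hΩ σ).ne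

theorem vol_pos (K : D.Cell) : 0 < D.vol K :=
  ENNReal.toReal_pos ((D.cell_open K).measure_pos _ ⟨_, D.center_mem K⟩).ne'
    (hΩ.subset (D.cell_subset K)).measure_lt_top.ne

theorem integrableOn_edge {E : Type*} [NormedAddCommGroup E] (σ : D.Edge)
    {f : Pt d → E} (hf : Continuous f) : IntegrableOn f (D.edge σ) (surf d) := by
  obtain ⟨K, hK⟩ := D.exists_cell σ
  have hfin := D.surf_edge_lt_top hΩ σ
  have hc := ((D.isStarCell hΩ K).isBounded_edge hK).isCompact_closure
  obtain ⟨M, hM⟩ := hc.exists_bound_of_continuousOn hf.continuousOn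
  refine Measure.integrableOn_of_bounded (M := M) hfin.ne hf.aestronglyMeasurable ?_
  refine (ae_restrict_mem (D.measurableSet_edge hΩ σ)).mono fun x hx => hM x (subset_closure hx)

theorem integral_edge_sub (σ : D.Edge) (c : Pt d) :
    ∫ y in D.edge σ, (y - c) ∂(surf d) = D.area σ • (D.bary σ - c) := by
  have hA := D.area_pos hΩ σ
  have hc : IntegrableOn (fun _ : Pt d => c) (D.edge σ) (surf d) :=
    D.integrableOn_edge hΩ σ continuous_const
  rw [integral_sub (D.integrableOn_edge hΩ σ continuous_id') hc, setIntegral_const, bary,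
    setAverage_eq, smul_sub, smul_smul]
  change _ = (D.area σ * (D.area σ)⁻¹) • _ - _
  rw [mul_inv_cancel₀ hA.ne', one_smul]
  rfl

theorem integral_edge_inner_sub (σ : D.Edge) (c e : Pt d) :
    ∫ y in D.edge σ, ⟪e, y - c⟫ ∂(surf d) = D.area σ * ⟪e, D.bary σ - c⟫ := by
  have h : IntegrableOn (fun y : Pt d => y - c) (D.edge σ) (surf d) :=
    D.integrableOn_edge hΩ σ (by fun_prop)
  rw [integral_inner h, D.integral_edge_sub hΩ, inner_smul_right]

/-- Edges need not be convex, so the barycentre may lie outside its edge; affine quantities constant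
on the edge are still preserved by averaging. -/
theorem inner_bary_sub_eq {c e : Pt d} {s : ℝ} (σ : D.Edge)
    (h : ∀ y ∈ D.edge σ, ⟪e, y - c⟫ = s) : ⟪e, D.bary σ - c⟫ = s := by
  have h1 := D.integral_edge_inner_sub hΩ σ c e
  rw [setIntegral_congr_fun (D.measurableSet_edge hΩ σ) h, setIntegral_const, smul_eq_mul] at h1
  exact (mul_left_cancel₀ (D.area_pos hΩ σ).ne' h1).symm

theorem bary_mem_of_subset {s : Set (Pt d)} (hs : Convex ℝ s) (hsc : IsClosed s) {σ : D.Edge}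
    (h : D.edge σ ⊆ s) : D.bary σ ∈ s :=
  hs.set_average_mem hsc (D.edge_measure_pos σ).ne' (D.surf_edge_lt_top hΩ σ).ne
    ((ae_restrict_mem (D.measurableSet_edge hΩ σ)).mono fun _ hx => h hx)
    (D.integrableOn_edge hΩ σ continuous_id')

theorem norm_sub_le_diam {K : D.Cell} {x y : Pt d} (hx : x ∈ closure (D.cell K))
    (hy : y ∈ closure (D.cell K)) : ‖x - y‖ ≤ D.diam K := by
  rw [← dist_eq_norm, diam, ← Metric.diam_closure]
  exact Metric.dist_le_diam_of_mem (hΩ.subset (D.cell_subset K)).closure hx hy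

theorem edge_subset_closure_cell {K : D.Cell} {σ : D.Edge} (hσ : σ ∈ D.edgesOf K) :
    D.edge σ ⊆ closure (D.cell K) :=
  ((D.isStarCell hΩ K).edge_subset_frontier hσ).trans frontier_subset_closure

theorem norm_bary_sub_le {K : D.Cell} {σ : D.Edge} (hσ : σ ∈ D.edgesOf K) {x : Pt d}
    (hx : x ∈ closure (D.cell K)) : ‖D.bary σ - x‖ ≤ D.diam K := by
  have := D.bary_mem_of_subset hΩ (convex_closedBall x (D.diam K)) Metric.isClosed_closedBall
    (σ := σ) fun y hy => by
      rw [Metric.mem_closedBall, dist_eq_norm]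
      exact D.norm_sub_le_diam hΩ (D.edge_subset_closure_cell hΩ hσ hy) hx
  rwa [Metric.mem_closedBall, dist_eq_norm] at this

theorem dist_le_diam {K : D.Cell} {σ : D.Edge} (hσ : σ ∈ D.edgesOf K) :
    D.dist K σ ≤ D.diam K := by
  obtain ⟨y, hy⟩ := D.edge_nonempty σ
  rw [← D.inner_normal_eq_dist hσ hy]
  refine (real_inner_le_norm _ _).trans ?_
  rw [(D.normal_spec K σ hσ).norm_eq, one_mul]
  exact D.norm_sub_le_diam hΩ (D.edge_subset_closure_cell hΩ hσ hy)
    (subset_closure (D.center_mem K))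

omit hΩ in
theorem diam_le_size (K : D.Cell) : D.diam K ≤ D.size :=
  le_ciSup (f := D.diam) (Set.finite_range _).bddAbove K

include hd

/-- The identity `∑_σ |σ| n_{K,σ} ⊗ (x_σ - p) = |K| Id`. -/
theorem sum_area_inner_mul_inner (K : D.Cell) (p e e' : Pt d) :
    ∑ σ ∈ D.edgesOf K, D.area σ * (⟪D.normal K σ, e⟫ * ⟪e', D.bary σ - p⟫) =
      D.vol K * ⟪e', e⟫ := by
  have h := (D.isStarCell hΩ K).integral_fderiv hd (a := fun x => ⟪e', x - p⟫)
    (contDiff_const.inner ℝ (contDiff_id.sub contDiff_const)) e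
  have h1 : ∀ x : Pt d, fderiv ℝ (fun x : Pt d => ⟪e', x - p⟫) x e = ⟪e', e⟫ := by
    intro x
    have : HasFDerivAt (fun x : Pt d => ⟪e', x - p⟫) (innerSL ℝ e') x :=
      (innerSL ℝ e').hasFDerivAt.comp x ((hasFDerivAt_id x).sub_const p)
    rw [this.fderiv]
    rfl
  simp_rw [h1] at h
  rw [setIntegral_const, smul_eq_mul] at h
  rw [vol, h]
  refine Finset.sum_congr rfl fun σ _ => ?_
  rw [D.integral_edge_inner_sub hΩ]
  ring

/-- The geometric identity in vector form: it says that `gradK` reproduces the gradient of an affine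
function. -/
theorem sum_area_inner_smul (K : D.Cell) (g : Pt d) :
    ∑ σ ∈ D.edgesOf K, (D.area σ * ⟪g, D.bary σ - D.center K⟫) • D.normal K σ =
      D.vol K • g := by
  refine ext_inner_right ℝ fun e => ?_
  rw [sum_inner, real_inner_smul_left, ← D.sum_area_inner_mul_inner hd hΩ K (D.center K) e g]
  refine Finset.sum_congr rfl fun σ _ => ?_
  rw [real_inner_smul_left]
  ring

theorem vol_cone {K : D.Cell} {σ : D.Edge} (hσ : σ ∈ D.edgesOf K) :
    volume.real (D.cone K σ) = D.area σ * D.dist K σ / d := by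
  have h := D.isStarCell hΩ K
  rw [cone_eq, volume_real_coneOver hd (h.norm_normal σ hσ) (h.height_pos σ hσ)
    (fun y hy => h.inner_eq hσ hy) (h.measurableSet_edge hσ), area]
  ring

/-- Trace of the identity `sum_area_inner_mul_inner`, with `p` the centre. -/
theorem sum_area_mul_dist (K : D.Cell) :
    ∑ σ ∈ D.edgesOf K, D.area σ * D.dist K σ = d * D.vol K := by
  let b := EuclideanSpace.basisFun (Fin d) ℝ
  have h1 : ∀ i, ∑ σ ∈ D.edgesOf K,
      D.area σ * (⟪D.normal K σ, b i⟫ * ⟪b i, D.bary σ - D.center K⟫) = D.vol K := by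
    intro i
    rw [D.sum_area_inner_mul_inner hd hΩ]
    simp
  have h2 : ∑ i, ∑ σ ∈ D.edgesOf K,
      D.area σ * (⟪D.normal K σ, b i⟫ * ⟪b i, D.bary σ - D.center K⟫) = d * D.vol K := by
    simp_rw [h1]
    simp
  rw [← h2, Finset.sum_comm]
  refine Finset.sum_congr rfl fun σ hσ => ?_
  rw [← Finset.mul_sum, b.sum_inner_mul_inner,
    D.inner_bary_sub_eq hΩ σ fun y hy => D.inner_normal_eq_dist hσ hy]

theorem sum_vol_cone (K : D.Cell) :
    ∑ σ ∈ D.edgesOf K, volume.real (D.cone K σ) = D.vol K := by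
  rw [Finset.sum_congr rfl fun σ hσ => D.vol_cone hd hΩ hσ, ← Finset.sum_div,
    D.sum_area_mul_dist hd hΩ]
  field_simp

theorem ae_mem_cone : ∀ᵐ x : Pt d, x ∈ Ω → ∃ K, ∃ σ ∈ D.edgesOf K, x ∈ D.cone K σ := by
  have : ∀ᵐ x : Pt d, ∀ K, x ∈ closure (D.cell K) → ∃ σ ∈ D.edgesOf K, x ∈ D.cone K σ :=
    ae_all_iff.2 fun K => (D.isStarCell hΩ K).ae_mem_cone hd
  filter_upwards [this] with x hx hxΩ
  have h1 : x ∈ ⋃ K, closure (D.cell K) := D.closure_eq ▸ subset_closure hxΩ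
  obtain ⟨K, hK⟩ := Set.mem_iUnion.1 h1
  exact ⟨K, hx K hK⟩

end Measure

end Discretisation

/-! ### Discrete Poincaré inequality, well-posedness, and the error estimate in the seminorm -/

namespace Discretisation

variable {d : ℕ} {Ω : Set (Pt d)} (D : Discretisation Ω)

/-- The square of the `L²` norm of `Π_M v`. -/
def cellNormSq (v : D.X) : ℝ := ∑ K, D.vol K * v.1 K ^ 2

theorem norm_le_of_mem_closure {R : ℝ} (hR : Ω ⊆ Metric.closedBall 0 R) {x : Pt d}
    (hx : x ∈ closure Ω) : ‖x‖ ≤ R := by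
  have := closure_minimal hR Metric.isClosed_closedBall hx
  simpa using this

theorem closure_cell_subset (K : D.Cell) : closure (D.cell K) ⊆ closure Ω :=
  closure_mono (D.cell_subset K)

theorem norm_bary_le {R : ℝ} (hR : Ω ⊆ Metric.closedBall 0 R) (σ : D.Edge) : ‖D.bary σ‖ ≤ R := by
  have hΩ : Bornology.IsBounded Ω := Metric.isBounded_closedBall.subset hR
  have := D.bary_mem_of_subset hΩ (convex_closedBall (0 : Pt d) R) Metric.isClosed_closedBall
    (σ := σ) ((D.edge_subset σ).trans (closure_minimal hR Metric.isClosed_closedBall))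
  simpa using this

theorem diam_le_two_mul {R : ℝ} (hR0 : 0 ≤ R) (hR : Ω ⊆ Metric.closedBall 0 R) (K : D.Cell) :
    D.diam K ≤ 2 * R :=
  (Metric.diam_mono ((D.cell_subset K).trans hR) Metric.isBounded_closedBall).trans
    (Metric.diam_closedBall hR0)

theorem sum_vol_mul_dist (hd : 0 < d) (hΩ : Bornology.IsBounded Ω) (K : D.Cell) (s : ℝ) :
    ∑ σ ∈ D.edgesOf K, D.area σ * D.dist K σ * s = d * D.vol K * s := by
  rw [← Finset.sum_mul, D.sum_area_mul_dist hd hΩ]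

/-- The discrete Poincaré inequality. -/
theorem cellNormSq_le (hd : 0 < d) {R : ℝ} (hR0 : 0 ≤ R) (hR : Ω ⊆ Metric.closedBall 0 R)
    {v : D.X} (hv : ∀ σ ∈ D.extEdges, v.2 σ = 0) :
    D.cellNormSq v ≤ (4 * d + 4) * R ^ 2 * D.seminormSq v := by
  have hΩ : Bornology.IsBounded Ω := Metric.isBounded_closedBall.subset hR
  let e : Pt d := EuclideanSpace.single ⟨0, hd⟩ 1
  have he : ‖e‖ = 1 := by simp [e]
  have hee : ⟪e, e⟫ = 1 := by rw [real_inner_self_eq_norm_sq, he]; norm_num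
  have h0 := D.sum_edge_inner_normal_eq_zero (fun σ => v.2 σ ^ 2)
    (fun σ hσ => by simp [hv σ hσ]) (fun σ => (D.area σ * ⟪e, D.bary σ⟫) • e)
  -- The volume `|K|` is written as the flux of the field `x ↦ ⟪e, x⟫ e` through the edges of `K`.
  -- Subtracting the same fluxes weighted by `v_σ²`, whose total is zero by conservativity, leaves
  -- differences `v_K² - v_σ²`.
  have h1 : D.cellNormSq v = ∑ K, ∑ σ ∈ D.edgesOf K,
      (v.1 K ^ 2 - v.2 σ ^ 2) * (D.area σ * (⟪D.normal K σ, e⟫ * ⟪e, D.bary σ⟫)) := by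
    rw [← sub_zero (D.cellNormSq v), ← h0, cellNormSq, ← Finset.sum_sub_distrib]
    refine Finset.sum_congr rfl fun K _ => ?_
    have := D.sum_area_inner_mul_inner hd hΩ K 0 e e
    rw [hee, mul_one] at this
    rw [← this, Finset.sum_mul, ← Finset.sum_sub_distrib]
    refine Finset.sum_congr rfl fun σ _ => ?_
    rw [inner_smul_right, sub_zero]
    ring
  have hd' : (0 : ℝ) < d := Nat.cast_pos.2 hd
  -- Young's inequality, with the weight `1 / (2 d)` chosen so that the terms `|σ| d_{K,σ} v_K² / (2
  -- d)` add up to half of `cellNormSq` and can be absorbed. The quadratic term in `v_σ - v_K` is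
  -- handled by `d_{K,σ} ≤ 2 R`, which gives the extra `2 R²`.
  have h2 : ∀ K, ∀ σ ∈ D.edgesOf K,
      (v.1 K ^ 2 - v.2 σ ^ 2) * (D.area σ * (⟪D.normal K σ, e⟫ * ⟪e, D.bary σ⟫)) ≤
        (2 * d + 2) * R ^ 2 * (D.area σ / D.dist K σ * (v.2 σ - v.1 K) ^ 2) +
          D.area σ * D.dist K σ * (v.1 K ^ 2 / (2 * d)) := by
    intro K σ hσ
    have hA := D.area_pos hΩ σ
    have hδ : 0 < D.dist K σ := D.dist_pos K σ hσ
    have hδR : D.dist K σ ≤ 2 * R := (D.dist_le_diam hΩ hσ).trans (D.diam_le_two_mul hR0 hR K)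
    have hs : |⟪D.normal K σ, e⟫ * ⟪e, D.bary σ⟫| ≤ R := by
      rw [abs_mul]
      have i1 : |⟪D.normal K σ, e⟫| ≤ 1 := by
        simpa [he, (D.normal_spec K σ hσ).norm_eq] using abs_real_inner_le_norm (D.normal K σ) e
      have i2 : |⟪e, D.bary σ⟫| ≤ R := by
        refine (abs_real_inner_le_norm _ _).trans ?_
        rw [he, one_mul]
        exact D.norm_bary_le hR σ
      calc _ ≤ 1 * R := mul_le_mul i1 i2 (abs_nonneg _) zero_le_one
        _ = R := one_mul R
    set s := ⟪D.normal K σ, e⟫ * ⟪e, D.bary σ⟫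
    set δ := D.dist K σ
    set A := D.area σ
    set a := v.2 σ - v.1 K with ha
    set x := v.1 K
    have hva : v.2 σ = x + a := by rw [ha]; ring
    have e1 : (x ^ 2 - v.2 σ ^ 2) * (A * s) = A * (-(s * (2 * a * x + a ^ 2))) := by
      rw [hva]; ring
    have e2 : (2 * d + 2) * R ^ 2 * (A / δ * a ^ 2) + A * δ * (x ^ 2 / (2 * d)) =
        A * ((2 * d + 2) * R ^ 2 * a ^ 2 / δ + δ * x ^ 2 / (2 * d)) := by
      field_simp
    rw [e1, e2]
    refine mul_le_mul_of_nonneg_left ?_ hA.le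
    have hs2 : s ^ 2 ≤ R ^ 2 := sq_le_sq' (abs_le.1 hs).1 (abs_le.1 hs).2
    have y1 : -(s * (2 * a * x)) ≤ 2 * d * R ^ 2 * a ^ 2 / δ + δ * x ^ 2 / (2 * d) := by
      have : 2 * d * s ^ 2 * a ^ 2 / δ + δ * x ^ 2 / (2 * d) + s * (2 * a * x) =
          (2 * d * s * a + δ * x) ^ 2 / (2 * d * δ) := by
        field_simp
        ring
      have h3 : 0 ≤ (2 * d * s * a + δ * x) ^ 2 / (2 * d * δ) := by positivity
      have h4 : 2 * d * s ^ 2 * a ^ 2 / δ ≤ 2 * d * R ^ 2 * a ^ 2 / δ := by gcongr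
      linarith
    have y2 : -(s * a ^ 2) ≤ 2 * R ^ 2 * a ^ 2 / δ := by
      have h5 : -(s * a ^ 2) ≤ R * a ^ 2 := by
        have := (abs_le.1 hs).1
        nlinarith [sq_nonneg a]
      have h6 : R * a ^ 2 ≤ 2 * R ^ 2 * a ^ 2 / δ := by
        rw [le_div_iff₀ hδ]
        have : 0 ≤ R * a ^ 2 := by positivity
        nlinarith
      linarith
    have e3 : (2 * d + 2) * R ^ 2 * a ^ 2 / δ = 2 * d * R ^ 2 * a ^ 2 / δ + 2 * R ^ 2 * a ^ 2 / δ := by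
      ring
    rw [e3]
    linarith
  have h3 : D.cellNormSq v ≤ (2 * d + 2) * R ^ 2 * D.seminormSq v + D.cellNormSq v / 2 := by
    conv_lhs => rw [h1]
    refine (Finset.sum_le_sum fun K _ => Finset.sum_le_sum fun σ hσ => h2 K σ hσ).trans_eq ?_
    simp_rw [Finset.sum_add_distrib, D.sum_vol_mul_dist hd hΩ, ← Finset.mul_sum]
    rw [seminormSq, cellNormSq, Finset.sum_div]
    congr 1
    refine Finset.sum_congr rfl fun K _ => ?_
    field_simp
  linarith

theorem seminormSq_nonneg (hΩ : Bornology.IsBounded Ω) (v : D.X) : 0 ≤ D.seminormSq v := by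
  refine Finset.sum_nonneg fun K _ => Finset.sum_nonneg fun σ hσ => ?_
  have hA := D.area_pos hΩ σ
  have hδ : 0 < D.dist K σ := D.dist_pos K σ hσ
  positivity

theorem eq_zero_of_seminormSq_le (hd : 0 < d) (hΩ : Bornology.IsBounded Ω) {v : D.X}
    (hv : ∀ σ ∈ D.extEdges, v.2 σ = 0) (h : D.seminormSq v ≤ 0) : v = 0 := by
  obtain ⟨R, hR0, hR⟩ := hΩ.subset_closedBall_lt 0 0
  have hs : D.seminormSq v = 0 := le_antisymm h (D.seminormSq_nonneg hΩ v)
  have h1 := D.cellNormSq_le hd hR0.le hR hv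
  rw [hs, mul_zero] at h1
  have hK : ∀ K, v.1 K = 0 := by
    have h2 : D.cellNormSq v = 0 := le_antisymm h1
      (Finset.sum_nonneg fun K _ => mul_nonneg (D.vol_pos hΩ K).le (sq_nonneg _))
    rw [cellNormSq, Finset.sum_eq_zero_iff_of_nonneg
      fun K _ => mul_nonneg (D.vol_pos hΩ K).le (sq_nonneg _)] at h2
    intro K
    have := h2 K (Finset.mem_univ K)
    rw [mul_eq_zero] at this
    exact pow_eq_zero_iff two_ne_zero |>.1 (this.resolve_left (D.vol_pos hΩ K).ne')
  have hpos : ∀ K, ∀ σ ∈ D.edgesOf K, 0 ≤ D.area σ / D.dist K σ * (v.2 σ - v.1 K) ^ 2 := by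
    intro K σ hσ
    have hA := D.area_pos hΩ σ
    have hδ : 0 < D.dist K σ := D.dist_pos K σ hσ
    positivity
  have hE : ∀ σ, v.2 σ = 0 := by
    intro σ
    obtain ⟨K, hσ⟩ := D.exists_cell σ
    rw [seminormSq, Finset.sum_eq_zero_iff_of_nonneg
      fun K _ => Finset.sum_nonneg (hpos K)] at hs
    have h3 := hs K (Finset.mem_univ K)
    rw [Finset.sum_eq_zero_iff_of_nonneg (hpos K)] at h3
    have h4 := h3 σ hσ
    have hA := D.area_pos hΩ σ
    have hδ : 0 < D.dist K σ := D.dist_pos K σ hσ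
    rw [mul_eq_zero, hK K, sub_zero] at h4
    exact pow_eq_zero_iff two_ne_zero |>.1 (h4.resolve_left (by positivity))
  ext x
  · exact hK x
  · exact hE x

/-- The space `X_{D,B}` as a submodule. -/
def submoduleXB (B : Finset D.Edge) (β : D.Edge → D.Cell → ℝ) : Submodule ℝ D.X where
  carrier := {v | D.MemXB B β v}
  add_mem' {v w} hv hw := by
    refine ⟨fun σ hσ => ?_, fun σ hσ => ?_⟩
    · simp [hv.1 σ hσ, hw.1 σ hσ]
    · simp [hv.2 σ hσ, hw.2 σ hσ, mul_add, Finset.sum_add_distrib]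
  zero_mem' := ⟨fun σ _ => by simp, fun σ _ => by simp⟩
  smul_mem' r v hv := by
    refine ⟨fun σ hσ => ?_, fun σ hσ => ?_⟩
    · simp [hv.1 σ hσ]
    · simp [hv.2 σ hσ, Finset.mul_sum, mul_left_comm]

/-- The bilinear form `⟨u, v⟩_F` as a bilinear map. -/
def formBilin (F : D.Fluxes) : D.X →ₗ[ℝ] D.X →ₗ[ℝ] ℝ :=
  LinearMap.mk₂ ℝ (D.form F)
    (fun u u' v => by simp [form, add_mul, Finset.sum_add_distrib])
    (fun r u v => by simp [form, Finset.mul_sum, mul_assoc])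
    (fun u v v' => by
      rw [form, form, form, ← Finset.sum_add_distrib]
      refine Finset.sum_congr rfl fun K _ => ?_
      rw [← Finset.sum_add_distrib]
      refine Finset.sum_congr rfl fun σ _ => ?_
      simp only [Prod.fst_add, Prod.snd_add, Pi.add_apply]
      ring)
    (fun r u v => by
      rw [form, form, smul_eq_mul, Finset.mul_sum]
      refine Finset.sum_congr rfl fun K _ => ?_
      rw [Finset.mul_sum]
      refine Finset.sum_congr rfl fun σ _ => ?_
      simp only [Prod.smul_fst, Prod.smul_snd, Pi.smul_apply, smul_eq_mul]
      ring)

/-- In finite dimension it suffices that the map from `X_{D,B}` to its dual be injective, and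
coercivity together with the Poincaré inequality ensures this. -/
theorem existsUnique_schemeSolution (hd : 0 < d) (hΩ : Bornology.IsBounded Ω) {α : ℝ} (hα : 0 < α)
    (B : Finset D.Edge) (β : D.Edge → D.Cell → ℝ) (F : D.Fluxes) (hF : D.IsCoercive F α)
    (f : Pt d → ℝ) : ∃! w : D.X, D.IsSchemeSolution B β F f w := by
  let W := D.submoduleXB B β
  let T : W →ₗ[ℝ] Module.Dual ℝ W := (D.formBilin F).domRestrict₁₂ W W
  have hT : ∀ w v : W, T w v = D.form F w v := fun w v => rfl
  have hinj : Function.Injective T := by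
    rw [← LinearMap.ker_eq_bot, LinearMap.ker_eq_bot']
    intro w hw
    have h1 : D.form F w w = 0 := by rw [← hT, hw]; rfl
    have h2 := hF w
    rw [h1] at h2
    have h3 : D.seminormSq w ≤ 0 := by
      by_contra hcon
      push Not at hcon
      have := mul_pos hα hcon
      linarith
    exact Subtype.ext (D.eq_zero_of_seminormSq_le hd hΩ w.2.1 h3)
  have hsurj : Function.Surjective T :=
    (LinearMap.injective_iff_surjective_of_finrank_eq_finrank
      (Subspace.dual_finrank_eq (K := ℝ) (V := W)).symm).1 hinj
  let ℓ : Module.Dual ℝ W :=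
    { toFun := fun v => ∑ K, v.1.1 K * ∫ x in D.cell K, f x
      map_add' := fun v w => by simp [add_mul, Finset.sum_add_distrib]
      map_smul' := fun r v => by simp [Finset.mul_sum, mul_assoc] }
  obtain ⟨w, hw⟩ := hsurj ℓ
  refine ⟨w, ⟨w.2, fun v hv => ?_⟩, fun w' hw' => ?_⟩
  · have := congrArg (fun g : Module.Dual ℝ W => g ⟨v, hv⟩) hw
    exact this
  · have : (⟨w', hw'.1⟩ : W) = w := by
      refine hinj ?_
      rw [hw]
      ext v
      exact hw'.2 v.1 v.2
    exact congrArg Subtype.val this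

theorem memXB_interpB {B : Finset D.Edge} {β : D.Edge → D.Cell → ℝ} (hB : B ⊆ D.intEdges)
    (u : Pt d → ℝ) : D.MemXB B β (D.interpB B β u) := by
  refine ⟨fun σ hσ => by simp [interpB, hσ], fun σ hσ => ?_⟩
  simp [interpB, hσ, D.notMem_extEdges (hB hσ)]

/-- A weighted Cauchy–Schwarz inequality over the pairs `(K, σ)`. -/
theorem sum_mul_sq_le_weighted (hΩ : Bornology.IsBounded Ω) (r y : D.Cell → D.Edge → ℝ) :
    (∑ K, ∑ σ ∈ D.edgesOf K, r K σ * y K σ) ^ 2 ≤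
      (∑ K, ∑ σ ∈ D.edgesOf K, D.dist K σ / D.area σ * r K σ ^ 2) *
        ∑ K, ∑ σ ∈ D.edgesOf K, D.area σ / D.dist K σ * y K σ ^ 2 := by
  simp_rw [Finset.sum_sigma']
  have hpos : ∀ p ∈ Finset.univ.sigma fun K => D.edgesOf K, 0 < D.area p.2 / D.dist p.1 p.2 := by
    intro p hp
    have hσ := (Finset.mem_sigma.1 hp).2
    exact div_pos (D.area_pos hΩ _) (D.dist_pos _ _ hσ)
  refine Finset.sum_sq_le_sum_mul_sum_of_sq_le_mul _ (fun p hp => ?_) (fun p hp => ?_)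
    (fun p hp => ?_)
  · have := hpos p hp
    rw [← inv_div]
    positivity
  · have := hpos p hp
    positivity
  · have hA := (D.area_pos hΩ p.2).ne'
    have hδ : D.dist p.1 p.2 ≠ 0 := (D.dist_pos _ _ (Finset.mem_sigma.1 hp).2).ne'
    refine le_of_eq ?_
    field_simp

/-- The error estimate in the discrete seminorm. -/
theorem sq_mul_seminormSq_sub_le (hΩ : Bornology.IsBounded Ω) {α : ℝ} (hα : 0 < α)
    {B : Finset D.Edge} {β : D.Edge → D.Cell → ℝ} (hB : B ⊆ D.intEdges) {F : D.Fluxes}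
    (hF : D.IsCoercive F α) {f u : Pt d → ℝ} (hu : Continuous (∇ u))
    (hfu : ∀ K, ∫ x in D.cell K, f x =
      -∑ σ ∈ D.edgesOf K, ⟪D.normal K σ, ∫ y in D.edge σ, ∇ u y ∂(surf d)⟫)
    {uD : D.X} (huD : D.IsSchemeSolution B β F f uD) :
    α ^ 2 * D.seminormSq (uD - D.interpB B β u) ≤ D.consErr B β F u ^ 2 := by
  set w := uD - D.interpB B β u with hw
  have hwB : D.MemXB B β w :=
    (D.submoduleXB B β).sub_mem huD.1 (D.memXB_interpB hB u)
  have hflux : ∀ K σ, ∫ x in D.edge σ, ⟪∇ u x, D.normal K σ⟫ ∂(surf d) =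
      ⟪D.normal K σ, ∫ y in D.edge σ, ∇ u y ∂(surf d)⟫ := by
    intro K σ
    rw [← integral_inner (D.integrableOn_edge hΩ σ hu)]
    simp_rw [real_inner_comm]
  have hcons := D.sum_edge_inner_normal_eq_zero w.2 hwB.1
    (fun σ => ∫ y in D.edge σ, ∇ u y ∂(surf d))
  -- The scheme replaces the form at `uD` by cell integrals of `f`, that is, by exact fluxes
  -- weighted by `w_K`. Adding the vanishing sum `hcons` replaces these weights by `w_K - w_σ`, so
  -- only flux residuals remain.
  have h1 : D.form F w w = ∑ K, ∑ σ ∈ D.edgesOf K,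
      (F K σ (D.interpB B β u) + ∫ x in D.edge σ, ⟪∇ u x, D.normal K σ⟫ ∂(surf d)) *
        (w.2 σ - w.1 K) := by
    have e1 : D.form F w w = D.form F uD w - D.form F (D.interpB B β u) w := by
      change D.formBilin F w w = D.formBilin F uD w - D.formBilin F (D.interpB B β u) w
      rw [← LinearMap.sub_apply, ← map_sub]
    rw [e1, huD.2 w hwB, form, ← sub_zero (_ - _), ← neg_zero, ← hcons, ← Finset.sum_neg_distrib,
      ← Finset.sum_sub_distrib, ← Finset.sum_sub_distrib]
    refine Finset.sum_congr rfl fun K _ => ?_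
    rw [hfu K, mul_neg, Finset.mul_sum, ← Finset.sum_neg_distrib, ← Finset.sum_neg_distrib,
      ← Finset.sum_sub_distrib, ← Finset.sum_sub_distrib]
    refine Finset.sum_congr rfl fun σ _ => ?_
    rw [hflux]
    ring
  have h2 := D.sum_mul_sq_le_weighted hΩ
    (fun K σ => F K σ (D.interpB B β u) + ∫ x in D.edge σ, ⟪∇ u x, D.normal K σ⟫ ∂(surf d))
    (fun K σ => w.2 σ - w.1 K)
  rw [← h1] at h2
  have hE : D.consErr B β F u ^ 2 = ∑ K, ∑ σ ∈ D.edgesOf K, D.dist K σ / D.area σ *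
      (F K σ (D.interpB B β u) + ∫ x in D.edge σ, ⟪∇ u x, D.normal K σ⟫ ∂(surf d)) ^ 2 := by
    refine Real.sq_sqrt (Finset.sum_nonneg fun K _ => Finset.sum_nonneg fun σ hσ => ?_)
    have hA := D.area_pos hΩ σ
    have hδ : 0 < D.dist K σ := D.dist_pos K σ hσ
    positivity
  rw [← hE] at h2
  change _ ≤ _ * D.seminormSq w at h2
  have hs := D.seminormSq_nonneg hΩ w
  rcases hs.eq_or_lt with h0 | hpos
  · rw [← h0, mul_zero]
    positivity
  have h3 := hF w
  have h4 : (α * D.seminormSq w) ^ 2 ≤ D.consErr B β F u ^ 2 * D.seminormSq w :=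
    (pow_le_pow_left₀ (by positivity) h3 2).trans h2
  refine le_of_mul_le_mul_right ?_ hpos
  calc _ = (α * D.seminormSq w) ^ 2 := by ring
    _ ≤ _ := h4

end Discretisation

/-! ### The weak solution: classical gradient and `-Δu = f` almost everywhere -/

section Gradient

variable {d : ℕ}

theorem inner_grad (u : Pt d → ℝ) (x y : Pt d) : ⟪∇ u x, y⟫ = fderiv ℝ u x y := by
  rw [← toDual_gradient, InnerProductSpace.toDual_apply_apply]

theorem contDiff_gradient {u : Pt d → ℝ} {m k : WithTop ℕ∞} (hu : ContDiff ℝ k u)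
    (hmk : m + 1 ≤ k) : ContDiff ℝ m (∇ u) :=
  (InnerProductSpace.toDual ℝ (Pt d)).symm.toContinuousLinearEquiv.contDiff.comp
    (hu.fderiv_right hmk)

/-- The Laplacian, in the canonical basis. -/
def lap (u : Pt d → ℝ) (x : Pt d) : ℝ :=
  ∑ i, fderiv ℝ (fun y => ⟪∇ u y, EuclideanSpace.basisFun (Fin d) ℝ i⟫) x
    (EuclideanSpace.basisFun (Fin d) ℝ i)

theorem contDiff_inner_gradient {u : Pt d → ℝ} (hu : ContDiff ℝ 2 u) (e : Pt d) :
    ContDiff ℝ 1 fun y => ⟪∇ u y, e⟫ :=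
  (contDiff_gradient hu (by norm_num)).inner ℝ contDiff_const

theorem continuous_lap {u : Pt d → ℝ} (hu : ContDiff ℝ 2 u) : Continuous (lap u) := by
  refine continuous_finsetSum _ fun i _ => ?_
  exact ((contDiff_inner_gradient hu _).continuous_fderiv one_ne_zero).clm_apply continuous_const

theorem hasCompactSupport_gradient {φ : Pt d → ℝ} (hφ : HasCompactSupport φ) :
    HasCompactSupport (∇ φ) := by
  refine (hφ.fderiv (𝕜 := ℝ)).comp_left (g := (InnerProductSpace.toDual ℝ (Pt d)).symm) ?_
  simp

theorem integral_mul_inner_gradient {φ : Pt d → ℝ} (hφ : ContDiff ℝ 1 φ)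
    (hc : HasCompactSupport φ) {a : Pt d → ℝ} (ha : ContDiff ℝ 1 a) (e : Pt d) :
    ∫ x, a x * ⟪∇ φ x, e⟫ = -∫ x, ⟪∇ a x, e⟫ * φ x := by
  simp_rw [inner_grad]
  have h1 : Continuous fun x => fderiv ℝ a x e :=
    (ha.continuous_fderiv one_ne_zero).clm_apply continuous_const
  have h2 : Continuous fun x => fderiv ℝ φ x e :=
    (hφ.continuous_fderiv one_ne_zero).clm_apply continuous_const
  have h3 : HasCompactSupport fun x => fderiv ℝ φ x e := hc.fderiv_apply (𝕜 := ℝ) e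
  refine integral_mul_fderiv_eq_neg_fderiv_mul_of_integrable ?_ ?_ ?_
    (fun x _ => ha.differentiable one_ne_zero x) (fun x _ => hφ.differentiable one_ne_zero x)
  · exact (h1.mul hφ.continuous).integrable_of_hasCompactSupport hc.mul_left
  · exact (ha.continuous.mul h2).integrable_of_hasCompactSupport h3.mul_left
  · exact (ha.continuous.mul hφ.continuous).integrable_of_hasCompactSupport hc.mul_left

end Gradient

/-- On a bounded domain `L²` convergence implies `L¹` convergence, and `ψ` is bounded on the
closure. The integrals run over any `A ⊆ Ω`, so that the limit may be taken on the cone over a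
boundary edge. -/
theorem tendsto_setIntegral_inner {d : ℕ} {V : Type*} [NormedAddCommGroup V]
    [InnerProductSpace ℝ V] {Ω A : Set (Pt d)} (hΩ : Bornology.IsBounded Ω) (hA : A ⊆ Ω)
    {ψ : Pt d → V} (hψ : Continuous ψ) {a : Pt d → V} {ak : ℕ → Pt d → V}
    (ha : MemLp a 2 (volume.restrict Ω)) (hak : ∀ k, MemLp (ak k) 2 (volume.restrict Ω))
    (h : Tendsto (fun k => normL2 Ω (ak k - a)) atTop (𝓝 0)) :
    Tendsto (fun k => ∫ x in A, ⟪ψ x, ak k x⟫) atTop (𝓝 (∫ x in A, ⟪ψ x, a x⟫)) := by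
  have hle : volume.restrict A ≤ volume.restrict Ω := Measure.restrict_mono hA le_rfl
  have hfin : IsFiniteMeasure (volume.restrict Ω) := ⟨by simpa using hΩ.measure_lt_top⟩
  obtain ⟨M, hM⟩ := hΩ.isCompact_closure.exists_bound_of_continuousOn hψ.continuousOn
  have hbd : ∀ᵐ x ∂(volume.restrict Ω), ‖ψ x‖ ≤ M := by
    refine ae_restrict_of_ae_restrict_of_subset subset_closure ?_
    exact (ae_restrict_mem isClosed_closure.measurableSet).mono fun x hx => hM x hx
  have hbd' : ∀ᵐ x ∂(volume.restrict Ω), ‖ψ x‖ₑ ≤ ENNReal.ofReal M := by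
    filter_upwards [hbd] with x hx
    rw [← ofReal_norm]
    exact ENNReal.ofReal_le_ofReal hx
  have hint : ∀ g : Pt d → V, MemLp g 2 (volume.restrict Ω) →
      Integrable (fun x => ⟪ψ x, g x⟫) (volume.restrict Ω) := by
    intro g hg
    have h1 : Integrable g (volume.restrict Ω) := hg.integrable one_le_two
    refine (h1.norm.const_mul M).mono' (hψ.aestronglyMeasurable.inner h1.aestronglyMeasurable) ?_
    filter_upwards [hbd] with x hx
    refine (norm_inner_le_norm _ _).trans ?_
    gcongr
  refine tendsto_integral_of_L1 _ ((hint a ha).aestronglyMeasurable.mono_measure hle)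
    (Eventually.of_forall fun k => (hint _ (hak k)).mono_measure hle) ?_
  have hlim : Tendsto (fun k => ENNReal.ofReal M * (normL2 Ω (ak k - a) *
      (volume.restrict Ω) Set.univ ^ (1 / (1 : ENNReal).toReal - 1 / (2 : ENNReal).toReal)))
      atTop (𝓝 0) := by
    have h1 : (volume.restrict Ω) Set.univ ^
        (1 / (1 : ENNReal).toReal - 1 / (2 : ENNReal).toReal) ≠ ⊤ := by
      refine ENNReal.rpow_ne_top_of_nonneg ?_ (measure_ne_top _ _)
      norm_num
    have h2 := ENNReal.Tendsto.mul_const h (Or.inr h1)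
    have h3 := ENNReal.Tendsto.const_mul h2 (Or.inr (ENNReal.ofReal_ne_top (r := M)))
    simpa using h3
  refine tendsto_of_tendsto_of_tendsto_of_le_of_le tendsto_const_nhds hlim
    (fun _ => zero_le) fun k => ?_
  have hm : AEStronglyMeasurable (ak k - a) (volume.restrict Ω) :=
    (hak k).aestronglyMeasurable.sub ha.aestronglyMeasurable
  calc ∫⁻ x in A, ‖⟪ψ x, ak k x⟫ - ⟪ψ x, a x⟫‖ₑ
      ≤ ∫⁻ x in Ω, ‖⟪ψ x, ak k x⟫ - ⟪ψ x, a x⟫‖ₑ := lintegral_mono' hle le_rfl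
    _ ≤ ∫⁻ x in Ω, ENNReal.ofReal M * ‖(ak k - a) x‖ₑ := by
        refine lintegral_mono_ae ?_
        filter_upwards [hbd'] with x hx
        rw [← inner_sub_right]
        have : ‖⟪ψ x, ak k x - a x⟫‖ₑ ≤ ‖ψ x‖ₑ * ‖ak k x - a x‖ₑ := by
          rw [← ofReal_norm, ← ofReal_norm, ← ofReal_norm, ← ENNReal.ofReal_mul (norm_nonneg _)]
          exact ENNReal.ofReal_le_ofReal (norm_inner_le_norm _ _)
        exact this.trans (mul_le_mul_left hx _)
    _ = ENNReal.ofReal M * eLpNorm (ak k - a) 1 (volume.restrict Ω) := by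
        rw [lintegral_const_mul' _ _ ENNReal.ofReal_ne_top, eLpNorm_one_eq_lintegral_enorm]
    _ ≤ _ := by
        gcongr
        exact eLpNorm_le_eLpNorm_mul_rpow_measure_univ one_le_two hm

section Weak

variable {d : ℕ} {Ω : Set (Pt d)}

/-- The `H¹₀` gradient of a `C¹` function is its classical gradient. -/
theorem HasH10Gradient.ae_eq_gradient (hΩo : IsOpen Ω) (hΩ : Bornology.IsBounded Ω)
    {u : Pt d → ℝ} {G : Pt d → Pt d} (h : HasH10Gradient Ω u G) (hu : ContDiff ℝ 1 u) :
    ∀ᵐ x, x ∈ Ω → G x = ∇ u x := by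
  have hfin : IsFiniteMeasure (volume.restrict Ω) := ⟨by simpa using hΩ.measure_lt_top⟩
  obtain ⟨φ, hφ, hφu, hφG⟩ := h.approx
  have hφ1 : ∀ k, ContDiff ℝ 1 (φ k) := fun k => (hφ k).1.of_le (by exact_mod_cast le_top)
  have hgc : Continuous (∇ u) := (contDiff_gradient (m := 0) hu (by norm_num)).continuous
  have hφc : ∀ k, Continuous (∇ (φ k)) := fun k =>
    (contDiff_gradient (m := 0) (hφ1 k) (by norm_num)).continuous
  have hmem1 : ∀ k, MemLp (φ k) 2 (volume.restrict Ω) := fun k =>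
    (((hφ k).1.continuous).memLp_of_hasCompactSupport (hφ k).2.1).restrict Ω
  have hmem2 : ∀ k, MemLp (∇ (φ k)) 2 (volume.restrict Ω) := fun k =>
    ((hφc k).memLp_of_hasCompactSupport (hasCompactSupport_gradient (hφ k).2.1)).restrict Ω
  have hkey : ∀ e : Pt d, ∀ᵐ x, x ∈ Ω → ⟪G x - ∇ u x, e⟫ = 0 := by
    intro e
    have hGi : IntegrableOn (fun x => ⟪G x, e⟫) Ω :=
      (h.memLp_grad.integrable one_le_two).inner_const e
    have hui : IntegrableOn (fun x => ⟪∇ u x, e⟫) Ω :=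
      (((hgc.inner continuous_const).continuousOn.integrableOn_compact
        hΩ.isCompact_closure).mono_set subset_closure)
    refine hΩo.ae_eq_zero_of_integral_contDiff_smul_eq_zero ?_ fun g hg hgs hgt => ?_
    · have : IntegrableOn (fun x => ⟪G x - ∇ u x, e⟫) Ω := by
        simp_rw [inner_sub_left]
        exact hGi.sub hui
      exact this.locallyIntegrableOn
    have hg1 : ContDiff ℝ 1 g := hg.of_le (by exact_mod_cast le_top)
    have hgg : Continuous (∇ g) := (contDiff_gradient (m := 0) hg1 (by norm_num)).continuous
    have hg0 : ∀ x, x ∉ Ω → g x = 0 := fun x hx => image_eq_zero_of_notMem_tsupport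
      fun hxt => hx (hgt hxt)
    have hgg0 : ∀ x, x ∉ Ω → ⟪∇ g x, e⟫ = 0 := fun x hx => by
      rw [inner_grad]
      have : fderiv ℝ g x = 0 := image_eq_zero_of_notMem_tsupport
        fun hxt => hx (hgt (tsupport_fderiv_subset ℝ hxt))
      simp [this]
    -- The pairings of `g • e` with `∇ (φ k)` tend to the pairing with `G`. Integrated by parts,
    -- they tend also to the pairing with `∇ u`. Uniqueness of the limit identifies `G` with `∇ u`
    -- in direction `e`.
    have l1 := tendsto_setIntegral_inner hΩ subset_rfl (ψ := fun x => g x • e)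
      (hg.continuous.smul continuous_const) h.memLp_grad hmem2 hφG
    have l2 := tendsto_setIntegral_inner hΩ subset_rfl (ψ := fun x => ⟪∇ g x, e⟫)
      (hgg.inner continuous_const) h.memLp hmem1 hφu
    have e1 : ∀ a : Pt d → ℝ, ContDiff ℝ 1 a → ∫ x in Ω, ⟪g x • e, ∇ a x⟫ =
        -∫ x in Ω, ⟪⟪∇ g x, e⟫, a x⟫ := by
      intro a ha
      have := integral_mul_inner_gradient hg1 hgs ha e
      rw [setIntegral_eq_integral_of_forall_compl_eq_zero fun x hx => by simp [hg0 x hx],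
        setIntegral_eq_integral_of_forall_compl_eq_zero fun x hx => by rw [hgg0 x hx]; simp]
      have e2 : ∫ x, ⟪⟪∇ g x, e⟫, a x⟫ = ∫ x, a x * ⟪∇ g x, e⟫ := rfl
      rw [e2, this, neg_neg]
      refine integral_congr_ae (Eventually.of_forall fun x => ?_)
      simp only
      rw [real_inner_smul_left, real_inner_comm, mul_comm]
    have l3 : Tendsto (fun k => ∫ x in Ω, ⟪g x • e, ∇ (φ k) x⟫) atTop
        (𝓝 (∫ x in Ω, ⟪g x • e, ∇ u x⟫)) := by
      rw [e1 u hu]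
      exact l2.neg.congr fun k => (e1 _ (hφ1 k)).symm
    have huniq := tendsto_nhds_unique l1 l3
    have hgbd : ∃ M, ∀ x, ‖g x‖ ≤ M := hgs.exists_bound_of_continuous hg.continuous
    obtain ⟨M, hM⟩ := hgbd
    have i1 : IntegrableOn (fun x => g x * ⟪G x, e⟫) Ω :=
      hGi.bdd_mul hg.continuous.aestronglyMeasurable (Eventually.of_forall hM)
    have i2 : IntegrableOn (fun x => g x * ⟪∇ u x, e⟫) Ω :=
      hui.bdd_mul hg.continuous.aestronglyMeasurable (Eventually.of_forall hM)
    rw [← setIntegral_eq_integral_of_forall_compl_eq_zero (s := Ω) fun x hx => by simp [hg0 x hx]]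
    simp_rw [smul_eq_mul, inner_sub_left, mul_sub]
    rw [integral_sub i1 i2, sub_eq_zero]
    simp_rw [real_inner_smul_left] at huniq
    simp_rw [real_inner_comm e] at huniq ⊢
    simpa [real_inner_comm] using huniq
  have hall : ∀ᵐ x, ∀ i, x ∈ Ω → ⟪G x - ∇ u x, EuclideanSpace.basisFun (Fin d) ℝ i⟫ = 0 :=
    ae_all_iff.2 fun i => hkey _
  filter_upwards [hall] with x hx hxΩ
  rw [← sub_eq_zero]
  ext i
  simpa [EuclideanSpace.inner_single_right] using hx i hxΩ

theorem hasH10Gradient_of_test {φ : Pt d → ℝ} (hφ : ContDiff ℝ ∞ φ) (hc : HasCompactSupport φ)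
    (hs : tsupport φ ⊆ Ω) : HasH10Gradient Ω φ (∇ φ) where
  memLp := (hφ.continuous.memLp_of_hasCompactSupport hc).restrict Ω
  memLp_grad :=
    (((contDiff_gradient (m := 0) hφ (by exact_mod_cast le_top)).continuous).memLp_of_hasCompactSupport
      (hasCompactSupport_gradient hc)).restrict Ω
  approx := ⟨fun _ => φ, fun _ => ⟨hφ, hc, hs⟩, by simp [normL2], by simp [normL2]⟩

/-- A weak solution of class `C²` satisfies `-Δu = f` almost everywhere. -/
theorem IsWeakSolution.ae_eq_neg_lap (hΩo : IsOpen Ω) (hΩ : Bornology.IsBounded Ω)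
    {u f : Pt d → ℝ} (hu : ContDiff ℝ 2 u) (hf : MemLp f 2 (volume.restrict Ω))
    (h : IsWeakSolution Ω (idField d) f u) : ∀ᵐ x, x ∈ Ω → f x + lap u x = 0 := by
  have hfin : IsFiniteMeasure (volume.restrict Ω) := ⟨by simpa using hΩ.measure_lt_top⟩
  obtain ⟨G, hG, hw⟩ := h
  have hGu := hG.ae_eq_gradient hΩo hΩ (hu.of_le (by norm_num))
  have hfi : IntegrableOn f Ω := hf.integrable one_le_two
  have hli : IntegrableOn (lap u) Ω :=
    ((continuous_lap hu).continuousOn.integrableOn_compact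
      hΩ.isCompact_closure).mono_set subset_closure
  refine hΩo.ae_eq_zero_of_integral_contDiff_smul_eq_zero
    (hfi.add hli).locallyIntegrableOn fun g hg hgs hgt => ?_
  have hg1 : ContDiff ℝ 1 g := hg.of_le (by exact_mod_cast le_top)
  have hg0 : ∀ x, x ∉ Ω → g x = 0 := fun x hx => image_eq_zero_of_notMem_tsupport
    fun hxt => hx (hgt hxt)
  have hgg0 : ∀ x, x ∉ Ω → ∇ g x = 0 := fun x hx => by
    have : fderiv ℝ g x = 0 := image_eq_zero_of_notMem_tsupport
      fun hxt => hx (hgt (tsupport_fderiv_subset ℝ hxt))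
    simp [gradient, this]
  have h1 := hw g (∇ g) (hasH10Gradient_of_test hg hgs hgt)
  have h2 : ∫ x in Ω, ⟪idField d x (G x), ∇ g x⟫ = ∫ x, ⟪∇ u x, ∇ g x⟫ := by
    rw [← setIntegral_eq_integral_of_forall_compl_eq_zero (s := Ω)
      (f := fun x => ⟪∇ u x, ∇ g x⟫) fun x hx => by rw [hgg0 x hx, inner_zero_right]]
    refine setIntegral_congr_ae hΩo.measurableSet ?_
    filter_upwards [hGu] with x hx hxΩ
    simp [idField, hx hxΩ]
  let b := EuclideanSpace.basisFun (Fin d) ℝ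
  have hgc : Continuous (∇ g) := (contDiff_gradient (m := 0) hg1 (by norm_num)).continuous
  have h3 : ∫ x, ⟪∇ u x, ∇ g x⟫ = -∫ x, lap u x * g x := by
    have e1 : ∀ x, ⟪∇ u x, ∇ g x⟫ = ∑ i, ⟪∇ u x, b i⟫ * ⟪∇ g x, b i⟫ := by
      intro x
      rw [← b.sum_inner_mul_inner]
      exact Finset.sum_congr rfl fun i _ => by rw [real_inner_comm (∇ g x)]
    simp_rw [e1, lap, Finset.sum_mul]
    rw [integral_finsetSum, integral_finsetSum, ← Finset.sum_neg_distrib]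
    · refine Finset.sum_congr rfl fun i _ => ?_
      rw [integral_mul_inner_gradient hg1 hgs (contDiff_inner_gradient hu _)]
      simp_rw [inner_grad (fun y => ⟪∇ u y, b i⟫)]
      rfl
    · intro i _
      exact ((((contDiff_inner_gradient hu _).continuous_fderiv one_ne_zero).clm_apply
        continuous_const).mul hg.continuous).integrable_of_hasCompactSupport hgs.mul_left
    · intro i _
      refine ((contDiff_inner_gradient hu _).continuous.mul
        (hgc.inner continuous_const)).integrable_of_hasCompactSupport (HasCompactSupport.mul_left ?_)
      exact (hasCompactSupport_gradient hgs).comp_left (g := fun y => ⟪y, b i⟫) (by simp)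
  obtain ⟨M, hM⟩ := hgs.exists_bound_of_continuous hg.continuous
  have i1 : IntegrableOn (fun x => g x * f x) Ω :=
    hfi.bdd_mul hg.continuous.aestronglyMeasurable (Eventually.of_forall hM)
  have i2 : IntegrableOn (fun x => g x * lap u x) Ω :=
    hli.bdd_mul hg.continuous.aestronglyMeasurable (Eventually.of_forall hM)
  rw [← setIntegral_eq_integral_of_forall_compl_eq_zero (s := Ω) fun x hx => by simp [hg0 x hx]]
  simp_rw [smul_eq_mul, mul_add]
  rw [integral_add i1 i2]
  rw [h2, h3, ← setIntegral_eq_integral_of_forall_compl_eq_zero (s := Ω)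
    (f := fun x => lap u x * g x) fun x hx => by simp [hg0 x hx]] at h1
  simp_rw [mul_comm (g _)]
  rw [← h1]
  simp

end Weak

/-! ### Zero trace on boundary edges and exact flux balance -/

namespace IsStarCell

variable {d : ℕ} {ι : Type*} {K : Set (Pt d)} {c : Pt d} {S : Finset ι} {σ : ι → Set (Pt d)}
  {n : ι → Pt d} {δ : ι → ℝ} (h : IsStarCell K c S σ n δ)

include h

/-- The divergence theorem for the radial field `h(x) (x - c)` on the cone over an edge. -/
theorem integral_cone_radial {i : ι} (hi : i ∈ S) {g : Pt d → ℝ} (hg : ContDiff ℝ 1 g) :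
    ∫ x in coneOver c (σ i), (d * g x + fderiv ℝ g x (x - c)) =
      δ i * ∫ y in σ i, g y ∂(surf d) := by
  have hd := h.dim_pos hi
  have hgc := hg.continuous
  have hgd : Continuous (fderiv ℝ g) := hg.continuous_fderiv one_ne_zero
  rw [h.integral_cone hi (by fun_prop)]
  have hfin : IsFiniteMeasure ((surf d).restrict (σ i)) :=
    ⟨by simpa using h.surf_edge_lt_top hi⟩
  let Ψ : ℝ → Pt d → ℝ := fun t y => δ i * t ^ (d - 1) *
    (d * g (c + t • (y - c)) + fderiv ℝ g (c + t • (y - c)) (c + t • (y - c) - c))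
  have hΨ : Continuous (Function.uncurry Ψ) := by
    simp only [Ψ, Function.uncurry_def]
    fun_prop
  have hint : Integrable (Function.uncurry Ψ)
      ((volume.restrict (Set.uIoc (0 : ℝ) 1)).prod ((surf d).restrict (σ i))) := by
    have hcomp : IsCompact (Set.Icc (0 : ℝ) 1 ×ˢ closure (σ i)) :=
      isCompact_Icc.prod (h.isBounded_edge hi).isCompact_closure
    obtain ⟨M, hM⟩ := hcomp.exists_bound_of_continuousOn hΨ.continuousOn
    have : IsFiniteMeasure ((volume : Measure ℝ).restrict (Set.uIoc (0 : ℝ) 1)) := by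
      rw [Set.uIoc_of_le zero_le_one]
      infer_instance
    refine Integrable.of_bound hΨ.aestronglyMeasurable M ?_
    have a1 : ∀ᵐ p ∂((volume.restrict (Set.uIoc (0 : ℝ) 1)).prod ((surf d).restrict (σ i))),
        p.1 ∈ Set.uIoc (0 : ℝ) 1 :=
      Measure.quasiMeasurePreserving_fst.ae (ae_restrict_mem measurableSet_uIoc)
    have a2 : ∀ᵐ p ∂((volume.restrict (Set.uIoc (0 : ℝ) 1)).prod ((surf d).restrict (σ i))),
        p.2 ∈ σ i :=
      Measure.quasiMeasurePreserving_snd.ae (ae_restrict_mem (h.measurableSet_edge hi))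
    filter_upwards [a1, a2] with p h1 h2
    rw [Set.uIoc_of_le zero_le_one] at h1
    exact hM p ⟨⟨h1.1.le, h1.2⟩, subset_closure h2⟩
  have e1 : ∫ t in (0 : ℝ)..1, δ i * t ^ (d - 1) * ∫ y in σ i, (d * g (c + t • (y - c)) +
      fderiv ℝ g (c + t • (y - c)) (c + t • (y - c) - c)) ∂(surf d) =
      ∫ t in (0 : ℝ)..1, ∫ y in σ i, Ψ t y ∂(surf d) := by
    refine intervalIntegral.integral_congr fun t _ => ?_
    simp only [Ψ]
    rw [integral_const_mul]
  rw [e1, intervalIntegral_integral_swap hint, ← integral_const_mul]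
  refine integral_congr_ae (Eventually.of_forall fun y => ?_)
  -- After Fubini the integrand along each ray is the derivative of `δ t^d g(c + t (y - c))`; the
  -- value at `t = 0` vanishes because `d > 0`.
  have hder : ∀ t : ℝ, HasDerivAt (fun t : ℝ => δ i * (t ^ d * g (c + t • (y - c)))) (Ψ t y) t := by
    intro t
    have h1 : HasDerivAt (fun t : ℝ => c + t • (y - c)) (y - c) t := by
      simpa using ((hasDerivAt_id t).smul_const (y - c)).const_add c
    have h2 : HasDerivAt (fun t : ℝ => g (c + t • (y - c)))
        (fderiv ℝ g (c + t • (y - c)) (y - c)) t :=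
      (hg.differentiable one_ne_zero _).hasFDerivAt.comp_hasDerivAt t h1
    have h3 := ((hasDerivAt_pow d t).mul h2).const_mul (δ i)
    refine h3.congr_deriv ?_
    simp only [Ψ]
    rw [add_sub_cancel_left, map_smul, smul_eq_mul]
    have : t ^ d = t ^ (d - 1) * t := by rw [← pow_succ]; congr 1; omega
    rw [this]
    ring
  have hcy : Continuous fun t => Ψ t y := hΨ.comp (by fun_prop : Continuous fun t : ℝ => (t, y))
  simp only
  rw [intervalIntegral.integral_eq_sub_of_hasDerivAt (fun t _ => hder t)
    (hcy.intervalIntegrable _ _)]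
  simp [hd.ne']

/-- A continuous function on an edge which vanishes almost everywhere vanishes. -/
theorem eq_zero_of_integral_sq {i : ι} (hi : i ∈ S) {g : Pt d → ℝ} (hg : Continuous g)
    (h0 : ∫ y in σ i, g y ^ 2 ∂(surf d) = 0) {y : Pt d} (hy : y ∈ σ i) : g y = 0 := by
  by_contra hne
  have hd := h.dim_pos hi
  have hfin : IsFiniteMeasure ((surf d).restrict (σ i)) :=
    ⟨by simpa using h.surf_edge_lt_top hi⟩
  have hint : IntegrableOn (fun y => g y ^ 2) (σ i) (surf d) := by
    obtain ⟨M, hM⟩ := (h.isBounded_edge hi).isCompact_closure.exists_bound_of_continuousOn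
      (hg.pow 2).continuousOn
    refine Measure.integrableOn_of_bounded (M := M) (h.surf_edge_lt_top hi).ne
      (hg.pow 2).aestronglyMeasurable ?_
    exact (ae_restrict_mem (h.measurableSet_edge hi)).mono fun x hx => hM x (subset_closure hx)
  have hae := (setIntegral_eq_zero_iff_of_nonneg_ae
    (Eventually.of_forall fun y => sq_nonneg (g y)) hint).1 h0
  obtain ⟨U, hU, hσ⟩ := h.exists_open i hi
  have hWo : IsOpen {x | g x ≠ 0} := isOpen_ne_fun hg continuous_const
  -- Where `g` is nonzero, the edge is relatively open and has no area. The cone over this part is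
  -- then open, nonempty and of zero volume, a contradiction.
  let σ' := {x | g x ≠ 0} ∩ σ i
  have hσ' : σ' = ({x | g x ≠ 0} ∩ U) ∩ {y | ⟪n i, y - c⟫ = δ i} := by
    simp only [σ']
    rw [hσ, Set.inter_assoc]
  have hnull : surf d σ' = 0 := by
    have h1 := measure_mono_null (s := {x | g x ≠ 0}) (μ := (surf d).restrict (σ i))
      (fun x hx => ?_) (ae_iff.1 hae)
    · rwa [Measure.restrict_apply hWo.measurableSet] at h1
    · simpa using hx
  have hopen : IsOpen (coneOver c σ') :=
    isOpen_coneOver (h.height_pos i hi) (hWo.inter hU) hσ'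
  have hvol := volume_coneOver (σ := σ') hd (h.norm_normal i hi) (h.height_pos i hi)
    (fun z hz => h.inner_eq hi hz.2) (hWo.measurableSet.inter (h.measurableSet_edge hi))
  rw [hnull, mul_zero] at hvol
  have hne' : (coneOver c σ').Nonempty :=
    ⟨_, y, ⟨hne, hy⟩, 1 / 2, ⟨by norm_num, by norm_num⟩, rfl⟩
  exact (hopen.measure_pos volume hne').ne' hvol

/-- A `C¹` function of `H¹₀` vanishes on the edges included in the boundary. -/
theorem eq_zero_of_hasH10Gradient {Ω : Set (Pt d)} (hΩo : IsOpen Ω)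
    (hΩ : Bornology.IsBounded Ω) (hK : K ⊆ Ω) {i : ι} (hi : i ∈ S) (hσ : σ i ⊆ frontier Ω)
    {u : Pt d → ℝ} {G : Pt d → Pt d} (hu : ContDiff ℝ 1 u) (hG : HasH10Gradient Ω u G)
    {y : Pt d} (hy : y ∈ σ i) : u y = 0 := by
  refine h.eq_zero_of_integral_sq hi hu.continuous ?_ hy
  have hGu := hG.ae_eq_gradient hΩo hΩ hu
  obtain ⟨φ, hφ, hφu, hφG⟩ := hG.approx
  have hφ1 : ∀ k, ContDiff ℝ 1 (φ k) := fun k => (hφ k).1.of_le (by exact_mod_cast le_top)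
  have hgc : Continuous (∇ u) := (contDiff_gradient (m := 0) hu (by norm_num)).continuous
  have hφc : ∀ k, Continuous (∇ (φ k)) := fun k =>
    (contDiff_gradient (m := 0) (hφ1 k) (by norm_num)).continuous
  have hmem1 : ∀ k, MemLp (φ k) 2 (volume.restrict Ω) := fun k =>
    (((hφ k).1.continuous).memLp_of_hasCompactSupport (hφ k).2.1).restrict Ω
  have hmem2 : ∀ k, MemLp (∇ (φ k)) 2 (volume.restrict Ω) := fun k =>
    ((hφc k).memLp_of_hasCompactSupport (hasCompactSupport_gradient (hφ k).2.1)).restrict Ω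
  have huc := hu.continuous
  let C := coneOver c (σ i)
  have hCΩ : C ⊆ Ω := (h.cone_subset hi).trans hK
  have hCm : MeasurableSet C := (h.isOpen_cone hi).measurableSet
  -- These weights are such that `ψ₁ a + ⟪ψ₂, ∇ a⟫` is the divergence of `a u (x - c)`. On the cone
  -- its integral is therefore `δ i` times the integral of `a u` over the edge: zero for the
  -- approximations `φ k`, which vanish off `Ω`, and in the limit equal to `δ i` times the integral
  -- of `u²`.
  let ψ₁ : Pt d → ℝ := fun x => d * u x + ⟪∇ u x, x - c⟫
  let ψ₂ : Pt d → Pt d := fun x => u x • (x - c)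
  have hψ₁ : Continuous ψ₁ := by fun_prop
  have hψ₂ : Continuous ψ₂ := by fun_prop
  have l1 := tendsto_setIntegral_inner hΩ hCΩ hψ₁ hG.memLp hmem1 hφu
  have l2 := tendsto_setIntegral_inner hΩ hCΩ hψ₂ hG.memLp_grad hmem2 hφG
  have hl := l1.add l2
  have hcint : ∀ q : Pt d → ℝ, Continuous q → IntegrableOn q C := fun q hq =>
    (hq.continuousOn.integrableOn_compact hΩ.isCompact_closure).mono_set
      (hCΩ.trans subset_closure)
  have key : ∀ a : Pt d → ℝ, ContDiff ℝ 1 a →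
      (∫ x in C, ⟪ψ₁ x, a x⟫) + ∫ x in C, ⟪ψ₂ x, ∇ a x⟫ =
        δ i * ∫ y in σ i, a y * u y ∂(surf d) := by
    intro a ha
    have hac := ha.continuous
    have hagc : Continuous (∇ a) := (contDiff_gradient (m := 0) ha (by norm_num)).continuous
    rw [← integral_add (hcint _ (by fun_prop)) (hcint _ (by fun_prop)),
      ← h.integral_cone_radial hi (ha.mul hu)]
    refine setIntegral_congr_fun hCm fun x _ => ?_
    have : fderiv ℝ (fun x => a x * u x) x = a x • fderiv ℝ u x + u x • fderiv ℝ a x :=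
      fderiv_fun_mul (ha.differentiable one_ne_zero x) (hu.differentiable one_ne_zero x)
    have e1 : ⟪ψ₁ x, a x⟫ = a x * (d * u x + fderiv ℝ u x (x - c)) := by
      rw [← inner_grad]
      rfl
    have e2 : ⟪ψ₂ x, ∇ a x⟫ = u x * fderiv ℝ a x (x - c) := by
      rw [← inner_grad, real_inner_comm]
      exact real_inner_smul_right _ _ _
    rw [e1, e2]
    change _ = d * (a x * u x) + fderiv ℝ (fun x => a x * u x) x (x - c)
    rw [this]
    simp only [_root_.add_apply, _root_.smul_apply, smul_eq_mul]
    ring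
  have hzero : ∀ k, (∫ x in C, ⟪ψ₁ x, φ k x⟫) + ∫ x in C, ⟪ψ₂ x, ∇ (φ k) x⟫ = 0 := by
    intro k
    rw [key _ (hφ1 k)]
    have : ∫ y in σ i, φ k y * u y ∂(surf d) = 0 := by
      refine setIntegral_eq_zero_of_forall_eq_zero fun y hy => ?_
      have hyΩ : y ∉ Ω := by
        have := hσ hy
        rw [hΩo.frontier_eq] at this
        exact this.2
      rw [image_eq_zero_of_notMem_tsupport fun hyt => hyΩ ((hφ k).2.2 hyt), zero_mul]
    rw [this, mul_zero]
  have hlim : (∫ x in C, ⟪ψ₁ x, u x⟫) + ∫ x in C, ⟪ψ₂ x, G x⟫ = 0 :=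
    tendsto_nhds_unique hl (tendsto_const_nhds.congr fun k => (hzero k).symm)
  have hGC : ∫ x in C, ⟪ψ₂ x, G x⟫ = ∫ x in C, ⟪ψ₂ x, ∇ u x⟫ := by
    refine setIntegral_congr_ae hCm ?_
    filter_upwards [hGu] with x hx hxC
    rw [hx (hCΩ hxC)]
  rw [hGC, key u hu] at hlim
  have := (mul_eq_zero.1 hlim).resolve_left (h.height_pos i hi).ne'
  simpa [sq] using this

end IsStarCell

namespace Discretisation

variable {d : ℕ} {Ω : Set (Pt d)} (D : Discretisation Ω)

theorem eq_zero_on_extEdge (hΩo : IsOpen Ω) (hΩ : Bornology.IsBounded Ω) {u f : Pt d → ℝ}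
    (hu : ContDiff ℝ 2 u) (hw : IsWeakSolution Ω (idField d) f u) {σ : D.Edge}
    (hσ : σ ∈ D.extEdges) {y : Pt d} (hy : y ∈ D.edge σ) : u y = 0 := by
  obtain ⟨K, hK⟩ := D.exists_cell σ
  obtain ⟨G, hG, -⟩ := hw
  exact (D.isStarCell hΩ K).eq_zero_of_hasH10Gradient hΩo hΩ (D.cell_subset K) hK
    (D.edge_subset_frontier_of_ext hσ) (hu.of_le (by norm_num)) hG hy

/-- If `u` vanishes on an edge, its gradient there is orthogonal to the edge. -/
theorem inner_gradient_eq_zero {u : Pt d → ℝ} (hu : ContDiff ℝ 2 u) {σ : D.Edge}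
    (h0 : ∀ y ∈ D.edge σ, u y = 0) {y z : Pt d} (hy : y ∈ D.edge σ) (hz : z ∈ D.edge σ) :
    ⟪∇ u y, z - y⟫ = 0 := by
  obtain ⟨K, hK⟩ := D.exists_cell σ
  obtain ⟨U, hU, he⟩ := D.edge_open σ
  have hp := D.plane_eq_of_mem hK hy y
  have hline : HasDerivAt (fun t : ℝ => y + t • (z - y)) (z - y) 0 := by
    simpa using ((hasDerivAt_id (0 : ℝ)).smul_const (z - y)).const_add y
  have hder : HasDerivAt (fun t : ℝ => u (y + t • (z - y))) (fderiv ℝ u y (z - y)) 0 := by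
    have h1 : HasFDerivAt u (fderiv ℝ u y) (y + (0 : ℝ) • (z - y)) := by
      simpa using (hu.differentiable two_ne_zero y).hasFDerivAt
    exact h1.comp_hasDerivAt 0 hline
  have hev : (fun t : ℝ => u (y + t • (z - y))) =ᶠ[𝓝 0] fun _ => 0 := by
    have hyU : y + (0 : ℝ) • (z - y) ∈ U := by
      simpa using (he ▸ hy : y ∈ U ∩ D.plane σ).1
    filter_upwards [hline.continuousAt.eventually (hU.mem_nhds hyU)] with t ht
    refine h0 _ ?_
    rw [he, hp]
    refine ⟨ht, ?_⟩
    have hzp : z ∈ D.plane σ := (he ▸ hz : z ∈ U ∩ D.plane σ).2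
    rw [hp] at hzp
    have hzp' : ⟪D.normal K σ, z - y⟫ = ⟪D.normal K σ, y - y⟫ := hzp
    rw [Set.mem_ofPred_eq, add_sub_cancel_left, inner_smul_right, hzp']
    simp
  rw [inner_grad]
  exact hder.unique ((hasDerivAt_const (0 : ℝ) (0 : ℝ)).congr_of_eventuallyEq hev)

/-- Integrate `-Δu = f` over the cell and apply the divergence theorem to each component of `∇ u`.
-/
theorem integral_cell_eq (hd : 0 < d) (hΩo : IsOpen Ω) (hΩ : Bornology.IsBounded Ω)
    {u f : Pt d → ℝ} (hu : ContDiff ℝ 2 u) (hf : MemLp f 2 (volume.restrict Ω))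
    (hw : IsWeakSolution Ω (idField d) f u) (K : D.Cell) :
    ∫ x in D.cell K, f x =
      -∑ σ ∈ D.edgesOf K, ⟪D.normal K σ, ∫ y in D.edge σ, ∇ u y ∂(surf d)⟫ := by
  have hae := hw.ae_eq_neg_lap hΩo hΩ hu hf
  have hgc : Continuous (∇ u) := (contDiff_gradient (m := 0) hu (by norm_num)).continuous
  let b := EuclideanSpace.basisFun (Fin d) ℝ
  have h1 : ∫ x in D.cell K, f x = -∫ x in D.cell K, lap u x := by
    rw [← integral_neg]
    refine setIntegral_congr_ae (D.cell_open K).measurableSet ?_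
    filter_upwards [hae] with x hx hxK
    have := hx (D.cell_subset K hxK)
    linarith
  have hS := D.isStarCell hΩ K
  rw [h1]
  congr 1
  simp_rw [lap]
  rw [integral_finsetSum]
  · simp_rw [hS.integral_fderiv hd (contDiff_inner_gradient hu _)]
    rw [Finset.sum_comm]
    refine Finset.sum_congr rfl fun σ _ => ?_
    rw [← b.sum_inner_mul_inner]
    refine Finset.sum_congr rfl fun i _ => ?_
    congr 1
    rw [← integral_inner (D.integrableOn_edge hΩ σ hgc)]
    simp_rw [real_inner_comm]
    rfl
  · intro i _
    exact ((((contDiff_inner_gradient hu _).continuous_fderiv one_ne_zero).clm_apply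
      continuous_const).continuousOn.integrableOn_compact
        hS.isBounded.isCompact_closure).mono_set subset_closure

end Discretisation

/-! ### Consistency of the interpolate and bounds for the discrete gradient -/

/-- First-order Taylor bounds with constant `M` on the ball of radius `R`. -/
structure IsTaylorBound {d : ℕ} (u : Pt d → ℝ) (R M : ℝ) : Prop where
  nonneg : 0 ≤ M
  grad : ∀ x y : Pt d, ‖x‖ ≤ R → ‖y‖ ≤ R → ‖∇ u y - ∇ u x‖ ≤ M * ‖y - x‖
  taylor : ∀ x y : Pt d, ‖x‖ ≤ R → ‖y‖ ≤ R → |u y - u x - ⟪∇ u x, y - x⟫| ≤ M * ‖y - x‖ ^ 2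

theorem exists_isTaylorBound {d : ℕ} {u : Pt d → ℝ} (hu : ContDiff ℝ 2 u) (R : ℝ) :
    ∃ M, IsTaylorBound u R M := by
  have hgd : ContDiff ℝ 1 (∇ u) := contDiff_gradient hu (by norm_num)
  obtain ⟨C, hC⟩ := hgd.contDiffOn.exists_lipschitzOnWith (s := Metric.closedBall (0 : Pt d) R)
    one_ne_zero (convex_closedBall _ _) (isCompact_closedBall _ _)
  have hg : ∀ x y : Pt d, ‖x‖ ≤ R → ‖y‖ ≤ R → ‖∇ u y - ∇ u x‖ ≤ C * ‖y - x‖ := fun x y hx hy => by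
    have := hC.dist_le_mul y (by simpa using hy) x (by simpa using hx)
    rwa [dist_eq_norm, dist_eq_norm] at this
  refine ⟨C, C.2, hg, fun x y hx hy => ?_⟩
  have hseg : ∀ z ∈ segment ℝ x y, ‖z‖ ≤ R ∧ ‖z - x‖ ≤ ‖y - x‖ := by
    intro z hz
    refine ⟨?_, ?_⟩
    · have := (convex_closedBall (0 : Pt d) R).segment_subset (by simpa using hx)
        (by simpa using hy) hz
      simpa using this
    · rw [segment_eq_image'] at hz
      obtain ⟨t, ht, rfl⟩ := hz
      simp only [add_sub_cancel_left]
      rw [norm_smul, Real.norm_of_nonneg ht.1]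
      exact mul_le_of_le_one_left (norm_nonneg _) ht.2
  have := (convex_segment x y).norm_image_sub_le_of_norm_fderiv_le' (𝕜 := ℝ) (f := u)
    (φ := fderiv ℝ u x) (C := C * ‖y - x‖) (fun z _ => hu.differentiable two_ne_zero z)
    (fun z hz => by
      obtain ⟨h1, h2⟩ := hseg z hz
      have : ‖fderiv ℝ u z - fderiv ℝ u x‖ = ‖∇ u z - ∇ u x‖ := by
        rw [← (InnerProductSpace.toDual ℝ (Pt d)).norm_map (∇ u z - ∇ u x), map_sub,
          toDual_gradient, toDual_gradient]
      rw [this]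
      refine (hg x z hx h1).trans ?_
      gcongr)
    (left_mem_segment ℝ x y) (right_mem_segment ℝ x y)
  rw [inner_grad, ← Real.norm_eq_abs]
  exact this.trans_eq (by ring)

namespace Discretisation

variable {d : ℕ} {Ω : Set (Pt d)} (D : Discretisation Ω)

/-- The shape-regularity bounds encoded in `θ_{D,B}`, with a constant at least `1`. -/
structure IsRegular (B : Finset D.Edge) (β : D.Edge → D.Cell → ℝ) (T : ℝ) : Prop where
  one_le : 1 ≤ T
  diam_le : ∀ K, ∀ σ ∈ D.edgesOf K, D.diam K ≤ T * D.dist K σ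
  bary_le : ∀ K, ∀ σ ∈ D.edgesOf K, σ ∈ B →
    ∑ L, |β σ L| * ‖D.center L - D.bary σ‖ ^ 2 ≤ T * D.diam K ^ 2

theorem isRegular_of_regB_le (hΩ : Bornology.IsBounded Ω) {B : Finset D.Edge}
    {β : D.Edge → D.Cell → ℝ} {θ : ℝ} (h : D.regB B β ≤ θ) : D.IsRegular B β (max θ 1) := by
  have h1 : D.reg ≤ θ := (le_max_left _ _).trans h
  refine ⟨le_max_right _ _, fun K σ hσ => ?_, fun K σ hσ hB => ?_⟩
  · have hδ : 0 < D.dist K σ := D.dist_pos K σ hσ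
    rw [← div_le_iff₀ hδ]
    refine le_trans ?_ (((le_max_right _ _).trans h1).trans (le_max_left _ _))
    -- A real supremum dominates its members only when the set is bounded above; boundedness comes
    -- from the finiteness of the mesh.
    refine le_csSup ?_ ⟨K, σ, hσ, rfl⟩
    refine ((Set.finite_range fun p : D.Cell × D.Edge =>
      D.diam p.1 / D.dist p.1 p.2).subset ?_).bddAbove
    rintro _ ⟨K, σ, -, rfl⟩
    exact ⟨(K, σ), rfl⟩
  · have hδ : 0 < D.diam K := (D.dist_pos K σ hσ).trans_le (D.dist_le_diam hΩ hσ)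
    rw [← div_le_iff₀ (by positivity)]
    refine le_trans ?_ (((le_max_right _ _).trans h).trans (le_max_left _ _))
    refine le_csSup ?_ ⟨K, σ, hσ, hB, rfl⟩
    refine ((Set.finite_range fun p : D.Cell × D.Edge =>
      (∑ L, |β p.2 L| * ‖D.center L - D.bary p.2‖ ^ 2) / D.diam p.1 ^ 2).subset ?_).bddAbove
    rintro _ ⟨K, σ, -, -, rfl⟩
    exact ⟨(K, σ), rfl⟩

section Linear

variable (v w : D.X) (K : D.Cell) (σ : D.Edge)

theorem gradK_sub : D.gradK (v - w) K = D.gradK v K - D.gradK w K := by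
  rw [gradK, gradK, gradK, ← smul_sub, ← Finset.sum_sub_distrib]
  congr 1
  refine Finset.sum_congr rfl fun σ _ => ?_
  rw [← sub_smul]
  congr 1
  simp only [Prod.fst_sub, Prod.snd_sub, Pi.sub_apply]
  ring

theorem gradKσ_sub : D.gradKσ (v - w) K σ = D.gradKσ v K σ - D.gradKσ w K σ := by
  have : D.stab (v - w) K σ = D.stab v K σ - D.stab w K σ := by
    simp only [stab, gradK_sub, inner_sub_left, Prod.fst_sub, Prod.snd_sub, Pi.sub_apply]
    ring
  rw [gradKσ, gradKσ, gradKσ, gradK_sub, this]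
  module

theorem gradD_sub : D.gradD (v - w) = D.gradD v - D.gradD w := by
  ext1 x
  simp only [gradD, Pi.sub_apply, ← Finset.sum_sub_distrib]
  refine Finset.sum_congr rfl fun K _ => Finset.sum_congr rfl fun σ _ => ?_
  by_cases hx : x ∈ D.cone K σ
  · simp only [Set.indicator_of_mem hx, gradKσ_sub]
  · simp only [Set.indicator_of_notMem hx, sub_zero]

end Linear

section Bounds

variable (hd : 0 < d) (hΩ : Bornology.IsBounded Ω) {B : Finset D.Edge} {β : D.Edge → D.Cell → ℝ}
  {T : ℝ} (hT : D.IsRegular B β T)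

include hd hΩ

/-- The contribution of `K` to the square of the seminorm `|v|_X`. -/
def cellSeminormSq (v : D.X) (K : D.Cell) : ℝ :=
  ∑ σ ∈ D.edgesOf K, D.area σ / D.dist K σ * (v.2 σ - v.1 K) ^ 2

/-- Cauchy–Schwarz with weights `|σ| d_{K,σ}`, whose sum is `d |K|`. -/
theorem vol_mul_norm_gradK_sq_le (v : D.X) (K : D.Cell) :
    D.vol K * ‖D.gradK v K‖ ^ 2 ≤ d * D.cellSeminormSq v K := by
  have hV := D.vol_pos hΩ K
  have h1 : D.vol K * ‖D.gradK v K‖ ≤ ∑ σ ∈ D.edgesOf K, D.area σ * |v.2 σ - v.1 K| := by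
    rw [gradK, norm_smul, norm_inv, Real.norm_of_nonneg hV.le, mul_inv_cancel_left₀ hV.ne']
    refine (norm_sum_le _ _).trans (Finset.sum_le_sum fun σ hσ => ?_)
    rw [norm_smul, (D.normal_spec K σ hσ).norm_eq, mul_one, Real.norm_eq_abs, abs_mul,
      abs_of_pos (D.area_pos hΩ σ)]
  have h2 : (∑ σ ∈ D.edgesOf K, D.area σ * |v.2 σ - v.1 K|) ^ 2 ≤
      (∑ σ ∈ D.edgesOf K, D.area σ * D.dist K σ) * D.cellSeminormSq v K := by
    refine Finset.sum_sq_le_sum_mul_sum_of_sq_le_mul _ (fun σ hσ => ?_) (fun σ hσ => ?_)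
      (fun σ hσ => ?_)
    all_goals
      have hA := D.area_pos hΩ σ
      have hδ : 0 < D.dist K σ := D.dist_pos K σ hσ
    · positivity
    · positivity
    · rw [mul_pow, sq_abs]
      refine le_of_eq ?_
      field_simp
  rw [D.sum_area_mul_dist hd hΩ] at h2
  have h3 : (D.vol K * ‖D.gradK v K‖) ^ 2 ≤ d * D.vol K * D.cellSeminormSq v K :=
    (pow_le_pow_left₀ (by positivity) h1 2).trans h2
  refine le_of_mul_le_mul_left ?_ hV
  calc D.vol K * (D.vol K * ‖D.gradK v K‖ ^ 2) = (D.vol K * ‖D.gradK v K‖) ^ 2 := by ring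
    _ ≤ _ := h3
    _ = _ := by ring

/-- The factor `√d` in the stabilisation is exactly what turns the cone volume `|σ| d_{K,σ} / d`
into the weight `|σ| / d_{K,σ}` of the seminorm. -/
theorem vol_cone_mul_stab_sq {K : D.Cell} {σ : D.Edge} (hσ : σ ∈ D.edgesOf K) (v : D.X) :
    volume.real (D.cone K σ) * D.stab v K σ ^ 2 = D.area σ / D.dist K σ *
      (v.2 σ - v.1 K - ⟪D.gradK v K, D.bary σ - D.center K⟫) ^ 2 := by
  have hδ : D.dist K σ ≠ 0 := (D.dist_pos K σ hσ).ne'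
  have hd' : (d : ℝ) ≠ 0 := Nat.cast_ne_zero.2 hd.ne'
  rw [D.vol_cone hd hΩ hσ, stab, mul_pow, div_pow, Real.sq_sqrt (Nat.cast_nonneg d)]
  field_simp

omit hd in
theorem abs_inner_bary_le {K : D.Cell} {σ : D.Edge} (hσ : σ ∈ D.edgesOf K) (g : Pt d) :
    |⟪g, D.bary σ - D.center K⟫| ≤ ‖g‖ * D.diam K := by
  refine (abs_real_inner_le_norm _ _).trans ?_
  gcongr
  exact D.norm_bary_sub_le hΩ hσ (subset_closure (D.center_mem K))

include hT

omit hd in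
theorem area_div_dist_mul_inner_sq_le {K : D.Cell} {σ : D.Edge} (hσ : σ ∈ D.edgesOf K) (g : Pt d) :
    D.area σ / D.dist K σ * ⟪g, D.bary σ - D.center K⟫ ^ 2 ≤
      D.area σ * D.dist K σ * (T ^ 2 * ‖g‖ ^ 2) := by
  have hA := D.area_pos hΩ σ
  have hδ : 0 < D.dist K σ := D.dist_pos K σ hσ
  have hT0 : 0 ≤ T := zero_le_one.trans hT.one_le
  have h1 : |⟪g, D.bary σ - D.center K⟫| ≤ ‖g‖ * (T * D.dist K σ) :=
    (D.abs_inner_bary_le hΩ hσ g).trans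
      (mul_le_mul_of_nonneg_left (hT.diam_le K σ hσ) (norm_nonneg _))
  calc _ = D.area σ / D.dist K σ * |⟪g, D.bary σ - D.center K⟫| ^ 2 := by rw [sq_abs]
    _ ≤ D.area σ / D.dist K σ * (‖g‖ * (T * D.dist K σ)) ^ 2 := by gcongr
    _ = _ := by field_simp

theorem sum_vol_cone_mul_stab_sq_le (v : D.X) (K : D.Cell) :
    ∑ σ ∈ D.edgesOf K, volume.real (D.cone K σ) * D.stab v K σ ^ 2 ≤
      2 * D.cellSeminormSq v K + 2 * T ^ 2 * d * (D.vol K * ‖D.gradK v K‖ ^ 2) := by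
  have h1 : ∀ σ ∈ D.edgesOf K, volume.real (D.cone K σ) * D.stab v K σ ^ 2 ≤
      2 * (D.area σ / D.dist K σ * (v.2 σ - v.1 K) ^ 2) +
        D.area σ * D.dist K σ * (2 * T ^ 2 * ‖D.gradK v K‖ ^ 2) := by
    intro σ hσ
    rw [D.vol_cone_mul_stab_sq hd hΩ hσ]
    have h2 := D.area_div_dist_mul_inner_sq_le hΩ hT hσ (D.gradK v K)
    have hp : 0 < D.area σ / D.dist K σ := div_pos (D.area_pos hΩ σ) (D.dist_pos K σ hσ)
    set p := D.area σ / D.dist K σ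
    set a := v.2 σ - v.1 K
    set b := ⟪D.gradK v K, D.bary σ - D.center K⟫
    nlinarith [mul_nonneg hp.le (sq_nonneg (a + b))]
  refine (Finset.sum_le_sum h1).trans_eq ?_
  rw [Finset.sum_add_distrib, ← Finset.mul_sum, D.sum_vol_mul_dist hd hΩ, cellSeminormSq]
  ring

/-- Stability of the discrete gradient, one half of its equivalence with the seminorm. Of the
constant, `2 d` comes from `∇_K`, and `4 + 4 T² d²` from the stabilisation, which itself involves
`∇_K`. -/
theorem sum_vol_cone_mul_norm_sq_le (v : D.X) (K : D.Cell) :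
    ∑ σ ∈ D.edgesOf K, volume.real (D.cone K σ) * ‖D.gradKσ v K σ‖ ^ 2 ≤
      (2 * d + 4 + 4 * T ^ 2 * d ^ 2) * D.cellSeminormSq v K := by
  have h1 : ∀ σ ∈ D.edgesOf K, volume.real (D.cone K σ) * ‖D.gradKσ v K σ‖ ^ 2 ≤
      volume.real (D.cone K σ) * (2 * ‖D.gradK v K‖ ^ 2) +
        2 * (volume.real (D.cone K σ) * D.stab v K σ ^ 2) := by
    intro σ hσ
    have : ‖D.gradKσ v K σ‖ ≤ ‖D.gradK v K‖ + |D.stab v K σ| := by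
      refine (norm_add_le _ _).trans_eq ?_
      rw [norm_smul, (D.normal_spec K σ hσ).norm_eq, mul_one, Real.norm_eq_abs]
    have h2 : ‖D.gradKσ v K σ‖ ^ 2 ≤ 2 * ‖D.gradK v K‖ ^ 2 + 2 * D.stab v K σ ^ 2 := by
      have h3 := pow_le_pow_left₀ (norm_nonneg _) this 2
      have h4 := sq_abs (D.stab v K σ)
      nlinarith [sq_nonneg (‖D.gradK v K‖ - |D.stab v K σ|)]
    have h5 : 0 ≤ volume.real (D.cone K σ) := measureReal_nonneg
    nlinarith [mul_le_mul_of_nonneg_left h2 h5]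
  refine (Finset.sum_le_sum h1).trans ?_
  rw [Finset.sum_add_distrib, ← Finset.sum_mul, D.sum_vol_cone hd hΩ, ← Finset.mul_sum]
  have h2 := D.sum_vol_cone_mul_stab_sq_le hd hΩ hT v K
  have h3 := D.vol_mul_norm_gradK_sq_le hd hΩ v K
  have h4 : 0 ≤ 4 * T ^ 2 * d := by positivity
  nlinarith [mul_le_mul_of_nonneg_left h3 h4]

/-- Consistency of the discrete gradient on functions which are nearly linear on `K`. -/
theorem norm_gradKσ_sub_le {v : D.X} {K : D.Cell} {G : Pt d} {M : ℝ} (hM : 0 ≤ M)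
    (h : ∀ σ ∈ D.edgesOf K,
      |v.2 σ - v.1 K - ⟪G, D.bary σ - D.center K⟫| ≤ M * D.diam K ^ 2)
    {τ : D.Edge} (hτ : τ ∈ D.edgesOf K) :
    ‖D.gradKσ v K τ - G‖ ≤ (M * T * d + Real.sqrt d * T * (M + M * T * d)) * D.diam K := by
  have hV := D.vol_pos hΩ K
  have hT0 : 0 ≤ T := zero_le_one.trans hT.one_le
  have hh : 0 ≤ D.diam K := Metric.diam_nonneg
  have hK : ‖D.gradK v K - G‖ ≤ M * T * d * D.diam K := by
    -- Since `gradK` is exact on affine functions, only the defects of `v` from the affine function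
    -- of slope `G` contribute. They are at most `M h_K² ≤ M T d_{K,σ} h_K`, and the weights `|σ|
    -- d_{K,σ}` add up to `d |K|`.
    have e1 : D.gradK v K - G = (D.vol K)⁻¹ • ∑ σ ∈ D.edgesOf K,
        (D.area σ * (v.2 σ - v.1 K - ⟪G, D.bary σ - D.center K⟫)) • D.normal K σ := by
      have e2 := D.sum_area_inner_smul hd hΩ K G
      have e3 : G = (D.vol K)⁻¹ • (D.vol K • G) := by
        rw [smul_smul, inv_mul_cancel₀ hV.ne', one_smul]
      conv_lhs => rw [e3, ← e2, gradK, ← smul_sub, ← Finset.sum_sub_distrib]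
      congr 1
      refine Finset.sum_congr rfl fun σ _ => ?_
      rw [← sub_smul]
      congr 1
      ring
    rw [e1, norm_smul, norm_inv, Real.norm_of_nonneg hV.le, inv_mul_le_iff₀ hV]
    calc _ ≤ ∑ σ ∈ D.edgesOf K, D.area σ * D.dist K σ * (M * T * D.diam K) := by
          refine (norm_sum_le _ _).trans (Finset.sum_le_sum fun σ hσ => ?_)
          have hA := D.area_pos hΩ σ
          rw [norm_smul, (D.normal_spec K σ hσ).norm_eq, mul_one, Real.norm_eq_abs, abs_mul,
            abs_of_pos hA, mul_assoc]
          refine mul_le_mul_of_nonneg_left ((h σ hσ).trans ?_) hA.le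
          have := mul_le_mul_of_nonneg_left (hT.diam_le K σ hσ) (mul_nonneg hM hh)
          nlinarith
      _ = _ := by
          rw [D.sum_vol_mul_dist hd hΩ]
          ring
  have hδ : 0 < D.dist K τ := D.dist_pos K τ hτ
  have hS : |D.stab v K τ| ≤ Real.sqrt d * T * (M + M * T * d) * D.diam K := by
    have e1 : v.2 τ - v.1 K - ⟪D.gradK v K, D.bary τ - D.center K⟫ =
        (v.2 τ - v.1 K - ⟪G, D.bary τ - D.center K⟫) -
          ⟪D.gradK v K - G, D.bary τ - D.center K⟫ := by
      rw [inner_sub_left]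
      ring
    have h1 : |v.2 τ - v.1 K - ⟪D.gradK v K, D.bary τ - D.center K⟫| ≤
        (M + M * T * d) * D.diam K * (T * D.dist K τ) := by
      rw [e1]
      refine (abs_sub _ _).trans ?_
      have h2 := D.abs_inner_bary_le hΩ hτ (D.gradK v K - G)
      have h3 := mul_le_mul_of_nonneg_right hK hh
      have h4 := h τ hτ
      have h5 : (M + M * T * d) * D.diam K * D.diam K ≤
          (M + M * T * d) * D.diam K * (T * D.dist K τ) :=
        mul_le_mul_of_nonneg_left (hT.diam_le K τ hτ) (by positivity)
      nlinarith
    rw [stab, abs_mul, abs_of_nonneg (by positivity : 0 ≤ Real.sqrt d / D.dist K τ)]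
    calc _ ≤ Real.sqrt d / D.dist K τ * ((M + M * T * d) * D.diam K * (T * D.dist K τ)) := by
          gcongr
      _ = _ := by field_simp
  rw [gradKσ, add_sub_right_comm]
  refine (norm_add_le _ _).trans ?_
  rw [norm_smul, (D.normal_spec K τ hτ).norm_eq, mul_one, Real.norm_eq_abs]
  linarith

end Bounds

/-- Consistency of the interpolate `P_{D,B} u`. -/
theorem abs_interpB_sub_le (hΩ : Bornology.IsBounded Ω) {B : Finset D.Edge}
    {β : D.Edge → D.Cell → ℝ} {T : ℝ} (hT : D.IsRegular B β T) (hβ : D.IsBarycentric B β)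
    {R M : ℝ} (hR : Ω ⊆ Metric.closedBall 0 R) {u : Pt d → ℝ} (hu : ContDiff ℝ 2 u)
    (hM : IsTaylorBound u R M) (h0 : ∀ σ ∈ D.extEdges, ∀ y ∈ D.edge σ, u y = 0)
    {K : D.Cell} {σ : D.Edge} (hσ : σ ∈ D.edgesOf K) :
    |(D.interpB B β u).2 σ - (D.interpB B β u).1 K -
      ⟪∇ u (D.center K), D.bary σ - D.center K⟫| ≤ M * (1 + T) * D.diam K ^ 2 := by
  have hcR : ∀ L, ‖D.center L‖ ≤ R := fun L => by
    simpa using hR (D.cell_subset L (D.center_mem L))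
  have hbR := D.norm_bary_le hR σ
  have hh : 0 ≤ D.diam K := Metric.diam_nonneg
  have hM0 := hM.nonneg
  have h1 : |u (D.bary σ) - u (D.center K) - ⟪∇ u (D.center K), D.bary σ - D.center K⟫| ≤
      M * D.diam K ^ 2 := by
    refine (hM.taylor _ _ (hcR K) hbR).trans ?_
    gcongr
    exact D.norm_bary_sub_le hΩ hσ (subset_closure (D.center_mem K))
  have h2 : |(D.interpB B β u).2 σ - u (D.bary σ)| ≤ M * T * D.diam K ^ 2 := by
    by_cases hext : σ ∈ D.extEdges
    · obtain ⟨y, hy⟩ := D.edge_nonempty σ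
      have hyK := D.edge_subset_closure_cell hΩ hσ hy
      -- The interpolate is `0` here, but the barycentre may lie off the edge, so `u` need not
      -- vanish there. Taylor expansion from a point `y` of the edge shows that it is `O(h_K²)`, as
      -- the tangential derivative at `y` vanishes.
      have e1 : ⟪∇ u y, D.bary σ - y⟫ = 0 := D.inner_bary_sub_eq hΩ σ fun z hz =>
        D.inner_gradient_eq_zero hu (h0 σ hext) hy hz
      have h3 := hM.taylor y (D.bary σ)
        (norm_le_of_mem_closure hR (D.closure_cell_subset K hyK)) hbR
      rw [h0 σ hext y hy, e1, sub_zero, sub_zero] at h3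
      simp only [interpB, hext, if_true, zero_sub, abs_neg]
      refine h3.trans ?_
      have h4 := D.norm_bary_sub_le hΩ hσ hyK
      calc M * ‖D.bary σ - y‖ ^ 2 ≤ M * 1 * D.diam K ^ 2 := by rw [mul_one]; gcongr
        _ ≤ M * T * D.diam K ^ 2 := by
          have := hT.one_le
          gcongr
    · by_cases hB : σ ∈ B
      · simp only [interpB, hext, hB, if_false, if_true]
        obtain ⟨hs, hb⟩ := hβ σ hB
        -- The barycentric conditions cancel the first-order terms of the Taylor expansions at the
        -- barycentre; the remainders are controlled by the regularity bound on `β`.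
        have hz : ∑ L, β σ L * ⟪∇ u (D.bary σ), D.center L - D.bary σ⟫ = 0 := by
          have : ∑ L, β σ L • (D.center L - D.bary σ) = 0 := by
            simp_rw [smul_sub]
            rw [Finset.sum_sub_distrib, ← Finset.sum_smul, hs, one_smul, ← hb, sub_self]
          calc _ = ⟪∇ u (D.bary σ), ∑ L, β σ L • (D.center L - D.bary σ)⟫ := by
                rw [inner_sum]
                exact Finset.sum_congr rfl fun L _ => (inner_smul_right _ _ _).symm
            _ = 0 := by rw [this, inner_zero_right]
        have e1 : ∑ L, β σ L * u (D.center L) - u (D.bary σ) = ∑ L, β σ L *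
            (u (D.center L) - u (D.bary σ) - ⟪∇ u (D.bary σ), D.center L - D.bary σ⟫) := by
          simp_rw [mul_sub, Finset.sum_sub_distrib]
          rw [← Finset.sum_mul, hs, one_mul]
          simp only [inner_sub_right, mul_sub, Finset.sum_sub_distrib] at hz ⊢
          linarith
        rw [e1]
        calc _ ≤ ∑ L, |β σ L| * (M * ‖D.center L - D.bary σ‖ ^ 2) := by
              refine (Finset.abs_sum_le_sum_abs _ _).trans (Finset.sum_le_sum fun L _ => ?_)
              rw [abs_mul]
              exact mul_le_mul_of_nonneg_left (hM.taylor _ _ hbR (hcR L)) (abs_nonneg _)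
          _ = M * ∑ L, |β σ L| * ‖D.center L - D.bary σ‖ ^ 2 := by
              rw [Finset.mul_sum]
              exact Finset.sum_congr rfl fun L _ => by ring
          _ ≤ M * (T * D.diam K ^ 2) :=
              mul_le_mul_of_nonneg_left (hT.bary_le K σ hσ hB) hM0
          _ = _ := by ring
      · simp only [interpB, hext, hB, if_false, sub_self, abs_zero]
        have := zero_le_one.trans hT.one_le
        positivity
  have e : (D.interpB B β u).2 σ - (D.interpB B β u).1 K -
      ⟪∇ u (D.center K), D.bary σ - D.center K⟫ =
      ((D.interpB B β u).2 σ - u (D.bary σ)) +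
        (u (D.bary σ) - u (D.center K) - ⟪∇ u (D.center K), D.bary σ - D.center K⟫) := by
    have : (D.interpB B β u).1 K = u (D.center K) := rfl
    rw [this]
    ring
  rw [e]
  refine (abs_add_le _ _).trans ?_
  linarith

end Discretisation

/-! ### SUSHI fluxes: coercivity and consistency -/

namespace Discretisation

variable {d : ℕ} {Ω : Set (Pt d)} (D : Discretisation Ω)

theorem yvec_eq (K : D.Cell) (τ σ : D.Edge) :
    D.yvec K τ σ = (D.area σ / D.vol K) • D.normal K σ + (Real.sqrt d / D.dist K τ *
      ((if τ = σ then 1 else 0) - D.area σ / D.vol K * ⟪D.normal K σ, D.bary τ - D.center K⟫)) •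
        D.normal K τ := by
  by_cases h : τ = σ
  · subst h
    simp [yvec]
  · simp only [yvec, h, if_false]
    rw [sub_eq_add_neg, ← neg_smul]
    congr 2
    ring

/-- The stabilised gradient in terms of the vectors `y^{τσ}`. -/
theorem gradKσ_eq_sum (v : D.X) {K : D.Cell} {τ : D.Edge} (hτ : τ ∈ D.edgesOf K) :
    D.gradKσ v K τ = ∑ σ ∈ D.edgesOf K, (v.2 σ - v.1 K) • D.yvec K τ σ := by
  simp_rw [D.yvec_eq, smul_add, Finset.sum_add_distrib, smul_smul]
  rw [gradKσ, ← Finset.sum_smul]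
  congr 1
  · rw [gradK, Finset.smul_sum]
    refine Finset.sum_congr rfl fun σ _ => ?_
    rw [smul_smul]
    congr 1
    ring
  · congr 1
    have h1 : ∑ σ ∈ D.edgesOf K, (v.2 σ - v.1 K) * (if τ = σ then 1 else 0) = v.2 τ - v.1 K := by
      simp [hτ]
    have h2 : ∑ σ ∈ D.edgesOf K, (v.2 σ - v.1 K) *
        (D.area σ / D.vol K * ⟪D.normal K σ, D.bary τ - D.center K⟫) =
        ⟪D.gradK v K, D.bary τ - D.center K⟫ := by
      rw [gradK, real_inner_smul_left, sum_inner, Finset.mul_sum]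
      refine Finset.sum_congr rfl fun σ _ => ?_
      rw [real_inner_smul_left]
      ring
    rw [stab, ← h2, ← h1, ← Finset.sum_sub_distrib, Finset.mul_sum]
    refine Finset.sum_congr rfl fun σ _ => ?_
    ring

theorem localMatrix_idField (K : D.Cell) (σ σ' : D.Edge) :
    D.localMatrix (idField d) K σ σ' = ∑ τ ∈ D.edgesOf K,
      volume.real (D.cone K τ) * ⟪D.yvec K τ σ, D.yvec K τ σ'⟫ := by
  refine Finset.sum_congr rfl fun τ _ => ?_
  simp only [idField]
  rw [setIntegral_const]
  simp [inner_smul_right]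

theorem sushiFlux_eq (v : D.X) (K : D.Cell) (σ : D.Edge) :
    D.sushiFlux (idField d) K σ v = -∑ τ ∈ D.edgesOf K,
      volume.real (D.cone K τ) * ⟪D.yvec K τ σ, D.gradKσ v K τ⟫ := by
  have h1 : D.sushiFlux (idField d) K σ v = ∑ σ' ∈ D.edgesOf K,
      D.localMatrix (idField d) K σ σ' * (v.1 K - v.2 σ') := by
    simp [sushiFlux]
  rw [h1]
  simp_rw [D.localMatrix_idField, Finset.sum_mul]
  rw [Finset.sum_comm, ← Finset.sum_neg_distrib]
  refine Finset.sum_congr rfl fun τ hτ => ?_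
  rw [D.gradKσ_eq_sum v hτ, inner_sum, Finset.mul_sum, ← Finset.sum_neg_distrib]
  refine Finset.sum_congr rfl fun σ' _ => ?_
  rw [inner_smul_right]
  ring

/-- The SUSHI form is the `L²` inner product of discrete gradients, because the `y^{τσ}` are the
coefficients of `gradKσ`. -/
theorem form_sushiFlux (v w : D.X) :
    D.form (D.sushiFlux (idField d)) v w = ∑ K, ∑ τ ∈ D.edgesOf K,
      volume.real (D.cone K τ) * ⟪D.gradKσ w K τ, D.gradKσ v K τ⟫ := by
  refine Finset.sum_congr rfl fun K _ => ?_
  simp_rw [D.sushiFlux_eq, ← Finset.sum_neg_distrib, Finset.sum_mul]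
  rw [Finset.sum_comm]
  refine Finset.sum_congr rfl fun τ hτ => ?_
  rw [D.gradKσ_eq_sum w hτ, sum_inner, Finset.mul_sum]
  refine Finset.sum_congr rfl fun σ _ => ?_
  rw [real_inner_smul_left]
  ring

variable (hd : 0 < d) (hΩ : Bornology.IsBounded Ω) {B : Finset D.Edge} {β : D.Edge → D.Cell → ℝ}
  {T : ℝ} (hT : D.IsRegular B β T)

include hd hΩ

theorem sqrt_div_dist_mul_vol_cone {K : D.Cell} {σ : D.Edge} (hσ : σ ∈ D.edgesOf K) :
    volume.real (D.cone K σ) * (Real.sqrt d / D.dist K σ) = Real.sqrt d / d * D.area σ := by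
  have hδ : D.dist K σ ≠ 0 := (D.dist_pos K σ hσ).ne'
  rw [D.vol_cone hd hΩ hσ]
  field_simp

/-- The stabilising part of the gradient has zero mean over each cell: the cone volumes turn `√d /
d_{K,σ}` into a multiple of `|σ|`, and what remains is the exactness of `gradK`. -/
theorem sum_vol_cone_stab_smul (v : D.X) (K : D.Cell) :
    ∑ σ ∈ D.edgesOf K, (volume.real (D.cone K σ) * D.stab v K σ) • D.normal K σ = 0 := by
  have hV := D.vol_pos hΩ K
  have h1 : ∀ σ ∈ D.edgesOf K, (volume.real (D.cone K σ) * D.stab v K σ) • D.normal K σ =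
      (Real.sqrt d / d) • ((D.area σ * (v.2 σ - v.1 K)) • D.normal K σ -
        (D.area σ * ⟪D.gradK v K, D.bary σ - D.center K⟫) • D.normal K σ) := by
    intro σ hσ
    rw [← sub_smul, smul_smul, stab, ← mul_assoc, D.sqrt_div_dist_mul_vol_cone hd hΩ hσ]
    congr 1
    ring
  rw [Finset.sum_congr rfl h1, ← Finset.smul_sum, Finset.sum_sub_distrib,
    D.sum_area_inner_smul hd hΩ, gradK, smul_smul, mul_inv_cancel₀ hV.ne', one_smul, sub_self,
    smul_zero]

/-- The consistent part and the stabilisation of the discrete gradient are orthogonal. -/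
theorem sum_vol_cone_mul_norm_sq_eq (v : D.X) (K : D.Cell) :
    ∑ σ ∈ D.edgesOf K, volume.real (D.cone K σ) * ‖D.gradKσ v K σ‖ ^ 2 =
      D.vol K * ‖D.gradK v K‖ ^ 2 +
        ∑ σ ∈ D.edgesOf K, volume.real (D.cone K σ) * D.stab v K σ ^ 2 := by
  have h0 : ∑ σ ∈ D.edgesOf K,
      ⟪D.gradK v K, (volume.real (D.cone K σ) * D.stab v K σ) • D.normal K σ⟫ = 0 := by
    rw [← inner_sum, D.sum_vol_cone_stab_smul hd hΩ, inner_zero_right]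
  have h1 : ∀ σ ∈ D.edgesOf K, volume.real (D.cone K σ) * ‖D.gradKσ v K σ‖ ^ 2 =
      volume.real (D.cone K σ) * ‖D.gradK v K‖ ^ 2 +
        volume.real (D.cone K σ) * D.stab v K σ ^ 2 +
          2 * ⟪D.gradK v K, (volume.real (D.cone K σ) * D.stab v K σ) • D.normal K σ⟫ := by
    intro σ hσ
    rw [gradKσ, norm_add_sq_real, norm_smul, (D.normal_spec K σ hσ).norm_eq, mul_one,
      Real.norm_eq_abs, sq_abs, inner_smul_right, inner_smul_right]
    ring
  rw [Finset.sum_congr rfl h1, Finset.sum_add_distrib, Finset.sum_add_distrib, ← Finset.mul_sum,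
    h0, mul_zero, add_zero, ← Finset.sum_mul, D.sum_vol_cone hd hΩ]

include hT

/-- The reverse of the stability bound. Orthogonality lets the norm of the discrete gradient control
`∇_K` and the stabilisation separately, and `v_σ - v_K` is recovered from the two by `a² ≤ 2 (a -
b)² + 2 b²`. -/
theorem cellSeminormSq_le (v : D.X) (K : D.Cell) :
    D.cellSeminormSq v K ≤ (2 + 2 * T ^ 2 * d) *
      ∑ σ ∈ D.edgesOf K, volume.real (D.cone K σ) * ‖D.gradKσ v K σ‖ ^ 2 := by
  rw [D.sum_vol_cone_mul_norm_sq_eq hd hΩ]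
  have h1 : ∀ σ ∈ D.edgesOf K, D.area σ / D.dist K σ * (v.2 σ - v.1 K) ^ 2 ≤
      2 * (volume.real (D.cone K σ) * D.stab v K σ ^ 2) +
        D.area σ * D.dist K σ * (2 * T ^ 2 * ‖D.gradK v K‖ ^ 2) := by
    intro σ hσ
    rw [D.vol_cone_mul_stab_sq hd hΩ hσ]
    have h2 := D.area_div_dist_mul_inner_sq_le hΩ hT hσ (D.gradK v K)
    have hp : 0 < D.area σ / D.dist K σ := div_pos (D.area_pos hΩ σ) (D.dist_pos K σ hσ)
    set p := D.area σ / D.dist K σ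
    set a := v.2 σ - v.1 K
    set b := ⟪D.gradK v K, D.bary σ - D.center K⟫
    nlinarith [mul_nonneg hp.le (sq_nonneg (a - 2 * b))]
  have h2 := Finset.sum_le_sum h1
  rw [Finset.sum_add_distrib, ← Finset.mul_sum, D.sum_vol_mul_dist hd hΩ] at h2
  have hS : 0 ≤ ∑ σ ∈ D.edgesOf K, volume.real (D.cone K σ) * D.stab v K σ ^ 2 :=
    Finset.sum_nonneg fun σ _ => mul_nonneg measureReal_nonneg (sq_nonneg _)
  have hG : 0 ≤ D.vol K * ‖D.gradK v K‖ ^ 2 := mul_nonneg (D.vol_pos hΩ K).le (sq_nonneg _)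
  have hTd : 0 ≤ 2 * T ^ 2 * d := by positivity
  rw [cellSeminormSq]
  nlinarith [mul_nonneg hTd hS]

theorem isCoercive_sushiFlux :
    D.IsCoercive (D.sushiFlux (idField d)) (1 / (2 + 2 * T ^ 2 * d)) := by
  intro v
  have hp : 0 < 2 + 2 * T ^ 2 * (d : ℝ) := by positivity
  rw [one_div, inv_mul_le_iff₀ hp, D.form_sushiFlux, seminormSq, Finset.mul_sum]
  refine Finset.sum_le_sum fun K _ => ?_
  simp_rw [real_inner_self_eq_norm_sq]
  exact D.cellSeminormSq_le hd hΩ hT v K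

omit hT in
-- This makes the fluxes exact when the discrete gradient is constant on the cell. The two
-- stabilising contributions cancel: the diagonal one gives `(√d / d) |σ| n_{K,σ}`, and the
-- geometric identity gives its opposite.
theorem sum_vol_cone_smul_yvec {K : D.Cell} {σ : D.Edge} (hσ : σ ∈ D.edgesOf K) :
    ∑ τ ∈ D.edgesOf K, volume.real (D.cone K τ) • D.yvec K τ σ =
      D.area σ • D.normal K σ := by
  have hV := D.vol_pos hΩ K
  have h1 : ∀ τ ∈ D.edgesOf K, volume.real (D.cone K τ) • D.yvec K τ σ =
      (volume.real (D.cone K τ) * (D.area σ / D.vol K)) • D.normal K σ +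
        (Real.sqrt d / d) • ((if τ = σ then D.area τ else 0) • D.normal K τ -
          (D.area σ / D.vol K) •
            ((D.area τ * ⟪D.normal K σ, D.bary τ - D.center K⟫) • D.normal K τ)) := by
    intro τ hτ
    rw [D.yvec_eq, smul_add, smul_smul, smul_smul, ← mul_assoc,
      D.sqrt_div_dist_mul_vol_cone hd hΩ hτ, smul_smul, ← sub_smul, smul_smul]
    congr 2
    split_ifs <;> ring
  rw [Finset.sum_congr rfl h1, Finset.sum_add_distrib, ← Finset.sum_smul, ← Finset.sum_mul,
    D.sum_vol_cone hd hΩ, ← Finset.smul_sum, Finset.sum_sub_distrib, ← Finset.smul_sum,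
    D.sum_area_inner_smul hd hΩ, smul_smul, div_mul_cancel₀ _ hV.ne', mul_div_cancel₀ _ hV.ne']
  simp [hσ]

/-- Bounds the effect on a flux of a perturbation of the discrete gradient. Off the diagonal,
`y^{τσ}` has size `|σ| / |K|` and the cone volumes add up to `|K|`; the extra diagonal term has
weight `√d / d`. -/
theorem sum_vol_cone_mul_norm_yvec_le {K : D.Cell} {σ : D.Edge} (hσ : σ ∈ D.edgesOf K) :
    ∑ τ ∈ D.edgesOf K, volume.real (D.cone K τ) * ‖D.yvec K τ σ‖ ≤
      (1 + Real.sqrt d * T + Real.sqrt d / d) * D.area σ := by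
  have hV := D.vol_pos hΩ K
  have hA := D.area_pos hΩ σ
  have hT0 : 0 ≤ T := zero_le_one.trans hT.one_le
  have h1 : ∀ τ ∈ D.edgesOf K, volume.real (D.cone K τ) * ‖D.yvec K τ σ‖ ≤
      volume.real (D.cone K τ) * (D.area σ / D.vol K * (1 + Real.sqrt d * T)) +
        (if τ = σ then Real.sqrt d / d * D.area τ else 0) := by
    intro τ hτ
    have hδ : 0 < D.dist K τ := D.dist_pos K τ hτ
    have hc : 0 ≤ volume.real (D.cone K τ) := measureReal_nonneg
    have hi : |⟪D.normal K σ, D.bary τ - D.center K⟫| ≤ T * D.dist K τ := by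
      refine (D.abs_inner_bary_le hΩ hτ _).trans ?_
      rw [(D.normal_spec K σ hσ).norm_eq, one_mul]
      exact hT.diam_le K τ hτ
    have h2 : ‖D.yvec K τ σ‖ ≤ D.area σ / D.vol K * (1 + Real.sqrt d * T) +
        Real.sqrt d / D.dist K τ * (if τ = σ then 1 else 0) := by
      rw [D.yvec_eq]
      refine (norm_add_le _ _).trans ?_
      rw [norm_smul, norm_smul, (D.normal_spec K σ hσ).norm_eq, (D.normal_spec K τ hτ).norm_eq,
        mul_one, mul_one, Real.norm_of_nonneg (by positivity), Real.norm_eq_abs, abs_mul,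
        abs_of_nonneg (by positivity : 0 ≤ Real.sqrt d / D.dist K τ)]
      have h3 : |(if τ = σ then (1 : ℝ) else 0) -
          D.area σ / D.vol K * ⟪D.normal K σ, D.bary τ - D.center K⟫| ≤
          (if τ = σ then 1 else 0) + D.area σ / D.vol K * (T * D.dist K τ) := by
        refine (abs_sub _ _).trans (add_le_add ?_ ?_)
        · split_ifs <;> simp
        · rw [abs_mul, abs_of_nonneg (by positivity : 0 ≤ D.area σ / D.vol K)]
          gcongr
      calc _ ≤ D.area σ / D.vol K + Real.sqrt d / D.dist K τ *
            ((if τ = σ then 1 else 0) + D.area σ / D.vol K * (T * D.dist K τ)) := by gcongr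
        _ = _ := by
          field_simp
          ring
    refine (mul_le_mul_of_nonneg_left h2 hc).trans_eq ?_
    rw [mul_add, ← mul_assoc (volume.real _) (Real.sqrt d / _),
      D.sqrt_div_dist_mul_vol_cone hd hΩ hτ]
    congr 1
    split_ifs <;> simp
  refine (Finset.sum_le_sum h1).trans_eq ?_
  rw [Finset.sum_add_distrib, ← Finset.sum_mul, D.sum_vol_cone hd hΩ, Finset.sum_ite_eq' _ _ _,
    if_pos hσ]
  field_simp

/-- Consistency of the SUSHI fluxes. -/
theorem abs_sushiFlux_add_le {R M C : ℝ} (hR : Ω ⊆ Metric.closedBall 0 R) {u : Pt d → ℝ}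
    (hu : ContDiff ℝ 2 u) (hM : IsTaylorBound u R M) {v : D.X} {K : D.Cell}
    (hv : ∀ τ ∈ D.edgesOf K, ‖D.gradKσ v K τ - ∇ u (D.center K)‖ ≤ C * D.diam K)
    {σ : D.Edge} (hσ : σ ∈ D.edgesOf K) :
    |D.sushiFlux (idField d) K σ v + ∫ x in D.edge σ, ⟪∇ u x, D.normal K σ⟫ ∂(surf d)| ≤
      (C * (1 + Real.sqrt d * T + Real.sqrt d / d) + M) * D.diam K * D.area σ := by
  have hA := D.area_pos hΩ σ
  have hh : 0 ≤ D.diam K := Metric.diam_nonneg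
  set G := ∇ u (D.center K) with hG
  have hgc : Continuous (∇ u) := (contDiff_gradient (m := 0) hu (by norm_num)).continuous
  have hn := (D.normal_spec K σ hσ).norm_eq
  have hC : 0 ≤ C * D.diam K := (norm_nonneg _).trans (hv σ hσ)
  have h1 : ∑ τ ∈ D.edgesOf K, volume.real (D.cone K τ) * ⟪D.yvec K τ σ, G⟫ =
      D.area σ * ⟪D.normal K σ, G⟫ := by
    rw [← real_inner_smul_left, ← D.sum_vol_cone_smul_yvec hd hΩ hσ, sum_inner]
    exact Finset.sum_congr rfl fun τ _ => (real_inner_smul_left _ _ _).symm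
  have h2 : ∫ x in D.edge σ, ⟪∇ u x, D.normal K σ⟫ ∂(surf d) - D.area σ * ⟪D.normal K σ, G⟫ =
      ∫ x in D.edge σ, ⟪∇ u x - G, D.normal K σ⟫ ∂(surf d) := by
    simp_rw [inner_sub_left]
    rw [integral_sub (D.integrableOn_edge hΩ σ (by fun_prop))
      (D.integrableOn_edge hΩ σ (by fun_prop)), setIntegral_const, smul_eq_mul,
      real_inner_comm G]
    rfl
  have h3 : |∫ x in D.edge σ, ⟪∇ u x - G, D.normal K σ⟫ ∂(surf d)| ≤
      M * D.diam K * D.area σ := by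
    rw [← Real.norm_eq_abs]
    refine norm_setIntegral_le_of_norm_le_const (D.surf_edge_lt_top hΩ σ) fun y hy => ?_
    refine (norm_inner_le_norm _ _).trans ?_
    rw [hn, mul_one]
    have hyK := D.edge_subset_closure_cell hΩ hσ hy
    refine (hM.grad _ _ ?_ ?_).trans ?_
    · simpa using hR (D.cell_subset K (D.center_mem K))
    · exact norm_le_of_mem_closure hR (D.closure_cell_subset K hyK)
    · exact mul_le_mul_of_nonneg_left
        (D.norm_sub_le_diam hΩ hyK (subset_closure (D.center_mem K))) hM.nonneg
  have h4 : |∑ τ ∈ D.edgesOf K, volume.real (D.cone K τ) *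
      ⟪D.yvec K τ σ, D.gradKσ v K τ - G⟫| ≤
      C * D.diam K * ((1 + Real.sqrt d * T + Real.sqrt d / d) * D.area σ) := by
    refine (Finset.abs_sum_le_sum_abs _ _).trans ?_
    refine le_trans (Finset.sum_le_sum fun τ hτ => ?_)
      (((Finset.mul_sum _ _ _).symm.le).trans
        (mul_le_mul_of_nonneg_left (D.sum_vol_cone_mul_norm_yvec_le hd hΩ hT hσ) hC))
    rw [abs_mul, abs_of_nonneg measureReal_nonneg]
    have h5 : |⟪D.yvec K τ σ, D.gradKσ v K τ - G⟫| ≤ ‖D.yvec K τ σ‖ * (C * D.diam K) :=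
      (abs_real_inner_le_norm _ _).trans
        (mul_le_mul_of_nonneg_left (hv τ hτ) (norm_nonneg _))
    calc _ ≤ volume.real (D.cone K τ) * (‖D.yvec K τ σ‖ * (C * D.diam K)) :=
          mul_le_mul_of_nonneg_left h5 measureReal_nonneg
      _ = _ := by ring
  -- The exact flux of the constant gradient `G` is subtracted from both fluxes; what is left is the
  -- error of the discrete gradient and the oscillation of `∇ u` on the edge.
  have e : D.sushiFlux (idField d) K σ v + ∫ x in D.edge σ, ⟪∇ u x, D.normal K σ⟫ ∂(surf d) =
      -(∑ τ ∈ D.edgesOf K, volume.real (D.cone K τ) * ⟪D.yvec K τ σ, D.gradKσ v K τ - G⟫) +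
        ∫ x in D.edge σ, ⟪∇ u x - G, D.normal K σ⟫ ∂(surf d) := by
    rw [← h2, ← h1, D.sushiFlux_eq]
    simp_rw [inner_sub_right, mul_sub]
    rw [Finset.sum_sub_distrib]
    ring
  rw [e]
  refine (abs_add_le _ _).trans ?_
  rw [abs_neg]
  calc _ ≤ _ := add_le_add h4 h3
    _ = _ := by ring

omit hd hT in
theorem sum_vol_le : ∑ K, D.vol K ≤ volume.real Ω := by
  have h1 : ∑ K, D.vol K = volume.real (⋃ K, D.cell K) := by
    rw [measureReal_iUnion_fintype D.cell_disjoint (fun K => (D.cell_open K).measurableSet)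
      (fun K => (hΩ.subset (D.cell_subset K)).measure_lt_top.ne)]
    rfl
  rw [h1]
  exact measureReal_mono (Set.iUnion_subset D.cell_subset) hΩ.measure_lt_top.ne

omit hT in
-- A residual of size `C h |σ|` contributes `(d_{K,σ} / |σ|) (C h |σ|)² = |σ| d_{K,σ} (C h)²`, and
-- the weights `|σ| d_{K,σ}` add up to at most `d |Ω|`.
theorem consErr_le {F : D.Fluxes} {u : Pt d → ℝ} {C : ℝ} (hC : 0 ≤ C)
    (h : ∀ K, ∀ σ ∈ D.edgesOf K, |F K σ (D.interpB B β u) +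
      ∫ x in D.edge σ, ⟪∇ u x, D.normal K σ⟫ ∂(surf d)| ≤ C * D.diam K * D.area σ) :
    D.consErr B β F u ≤ C * Real.sqrt (d * volume.real Ω) * D.size := by
  have hs0 : 0 ≤ D.size := Real.iSup_nonneg fun K => Metric.diam_nonneg
  have h1 : ∑ K, ∑ σ ∈ D.edgesOf K, D.dist K σ / D.area σ *
      (F K σ (D.interpB B β u) + ∫ x in D.edge σ, ⟪∇ u x, D.normal K σ⟫ ∂(surf d)) ^ 2 ≤
      (C * D.size) ^ 2 * (d * volume.real Ω) := by
    calc _ ≤ ∑ K, ∑ σ ∈ D.edgesOf K, D.area σ * D.dist K σ * (C * D.size) ^ 2 := by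
          refine Finset.sum_le_sum fun K _ => Finset.sum_le_sum fun σ hσ => ?_
          have hA := D.area_pos hΩ σ
          have hδ : 0 < D.dist K σ := D.dist_pos K σ hσ
          have hh : 0 ≤ D.diam K := Metric.diam_nonneg
          have h2 : |F K σ (D.interpB B β u) +
              ∫ x in D.edge σ, ⟪∇ u x, D.normal K σ⟫ ∂(surf d)| ≤ C * D.size * D.area σ :=
            (h K σ hσ).trans (by gcongr; exact D.diam_le_size K)
          rw [← sq_abs]
          calc _ ≤ D.dist K σ / D.area σ * (C * D.size * D.area σ) ^ 2 := by gcongr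
            _ = _ := by field_simp
      _ = (C * D.size) ^ 2 * (d * ∑ K, D.vol K) := by
          simp_rw [D.sum_vol_mul_dist hd hΩ]
          rw [← Finset.sum_mul, ← Finset.mul_sum]
          ring
      _ ≤ _ := by
          gcongr
          exact D.sum_vol_le hΩ
  calc _ ≤ Real.sqrt ((C * D.size) ^ 2 * (d * volume.real Ω)) := Real.sqrt_le_sqrt h1
    _ = _ := by
      rw [Real.sqrt_mul (sq_nonneg _), Real.sqrt_sq (by positivity)]
      ring

end Discretisation

/-! ### `L²` norms of piecewise constant functions -/

theorem sum_indicator_eq_of_mem {α V ι : Type*} [AddCommMonoid V] {s : Finset ι} {A : ι → Set α}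
    (hdis : ∀ i ∈ s, ∀ j ∈ s, i ≠ j → Disjoint (A i) (A j)) (a : ι → V) {i : ι} (hi : i ∈ s)
    {x : α} (hx : x ∈ A i) : ∑ j ∈ s, (A j).indicator (fun _ => a j) x = a i := by
  rw [Finset.sum_eq_single i, Set.indicator_of_mem hx]
  · intro j hj hji
    exact Set.indicator_of_notMem (Set.disjoint_left.1 (hdis i hi j hj hji.symm) hx) _
  · exact fun hcon => absurd hi hcon

/-- At most one indicator is nonzero at each point, so the squared norm of the sum is the sum of the
squared norms. The inequality comes from enlarging the domain of integration from `Ω` to the whole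
space. -/
theorem normL2_sum_indicator_le {d : ℕ} {V ι : Type*} [NormedAddCommGroup V] (Ω : Set (Pt d))
    {s : Finset ι} {A : ι → Set (Pt d)} (hA : ∀ i ∈ s, MeasurableSet (A i))
    (hfin : ∀ i ∈ s, volume (A i) ≠ ⊤)
    (hdis : ∀ i ∈ s, ∀ j ∈ s, i ≠ j → Disjoint (A i) (A j)) (a : ι → V) :
    normL2 Ω (fun x => ∑ i ∈ s, (A i).indicator (fun _ => a i) x) ≤
      ENNReal.ofReal (Real.sqrt (∑ i ∈ s, volume.real (A i) * ‖a i‖ ^ 2)) := by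
  have hsum : 0 ≤ ∑ i ∈ s, volume.real (A i) * ‖a i‖ ^ 2 :=
    Finset.sum_nonneg fun i _ => mul_nonneg measureReal_nonneg (sq_nonneg _)
  rw [normL2, eLpNorm_eq_lintegral_rpow_enorm_toReal two_ne_zero ENNReal.ofNat_ne_top,
    Real.sqrt_eq_rpow, ← ENNReal.ofReal_rpow_of_nonneg hsum (by norm_num)]
  simp only [ENNReal.toReal_ofNat]
  refine ENNReal.rpow_le_rpow ?_ (by norm_num)
  have hpt : ∀ x, ‖∑ i ∈ s, (A i).indicator (fun _ => a i) x‖ₑ ^ (2 : ℝ) ≤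
      ∑ i ∈ s, (A i).indicator (fun _ => ENNReal.ofReal (‖a i‖ ^ 2)) x := by
    intro x
    by_cases hx : ∃ i ∈ s, x ∈ A i
    · obtain ⟨i, hi, hxi⟩ := hx
      rw [sum_indicator_eq_of_mem hdis _ hi hxi, sum_indicator_eq_of_mem hdis _ hi hxi,
        ← ofReal_norm, ENNReal.ofReal_rpow_of_nonneg (norm_nonneg _) (by norm_num)]
      simp
    · push Not at hx
      rw [Finset.sum_eq_zero fun i hi => Set.indicator_of_notMem (hx i hi) _]
      simp
  calc _ ≤ ∫⁻ x, ‖∑ i ∈ s, (A i).indicator (fun _ => a i) x‖ₑ ^ (2 : ℝ) :=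
        lintegral_mono' Measure.restrict_le_self le_rfl
    _ ≤ ∫⁻ x, ∑ i ∈ s, (A i).indicator (fun _ => ENNReal.ofReal (‖a i‖ ^ 2)) x :=
        lintegral_mono hpt
    _ = ∑ i ∈ s, ENNReal.ofReal (volume.real (A i) * ‖a i‖ ^ 2) := by
        rw [lintegral_finsetSum' _ fun i hi =>
          (measurable_const.indicator (hA i hi)).aemeasurable]
        refine Finset.sum_congr rfl fun i hi => ?_
        rw [lintegral_indicator (hA i hi), setLIntegral_const,
          ENNReal.ofReal_mul measureReal_nonneg, measureReal_def,
          ENNReal.ofReal_toReal (hfin i hi), mul_comm]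
    _ = _ := (ENNReal.ofReal_sum_of_nonneg fun i _ =>
        mul_nonneg measureReal_nonneg (sq_nonneg _)).symm

namespace Discretisation

variable {d : ℕ} {Ω : Set (Pt d)} (D : Discretisation Ω)

theorem normL2_piM_le (hΩ : Bornology.IsBounded Ω) (v : D.X) :
    normL2 Ω (D.piM v) ≤ ENNReal.ofReal (Real.sqrt (D.cellNormSq v)) := by
  have := normL2_sum_indicator_le Ω (s := Finset.univ) (A := D.cell)
    (fun K _ => (D.cell_open K).measurableSet)
    (fun K _ => (hΩ.subset (D.cell_subset K)).measure_lt_top.ne)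
    (fun K _ L _ hKL => D.cell_disjoint hKL) v.1
  have e : D.piM v = fun x => ∑ K, (D.cell K).indicator (fun _ => v.1 K) x := rfl
  rw [e]
  simpa only [cellNormSq, vol, Real.norm_eq_abs, sq_abs] using this

theorem piM_sub_projM (B : Finset D.Edge) (β : D.Edge → D.Cell → ℝ) (u : Pt d → ℝ) (v : D.X) :
    D.piM v - D.projM u = D.piM (v - D.interpB B β u) := by
  ext1 x
  simp only [piM, projM, Pi.sub_apply, ← Finset.sum_sub_distrib]
  refine Finset.sum_congr rfl fun K _ => ?_
  by_cases hx : x ∈ D.cell K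
  · simp only [Set.indicator_of_mem hx]
    rfl
  · simp only [Set.indicator_of_notMem hx, sub_zero]

/-- The pairs `(K, σ)` with `σ ∈ E_K`. -/
def pairs : Finset (Σ _ : D.Cell, D.Edge) := Finset.univ.sigma fun K => D.edgesOf K

theorem mem_pairs {p : Σ _ : D.Cell, D.Edge} : p ∈ D.pairs ↔ p.2 ∈ D.edgesOf p.1 := by
  simp [pairs]

theorem gradD_eq (v : D.X) : D.gradD v = fun x =>
    ∑ p ∈ D.pairs, (D.cone p.1 p.2).indicator (fun _ => D.gradKσ v p.1 p.2) x := by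
  ext1 x
  rw [gradD, Finset.sum_sigma', pairs]

theorem cone_disjoint (hΩ : Bornology.IsBounded Ω) : ∀ p ∈ D.pairs, ∀ q ∈ D.pairs, p ≠ q →
    Disjoint (D.cone p.1 p.2) (D.cone q.1 q.2) := by
  rintro ⟨K, σ⟩ hp ⟨L, τ⟩ hq hne
  rw [mem_pairs] at hp hq
  by_cases hKL : K = L
  · subst hKL
    exact (D.isStarCell hΩ K).cone_disjoint hp hq fun h => hne (congrArg (Sigma.mk K) h)
  · exact (D.cell_disjoint hKL).mono ((D.isStarCell hΩ K).cone_subset hp)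
      ((D.isStarCell hΩ L).cone_subset hq)

theorem measurableSet_cone (hΩ : Bornology.IsBounded Ω) : ∀ p ∈ D.pairs,
    MeasurableSet (D.cone p.1 p.2) := fun p hp =>
  ((D.isStarCell hΩ p.1).isOpen_cone (D.mem_pairs.1 hp)).measurableSet

theorem aestronglyMeasurable_gradD (hΩ : Bornology.IsBounded Ω) (v : D.X) :
    AEStronglyMeasurable (D.gradD v) (volume.restrict Ω) := by
  rw [gradD_eq]
  exact Finset.aestronglyMeasurable_fun_sum _ fun p hp =>
    aestronglyMeasurable_const.indicator (D.measurableSet_cone hΩ p hp)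

section Estimates

variable (hd : 0 < d) (hΩ : Bornology.IsBounded Ω) {B : Finset D.Edge} {β : D.Edge → D.Cell → ℝ}
  {T : ℝ} (hT : D.IsRegular B β T)

include hd hΩ hT

theorem normL2_gradD_le (v : D.X) : normL2 Ω (D.gradD v) ≤ ENNReal.ofReal (Real.sqrt
    ((2 * d + 4 + 4 * T ^ 2 * d ^ 2) * D.seminormSq v)) := by
  rw [gradD_eq]
  refine (normL2_sum_indicator_le Ω (D.measurableSet_cone hΩ) (fun p hp => ?_)
    (D.cone_disjoint hΩ) fun p => D.gradKσ v p.1 p.2).trans ?_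
  · have hsub : D.cone p.1 p.2 ⊆ D.cell p.1 :=
      (D.isStarCell hΩ p.1).cone_subset (D.mem_pairs.1 hp)
    exact (hΩ.subset (hsub.trans (D.cell_subset p.1))).measure_lt_top.ne
  · refine ENNReal.ofReal_le_ofReal (Real.sqrt_le_sqrt ?_)
    rw [pairs, Finset.sum_sigma, seminormSq, Finset.mul_sum]
    exact Finset.sum_le_sum fun K _ => D.sum_vol_cone_mul_norm_sq_le hd hΩ hT v K

/-- The constant in the consistency estimate of the discrete gradient. -/
def consistencyConst (d : ℕ) (T M : ℝ) : ℝ :=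
  M * (1 + T) * T * d + Real.sqrt d * T * (M * (1 + T) + M * (1 + T) * T * d)

omit hd hΩ hT in
theorem consistencyConst_nonneg {T M : ℝ} (hT : 1 ≤ T) (hM : 0 ≤ M) :
    0 ≤ consistencyConst d T M := by
  have : 0 ≤ T := zero_le_one.trans hT
  rw [consistencyConst]
  positivity

theorem norm_gradKσ_interpB_sub_le (hβ : D.IsBarycentric B β)
    {R M : ℝ} (hR : Ω ⊆ Metric.closedBall 0 R) {u : Pt d → ℝ} (hu : ContDiff ℝ 2 u)
    (hM : IsTaylorBound u R M) (h0 : ∀ σ ∈ D.extEdges, ∀ y ∈ D.edge σ, u y = 0)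
    {K : D.Cell} {σ : D.Edge} (hσ : σ ∈ D.edgesOf K) :
    ‖D.gradKσ (D.interpB B β u) K σ - ∇ u (D.center K)‖ ≤ consistencyConst d T M * D.diam K := by
  have hT0 : 0 ≤ T := zero_le_one.trans hT.one_le
  have hM0 := hM.nonneg
  exact D.norm_gradKσ_sub_le hd hΩ hT (by positivity : 0 ≤ M * (1 + T))
    (fun τ hτ => D.abs_interpB_sub_le hΩ hT hβ hR hu hM h0 hτ) hσ

/-- Almost every point of `Ω` lies in some cone. There `∇_D P u` is compared with `∇ u` at the
centre of the cell, and the latter with `∇ u` at the point, each up to `O(h_K)`. -/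
theorem normL2_gradD_interpB_sub_le (hβ : D.IsBarycentric B β)
    {R M : ℝ} (hR : Ω ⊆ Metric.closedBall 0 R) {u : Pt d → ℝ} (hu : ContDiff ℝ 2 u)
    (hM : IsTaylorBound u R M) (h0 : ∀ σ ∈ D.extEdges, ∀ y ∈ D.edge σ, u y = 0)
    (hΩm : MeasurableSet Ω) :
    normL2 Ω (D.gradD (D.interpB B β u) - ∇ u) ≤ ENNReal.ofReal
      ((consistencyConst d T M + M) * Real.sqrt (volume.real Ω) * D.size) := by
  have hs0 : 0 ≤ D.size := Real.iSup_nonneg fun K => Metric.diam_nonneg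
  have hC := consistencyConst_nonneg (d := d) hT.one_le hM.nonneg
  have hM0 := hM.nonneg
  have hae : ∀ᵐ x ∂(volume.restrict Ω), ‖(D.gradD (D.interpB B β u) - ∇ u) x‖ ≤
      (consistencyConst d T M + M) * D.size := by
    rw [ae_restrict_iff' hΩm]
    filter_upwards [D.ae_mem_cone hd hΩ] with x hx hxΩ
    obtain ⟨K, σ, hσ, hxc⟩ := hx hxΩ
    have e1 : D.gradD (D.interpB B β u) x = D.gradKσ (D.interpB B β u) K σ := by
      rw [gradD_eq]
      exact sum_indicator_eq_of_mem (D.cone_disjoint hΩ)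
        (fun p : (Σ _ : D.Cell, D.Edge) => D.gradKσ (D.interpB B β u) p.1 p.2)
        (i := ⟨K, σ⟩) (D.mem_pairs.2 hσ) hxc
    have hxK : x ∈ D.cell K := (D.isStarCell hΩ K).cone_subset hσ hxc
    rw [Pi.sub_apply, e1]
    have h1 := D.norm_gradKσ_interpB_sub_le hd hΩ hT hβ hR hu hM h0 hσ
    have h2 : ‖∇ u (D.center K) - ∇ u x‖ ≤ M * D.diam K := by
      refine (hM.grad _ _ (by simpa using hR hxΩ)
        (by simpa using hR (D.cell_subset K (D.center_mem K)))).trans ?_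
      exact mul_le_mul_of_nonneg_left (D.norm_sub_le_diam hΩ
        (subset_closure (D.center_mem K)) (subset_closure hxK)) hM0
    calc _ ≤ _ := norm_sub_le_norm_sub_add_norm_sub _ (∇ u (D.center K)) _
      _ ≤ (consistencyConst d T M + M) * D.diam K := by linarith
      _ ≤ _ := mul_le_mul_of_nonneg_left (D.diam_le_size K) (by positivity)
  refine (eLpNorm_le_of_ae_bound hae).trans_eq ?_
  have hv : volume Ω ≠ ⊤ := hΩ.measure_lt_top.ne
  rw [Measure.restrict_apply_univ, ENNReal.toReal_ofNat, ← ENNReal.ofReal_toReal hv,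
    ENNReal.ofReal_rpow_of_nonneg ENNReal.toReal_nonneg (by norm_num),
    ← ENNReal.ofReal_mul (by positivity), Real.sqrt_eq_rpow, measureReal_def]
  congr 1
  norm_num
  ring

end Estimates

/-! ### Error estimates and assembly of the constants -/

section Main

variable (hd : 0 < d) (hΩo : IsOpen Ω) (hΩ : Bornology.IsBounded Ω) {B : Finset D.Edge}
  {β : D.Edge → D.Cell → ℝ} {α : ℝ} (hα : 0 < α) (hB : B ⊆ D.intEdges) {F : D.Fluxes}
  (hF : D.IsCoercive F α) {u f : Pt d → ℝ} (hu : ContDiff ℝ 2 u)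
  (hf : MemLp f 2 (volume.restrict Ω)) (hw : IsWeakSolution Ω (idField d) f u) {uD : D.X}
  (huD : D.IsSchemeSolution B β F f uD)

include hd hΩo hΩ hα hB hF hu hf hw huD

/-- `C` stands for the Poincaré constant in one application and for the stability constant of the
discrete gradient in the other. -/
theorem sqrt_mul_seminormSq_le {C : ℝ} (hC : 0 ≤ C) :
    Real.sqrt (C * D.seminormSq (uD - D.interpB B β u)) ≤
      Real.sqrt C / α * D.consErr B β F u := by
  have hE : 0 ≤ D.consErr B β F u := Real.sqrt_nonneg _
  have hgc : Continuous (∇ u) := (contDiff_gradient (m := 0) hu (by norm_num)).continuous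
  have h := D.sq_mul_seminormSq_sub_le hΩ hα hB hF hgc
    (D.integral_cell_eq hd hΩo hΩ hu hf hw) huD
  have hs := D.seminormSq_nonneg hΩ (uD - D.interpB B β u)
  rw [Real.sqrt_mul hC, div_mul_eq_mul_div, mul_div_assoc]
  refine mul_le_mul_of_nonneg_left ?_ (Real.sqrt_nonneg _)
  rw [Real.sqrt_le_left (by positivity), div_pow, le_div_iff₀ (by positivity), mul_comm]
  exact h

theorem normL2_piM_sub_projM_le {R : ℝ} (hR0 : 0 ≤ R) (hR : Ω ⊆ Metric.closedBall 0 R) :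
    normL2 Ω (D.piM uD - D.projM u) ≤ ENNReal.ofReal
      (Real.sqrt ((4 * d + 4) * R ^ 2) / α * D.consErr B β F u) := by
  rw [D.piM_sub_projM B β]
  refine (D.normL2_piM_le hΩ _).trans (ENNReal.ofReal_le_ofReal ?_)
  have hwB : D.MemXB B β (uD - D.interpB B β u) :=
    (D.submoduleXB B β).sub_mem huD.1 (D.memXB_interpB hB u)
  exact (Real.sqrt_le_sqrt (D.cellNormSq_le hd hR0 hR hwB.1)).trans
    (D.sqrt_mul_seminormSq_le hd hΩo hΩ hα hB hF hu hf hw huD (by positivity))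

theorem normL2_gradD_sub_gradient_le {T : ℝ} (hT : D.IsRegular B β T) (hβ : D.IsBarycentric B β)
    {R M : ℝ} (hR : Ω ⊆ Metric.closedBall 0 R) (hM : IsTaylorBound u R M) :
    normL2 Ω (D.gradD uD - ∇ u) ≤ ENNReal.ofReal
      ((Real.sqrt (2 * d + 4 + 4 * T ^ 2 * d ^ 2) / α +
        (consistencyConst d T M + M) * Real.sqrt (volume.real Ω)) *
          (D.consErr B β F u + D.size)) := by
  have hs0 : 0 ≤ D.size := Real.iSup_nonneg fun K => Metric.diam_nonneg
  have hE : 0 ≤ D.consErr B β F u := Real.sqrt_nonneg _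
  have hC := consistencyConst_nonneg (d := d) hT.one_le hM.nonneg
  have hM0 := hM.nonneg
  have hgc : Continuous (∇ u) := (contDiff_gradient (m := 0) hu (by norm_num)).continuous
  -- Split into the discrete error, controlled by the seminorm, and the interpolation error.
  have e : D.gradD uD - ∇ u =
      D.gradD (uD - D.interpB B β u) + (D.gradD (D.interpB B β u) - ∇ u) := by
    rw [gradD_sub]
    abel
  have h1 := D.normL2_gradD_le hd hΩ hT (uD - D.interpB B β u)
  have h2 := D.normL2_gradD_interpB_sub_le hd hΩ hT hβ hR hu hM
    (fun σ hσ y hy => D.eq_zero_on_extEdge hΩo hΩ hu hw hσ hy) hΩo.measurableSet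
  have h3 := D.sqrt_mul_seminormSq_le hd hΩo hΩ hα hB hF hu hf hw huD
    (by positivity : (0 : ℝ) ≤ 2 * d + 4 + 4 * T ^ 2 * d ^ 2)
  rw [e, normL2]
  refine (eLpNorm_add_le (D.aestronglyMeasurable_gradD hΩ _)
    ((D.aestronglyMeasurable_gradD hΩ _).sub hgc.aestronglyMeasurable) one_le_two).trans ?_
  refine (add_le_add (h1.trans (ENNReal.ofReal_le_ofReal h3)) h2).trans ?_
  rw [← ENNReal.ofReal_add (by positivity) (by positivity)]
  refine ENNReal.ofReal_le_ofReal ?_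
  have i1 : 0 ≤ Real.sqrt (2 * d + 4 + 4 * T ^ 2 * d ^ 2) / α * D.size := by positivity
  have i2 : 0 ≤ (consistencyConst d T M + M) * Real.sqrt (volume.real Ω) *
      D.consErr B β F u := by positivity
  linarith

end Main

theorem consErr_sushiFlux_le (hd : 0 < d) (hΩo : IsOpen Ω) (hΩ : Bornology.IsBounded Ω)
    {B : Finset D.Edge} {β : D.Edge → D.Cell → ℝ} {u f : Pt d → ℝ} (hu : ContDiff ℝ 2 u)
    (hw : IsWeakSolution Ω (idField d) f u) {T : ℝ} (hT : D.IsRegular B β T)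
    (hβ : D.IsBarycentric B β) {R M : ℝ} (hR : Ω ⊆ Metric.closedBall 0 R)
    (hM : IsTaylorBound u R M) :
    D.consErr B β (D.sushiFlux (idField d)) u ≤
      (consistencyConst d T M * (1 + Real.sqrt d * T + Real.sqrt d / d) + M) *
        Real.sqrt (d * volume.real Ω) * D.size := by
  have hC := consistencyConst_nonneg (d := d) hT.one_le hM.nonneg
  have hM0 := hM.nonneg
  have hT0 : 0 ≤ T := zero_le_one.trans hT.one_le
  refine D.consErr_le hd hΩ (by positivity) fun K σ hσ => ?_
  exact D.abs_sushiFlux_add_le hd hΩ hT hR hu hM (fun τ hτ =>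
    D.norm_gradKσ_interpB_sub_le hd hΩ hT hβ hR hu hM
      (fun σ hσ y hy => D.eq_zero_on_extEdge hΩo hΩ hu hw hσ hy) hτ) hσ

end Discretisation

end

theorem theorem4p2 {d : ℕ} (hd : 0 < d) (Ω : Set (Pt d)) (hΩ_open : IsOpen Ω)
    (hΩ_bdd : Bornology.IsBounded Ω) (hΩ_conn : IsConnected Ω) (hΩ_poly : IsPolyhedral Ω)
    (α θ : ℝ) (hα : 0 < α) :
    -- well-posedness of the scheme and error estimate for the solution
    (∃ C₁ : ℝ, 0 < C₁ ∧ ∀ u f : Pt d → ℝ, ContDiff ℝ 2 u → MemLp f 2 (volume.restrict Ω) →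
      IsWeakSolution Ω (idField d) f u →
      ∀ (D : Discretisation Ω) (B : Finset D.Edge) (β : D.Edge → D.Cell → ℝ),
        B ⊆ D.intEdges → D.IsBarycentric B β → D.regB B β ≤ θ →
        ∀ F : D.Fluxes, D.IsCoercive F α →
          (∃! w : D.X, D.IsSchemeSolution B β F f w) ∧
          ∀ uD : D.X, D.IsSchemeSolution B β F f uD →
            normL2 Ω (D.piM uD - D.projM u) ≤ ENNReal.ofReal (C₁ * D.consErr B β F u)) ∧
    -- error estimate for the gradient
    (∀ u : Pt d → ℝ, ContDiff ℝ 2 u → ∃ C₂ : ℝ, 0 < C₂ ∧ ∀ f : Pt d → ℝ,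
      MemLp f 2 (volume.restrict Ω) → IsWeakSolution Ω (idField d) f u →
      ∀ (D : Discretisation Ω) (B : Finset D.Edge) (β : D.Edge → D.Cell → ℝ),
        B ⊆ D.intEdges → D.IsBarycentric B β → D.regB B β ≤ θ →
        ∀ F : D.Fluxes, D.IsCoercive F α →
          ∀ uD : D.X, D.IsSchemeSolution B β F f uD →
            normL2 Ω (D.gradD uD - ∇ u) ≤
              ENNReal.ofReal (C₂ * (D.consErr B β F u + D.size))) ∧
    -- first order convergence for the SUSHI fluxes
    (∀ u : Pt d → ℝ, ContDiff ℝ 2 u → ∃ C₃ : ℝ, 0 < C₃ ∧ ∀ f : Pt d → ℝ,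
      MemLp f 2 (volume.restrict Ω) → IsWeakSolution Ω (idField d) f u →
      ∀ (D : Discretisation Ω) (B : Finset D.Edge) (β : D.Edge → D.Cell → ℝ),
        B ⊆ D.intEdges → D.IsBarycentric B β → D.regB B β ≤ θ →
          D.consErr B β (D.sushiFlux (idField d)) u ≤ C₃ * D.size ∧
          (∃! w : D.X, D.IsSchemeSolution B β (D.sushiFlux (idField d)) f w) ∧
          ∀ uD : D.X, D.IsSchemeSolution B β (D.sushiFlux (idField d)) f uD →
            normL2 Ω (D.piM uD - D.projM u) ≤ ENNReal.ofReal (C₃ * D.size) ∧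
            normL2 Ω (D.gradD uD - ∇ u) ≤ ENNReal.ofReal (C₃ * D.size)) := by
  obtain ⟨R, hR0, hR⟩ := hΩ_bdd.subset_closedBall_lt 0 0
  have hd' : (0 : ℝ) < d := Nat.cast_pos.2 hd
  have hreg : ∀ (D : Discretisation Ω) (B : Finset D.Edge) (β : D.Edge → D.Cell → ℝ),
      D.regB B β ≤ θ → D.IsRegular B β (max θ 1) :=
    fun D B β h => D.isRegular_of_regB_le hΩ_bdd h
  set T := max θ 1
  have hT0 : 0 < T := zero_lt_one.trans_le (le_max_right θ 1)
  refine ⟨⟨Real.sqrt ((4 * d + 4) * R ^ 2) / α, by positivity, ?_⟩, ?_, ?_⟩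
  · intro u f hu hf hw D B β hB _ _ F hF
    exact ⟨D.existsUnique_schemeSolution hd hΩ_bdd hα B β F hF f, fun uD huD =>
      D.normL2_piM_sub_projM_le hd hΩ_open hΩ_bdd hα hB hF hu hf hw huD hR0.le hR⟩
  · intro u hu
    obtain ⟨M, hM⟩ := exists_isTaylorBound hu R
    have hC := Discretisation.consistencyConst_nonneg (d := d) (le_max_right θ 1) hM.nonneg
    have hM0 := hM.nonneg
    refine ⟨Real.sqrt (2 * d + 4 + 4 * T ^ 2 * d ^ 2) / α +
      (Discretisation.consistencyConst d T M + M) * Real.sqrt (volume.real Ω), by positivity, ?_⟩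
    intro f hf hw D B β hB hβ hθ F hF uD huD
    exact D.normL2_gradD_sub_gradient_le hd hΩ_open hΩ_bdd hα hB hF hu hf hw huD
      (hreg D B β hθ) hβ hR hM
  · intro u hu
    obtain ⟨M, hM⟩ := exists_isTaylorBound hu R
    have hC := Discretisation.consistencyConst_nonneg (d := d) (le_max_right θ 1) hM.nonneg
    have hM0 := hM.nonneg
    -- The coercivity constant of the SUSHI fluxes, which depends only on `d` and `θ`; the general
    -- estimates are applied with it.
    set α₀ : ℝ := 1 / (2 + 2 * T ^ 2 * d)
    have hα₀ : 0 < α₀ := by positivity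
    set CE := (Discretisation.consistencyConst d T M *
      (1 + Real.sqrt d * T + Real.sqrt d / d) + M) * Real.sqrt (d * volume.real Ω) with hCE
    have hCE0 : 0 ≤ CE := by positivity
    set CP := Real.sqrt ((4 * d + 4) * R ^ 2) / α₀ with hCP
    have hCP0 : 0 ≤ CP := by positivity
    set CG := Real.sqrt (2 * d + 4 + 4 * T ^ 2 * d ^ 2) / α₀ +
      (Discretisation.consistencyConst d T M + M) * Real.sqrt (volume.real Ω) with hCG
    have hCG0 : 0 ≤ CG := by positivity
    -- One constant dominating all three bounds: `CE` for the consistency error, `CP * CE` for the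
    -- cell values, `CG * (CE + 1)` for the gradient. The final `1` makes it positive.
    refine ⟨CE + CP * CE + CG * (CE + 1) + 1, by positivity, ?_⟩
    intro f hf hw D B β hB hβ hθ
    have hT := hreg D B β hθ
    have hs0 : 0 ≤ D.size := Real.iSup_nonneg fun K => Metric.diam_nonneg
    have hF := D.isCoercive_sushiFlux hd hΩ_bdd hT
    have hE := D.consErr_sushiFlux_le hd hΩ_open hΩ_bdd hu hw hT hβ hR hM
    rw [← hCE] at hE
    have p1 : 0 ≤ CE * D.size := mul_nonneg hCE0 hs0
    have p2 : 0 ≤ CP * (CE * D.size) := mul_nonneg hCP0 p1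
    have p3 : 0 ≤ CG * (CE * D.size + D.size) := mul_nonneg hCG0 (add_nonneg p1 hs0)
    refine ⟨by linarith, D.existsUnique_schemeSolution hd hΩ_bdd hα₀ B β _ hF f,
      fun uD huD => ⟨?_, ?_⟩⟩
    · refine (D.normL2_piM_sub_projM_le hd hΩ_open hΩ_bdd hα₀ hB hF hu hf hw huD
        hR0.le hR).trans (ENNReal.ofReal_le_ofReal ?_)
      rw [← hCP]
      have := mul_le_mul_of_nonneg_left hE hCP0
      linarith
    · refine (D.normL2_gradD_sub_gradient_le hd hΩ_open hΩ_bdd hα₀ hB hF hu hf hw huD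
        hT hβ hR hM).trans (ENNReal.ofReal_le_ofReal ?_)
      rw [← hCG]
      have := mul_le_mul_of_nonneg_left (add_le_add_left hE D.size) hCG0
      linarith
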